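/- Let $k$ be an odd positive integer, let $\chi$ be a non-principal primitive Dirichlet character of modulus $k$, let $\bar\chi$ be its complex conjugate, and let $G(\chi)=\sum_{v=0}^{k-1}\chi(v)e^{2\pi i v/k}$ be its Gauss sum. For $\operatorname{Im} z>0$ and $s\in\mathbb{C}$ put $$A_1(z,s:\chi)=\sum_{n=1}^{\infty}\sum_{m=1}^{\infty}(-1)^m\chi(m)\chi(n)n^{s-1}e^{2\pi i mnz/k},\qquad H_1(z,s:\chi)=(1+e^{\pi i s})A_1(z,s:\chi).$$ Let $a,b,c,d$ be integers with $ad-bc=1$, $c>0$ and $c$ even, let $Tz=(az+b)/(cz+d)$, and let $s\in\mathbb{C}$ and $z=x+iy$ with $x>-d/c$, $y>0$. For integers $c'>0$, $j$ with $1\le j\le c'$, and $0\le\mu,\nu\le k-1$, and for $z'\in\mathbb{C}$ put $$f(z',s,c',d)=\int_{C}\frac{e^{-(\mu c'+j)(c'z'+d)u/c'}}{e^{-(c'z'+d)ku}-1}\,\frac{e^{(\nu+\{dj/c'\})u}}{e^{ku}-1}\,u^{s-1}\,du,$$ where $\{x\}=x-[x]$ and $[x]$ is the greatest integer not exceeding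 $x$, and where $u^{s-1}$ is taken with $0<\arg u<2\pi$. Here $C$ is a loop that begins at $+\infty$, proceeds in the upper half-plane, encircles the origin in the positive direction and returns to $+\infty$ in the lower half-plane, such that $u=0$ is the only zero of $(e^{-(c'z'+d)ku}-1)(e^{ku}-1)$ inside or on it; concretely, $C$ is the boundary of the $\delta$-neighbourhood of $[0,\infty)$ for any $\delta>0$ with this property. Only $(z',c')=(z,c)$ and $(z',c')=(2z,c/2)$ are used; for both, $c'z'+d=cz+d$, and the same loop $C$ serves. Such $\delta$ exist, the double series $A_1(Tz,s:\chi)$, $A_1(z,s:\chi)$, $A_1(z,s:\bar\chi)$ and the integrals $f$ below converge absolutely, and the following holds for every such $\delta$. All powers outside the integral are principal. If $a\equiv d\equiv 0\pmod k$, then $$\begin{aligned}G(\bar\chi)(cz+d)^{-s}H_1(Tz,s:\chi)={}&\bar\chi(b)\chi(c)G(\chi)H_1(z,s:\bar\chi)-\bar\chi(b)\chi(c)\Bigl(-\frac{k}{2\pi i}\Bigr)^{s}e^{-\pi i s}\sum_{\mu=0}^{k-1}\sum_{\nu=0}^{k-1}\Bigl\{\sum_{j=1}^{c}\bar\chi(\mu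 c+j)\,\chi\bigl([\tfrac{dj}{c}]-\nu\bigr)f(z,s,c,d)\\&-\sum_{j=1}^{c/2}2\bar\chi(2)\,\bar\chi\bigl(\tfrac{\mu c}{2}+j\bigr)\,\chi\bigl([\tfrac{2dj}{c}]-\nu\bigr)f(2z,s,\tfrac c2,d)\Bigr\}.\end{aligned}$$ If $b\equiv c\equiv 0\pmod k$, then $$\begin{aligned}(cz+d)^{-s}G(\bar\chi)H_1(Tz,s:\chi)={}&\bar\chi(a)\chi(d)G(\bar\chi)H_1(z,s:\chi)-\bar\chi(a)\chi(d)\Bigl(-\frac{k}{2\pi i}\Bigr)^{s}e^{-\pi i s}\sum_{\mu=0}^{k-1}\sum_{\nu=0}^{k-1}\Bigl\{\sum_{j=1}^{c}\chi(j)\,\bar\chi\bigl([\tfrac{dj}{c}]+d\mu-\nu\bigr)f(z,s,c,d)\\&-\sum_{j=1}^{c/2}2\chi(2)\,\chi(j)\,\bar\chi\bigl([\tfrac{2dj}{c}]+d\mu-\nu\bigr)f(2z,s,\tfrac c2,d)\Bigr\}.\end{aligned}$$ -/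

import Mathlib

open MeasureTheory Set

noncomputable section

namespace CharTransformation

/-- The complex conjugate character `χ̄`. -/
def conjChar {k : ℕ} (χ : DirichletCharacter ℂ k) : DirichletCharacter ℂ k :=
  χ.ringHomComp (starRingEnd ℂ)

/-- The Gauss sum `G(χ) = ∑_{v mod k} χ(v) exp(2πiv/k)`. -/
def G {k : ℕ} [NeZero k] (χ : DirichletCharacter ℂ k) : ℂ :=
  gaussSum χ (ZMod.stdAddChar (N := k))

/-- The quarter-plane `{x + iy : x > -d/c, y > 0}`. -/
def upperQuarterPlane (c d : ℤ) : Set ℂ :=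
  {z | -(d : ℝ) / (c : ℝ) < z.re ∧ 0 < z.im}

/-- The general term `(-1)^m χ(m) χ(n) n^(s-1) exp(2πimnz/k)` of the double series `A₁`. -/
def A₁Term {k : ℕ} (χ : DirichletCharacter ℂ k) (z s : ℂ) (n m : ℕ+) : ℂ :=
  (-1) ^ (m : ℕ) * χ ((m : ℕ) : ZMod k) * χ ((n : ℕ) : ZMod k) * ((n : ℕ) : ℂ) ^ (s - 1) *
    Complex.exp (2 * Real.pi * Complex.I * (m : ℕ) * (n : ℕ) * z / k)

/-- Absolute convergence of the double series `A₁(z, s : χ)`. -/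
def A₁Converges {k : ℕ} (χ : DirichletCharacter ℂ k) (z s : ℂ) : Prop :=
  Summable fun p : ℕ+ × ℕ+ => ‖A₁Term χ z s p.1 p.2‖

/-- `A₁(z, s : χ) = ∑_{n ≥ 1} ∑_{m ≥ 1} (-1)^m χ(m) χ(n) n^(s-1) exp(2πimnz/k)`. -/
def A₁ {k : ℕ} (χ : DirichletCharacter ℂ k) (z s : ℂ) : ℂ :=
  ∑' n : ℕ+, ∑' m : ℕ+, A₁Term χ z s n m

/-- `H₁(z, s : χ) = (1 + exp(πis)) A₁(z, s : χ)`. -/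
def H₁ {k : ℕ} (χ : DirichletCharacter ℂ k) (z s : ℂ) : ℂ :=
  (1 + Complex.exp (Real.pi * Complex.I * s)) * A₁ χ z s

/-- The power `u ^ s` for the branch `0 < arg u < 2π`: there `log u = log (-u) + πi`, with the
principal logarithm on the right. -/
def branchPow (u s : ℂ) : ℂ :=
  Complex.exp (s * (Complex.log (-u) + Real.pi * Complex.I))

/-- The nonnegative real axis in `ℂ`. -/
def nonnegAxis : Set ℂ := {u | 0 ≤ u.re ∧ u.im = 0}

/-- `δ` is small enough for the loop of radius `δ` around the nonnegative real axis: `u = 0` is the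
only zero of `(exp(-wku) - 1)(exp(ku) - 1)` inside or on the loop. -/
def IsLoopRadius (k : ℕ) (w : ℂ) (δ : ℝ) : Prop :=
  0 < δ ∧ ∀ u : ℂ, Metric.infDist u nonnegAxis ≤ δ →
    (Complex.exp (-w * k * u) - 1) * (Complex.exp (k * u) - 1) = 0 → u = 0

/-- The integral of `F` along the loop of radius `δ`, the boundary of the `δ`-neighbourhood of the
nonnegative real axis: from `+∞ + iδ` along a horizontal line to `iδ`, then counterclockwise along
the left half of the circle `|u| = δ` to `-iδ`, then along a horizontal line to `+∞ - iδ`. -/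
def loopIntegral (δ : ℝ) (F : ℂ → ℂ) : ℂ :=
  -(∫ x in Ioi (0 : ℝ), F (x + δ * Complex.I))
    + (∫ θ in (Real.pi / 2)..(3 * Real.pi / 2),
        F (δ * Complex.exp (θ * Complex.I)) * (δ * Complex.I * Complex.exp (θ * Complex.I)))
    + ∫ x in Ioi (0 : ℝ), F (x - δ * Complex.I)

/-- Absolute convergence of the integral of `F` along the loop of radius `δ`. -/
def LoopIntegrable (δ : ℝ) (F : ℂ → ℂ) : Prop :=
  IntegrableOn (fun x : ℝ => F (x + δ * Complex.I)) (Ioi 0) ∧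
  IntervalIntegrable (fun θ : ℝ =>
    F (δ * Complex.exp (θ * Complex.I)) * (δ * Complex.I * Complex.exp (θ * Complex.I)))
    volume (Real.pi / 2) (3 * Real.pi / 2) ∧
  IntegrableOn (fun x : ℝ => F (x - δ * Complex.I)) (Ioi 0)

/-- The integrand of `f(z, s, c, d)`, which depends also on `k`, `μ`, `ν` and `j`. -/
def fIntegrand (k μ ν : ℕ) (j : ℤ) (z s : ℂ) (c d : ℤ) (u : ℂ) : ℂ :=
  Complex.exp (-(μ * c + j) * (c * z + d) * u / c) / (Complex.exp (-(c * z + d) * k * u) - 1) *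
    (Complex.exp ((ν + (Int.fract ((d * j : ℝ) / c) : ℝ)) * u) / (Complex.exp (k * u) - 1)) *
    branchPow u (s - 1)

/-- The contour integral `f(z, s, c, d)`, along the loop of radius `δ`. -/
def f (δ : ℝ) (k μ ν : ℕ) (j : ℤ) (z s : ℂ) (c d : ℤ) : ℂ :=
  loopIntegral δ (fIntegrand k μ ν j z s c d)

end CharTransformation

end

/-! Write `w = cz + d`. With `M = μc + j` and `N = cν + (dj mod c)`, a triple sum over `μ, ν, j`
becomes a sum over pairs `0 < M ≤ kc`, `0 ≤ N < kc` with `N ≡ dM (mod c)`. Its weight is `ψ⁻¹(M)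
ψ((dM - N)/c)`, and the integrand of `f` becomes `kern α (-wku) * kern β (ku) * u^(s-1)` with `α =
M/(kc)` and `β = N/(kc)`. The weight vanishes when `k` divides `M` or `N`, so only `0 < α, β < 1`
matters; there the integrand decays exponentially in every direction away from its poles.

The loop integral is then minus `2πi` times the sum of the residues at `±2πin/k` and `±2πin/(kw)`.
The residue theorem is applied after `u = exp t`: the outside of a small circle becomes a
half-strip, the rays of poles become horizontal, and `0 < arg w < π/2` separates the two rays with
`0 < Im t < π` (`hasSum_residues_of_strip`, `hasSum_residueTerm_half`). The lower half-plane is the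
upper one shifted by `πi`, which replaces `(α, β)` by `(1 - α, 1 - β)` and costs `exp (πis)`. The
reflection `(M, N) ↦ (kc - M, kc - N)` preserves the weights, so both halves have the same weighted
sum; this produces the factor `1 + exp (πis)`.

At `2πin/k` the sum over `N` for fixed `M` is a Gauss sum of `ψ`, and the sum over `M` of the other
kernel is a geometric expansion: together they give a character series at `z`. At `2πin/(kw)` one
fixes `N` and writes `M = aN + cy`; the congruences on the matrix make the weight factor as `κ θ(N)
θ⁻¹(y)`, and the same two steps give the series of `θ` at `Tz`. The outcome is `sum_mul_f`, a
transformation formula for the series without the sign `(-1)^m`.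

The sign is restored by `(-1)^m = 2·[m even] - 1`, which gives `A₁_eq_charSum`. Since `2Tz` is the
image of `2z` under the matrix with rows `(a, 2b)` and `(c/2, d)`, which has the same `cz + d`,
`sum_mul_f` is used for both matrices with the same loop. The two cases of the theorem are `ψ = θ =
χ` and `ψ = χ⁻¹`, `θ = χ`. -/

noncomputable section

namespace CharTransformation

open Filter Topology

/-! ### The residue theorem for a rectangle -/

/-- The integral of `f` along the positively oriented boundary of `[a, b] × [c, d]`. -/
def rectIntegral (f : ℂ → ℂ) (a b c d : ℝ) : ℂ :=
  (∫ x : ℝ in a..b, f (x + c * Complex.I)) - (∫ x : ℝ in a..b, f (x + d * Complex.I)) +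
    Complex.I * (∫ y : ℝ in c..d, f (b + y * Complex.I)) -
    Complex.I * (∫ y : ℝ in c..d, f (a + y * Complex.I))

/-- The closed rectangle `[a, b] × [c, d]`. -/
def closedRect (a b c d : ℝ) : Set ℂ := {t | t.re ∈ Icc a b ∧ t.im ∈ Icc c d}

/-- The open rectangle `(a, b) × (c, d)`. -/
def openRect (a b c d : ℝ) : Set ℂ := {t | t.re ∈ Ioo a b ∧ t.im ∈ Ioo c d}

lemma isOpen_openRect (a b c d : ℝ) : IsOpen (openRect a b c d) :=
  (isOpen_Ioo.preimage Complex.continuous_re).inter (isOpen_Ioo.preimage Complex.continuous_im)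

lemma openRect_subset_closedRect (a b c d : ℝ) : openRect a b c d ⊆ closedRect a b c d :=
  fun _ h => ⟨Ioo_subset_Icc_self h.1, Ioo_subset_Icc_self h.2⟩

variable {a b c d : ℝ}

lemma rectIntegral_eq_zero {f : ℂ → ℂ} (hab : a ≤ b) (hcd : c ≤ d)
    (hf : ∀ t ∈ closedRect a b c d, DifferentiableAt ℂ f t) : rectIntegral f a b c d = 0 := by
  have h := Complex.integral_boundary_rect_eq_zero_of_differentiableOn f ⟨a, c⟩ ⟨b, d⟩
    (fun t ht => (hf t ?_).differentiableWithinAt)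
  · simpa [rectIntegral] using h
  · simpa [closedRect, Complex.mem_reProdIm, uIcc_of_le hab, uIcc_of_le hcd] using ht

lemma intervalIntegrable_horizontal {f : ℂ → ℂ} {y : ℝ} (hab : a ≤ b)
    (hf : ∀ x ∈ Icc a b, ContinuousAt f (x + y * Complex.I)) :
    IntervalIntegrable (fun x : ℝ => f (x + y * Complex.I)) volume a b := by
  refine ContinuousOn.intervalIntegrable fun x hx => ?_
  rw [uIcc_of_le hab] at hx
  exact ((hf x hx).comp (f := fun x : ℝ => (x + y * Complex.I : ℂ))
    (by fun_prop)).continuousWithinAt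

lemma intervalIntegrable_vertical {f : ℂ → ℂ} {x : ℝ} (hcd : c ≤ d)
    (hf : ∀ y ∈ Icc c d, ContinuousAt f (x + y * Complex.I)) :
    IntervalIntegrable (fun y : ℝ => f (x + y * Complex.I)) volume c d := by
  refine ContinuousOn.intervalIntegrable fun y hy => ?_
  rw [uIcc_of_le hcd] at hy
  exact ((hf y hy).comp (f := fun y : ℝ => (x + y * Complex.I : ℂ))
    (by fun_prop)).continuousWithinAt

lemma mem_boundary_bottom {x : ℝ} (hcd : c ≤ d) (hx : x ∈ Icc a b) :
    (x + c * Complex.I : ℂ) ∈ closedRect a b c d \ openRect a b c d := by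
  simp only [closedRect, openRect, Set.mem_sdiff, mem_ofPred_eq]; simp [hx.1, hx.2, hcd]

lemma mem_boundary_top {x : ℝ} (hcd : c ≤ d) (hx : x ∈ Icc a b) :
    (x + d * Complex.I : ℂ) ∈ closedRect a b c d \ openRect a b c d := by
  simp only [closedRect, openRect, Set.mem_sdiff, mem_ofPred_eq]; simp [hx.1, hx.2, hcd]

lemma mem_boundary_left {y : ℝ} (hab : a ≤ b) (hy : y ∈ Icc c d) :
    (a + y * Complex.I : ℂ) ∈ closedRect a b c d \ openRect a b c d := by
  simp only [closedRect, openRect, Set.mem_sdiff, mem_ofPred_eq]; simp [hy.1, hy.2, hab]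

lemma mem_boundary_right {y : ℝ} (hab : a ≤ b) (hy : y ∈ Icc c d) :
    (b + y * Complex.I : ℂ) ∈ closedRect a b c d \ openRect a b c d := by
  simp only [closedRect, openRect, Set.mem_sdiff, mem_ofPred_eq]; simp [hy.1, hy.2, hab]

lemma rectIntegral_congr {f g : ℂ → ℂ} (hab : a ≤ b) (hcd : c ≤ d)
    (h : ∀ t ∈ closedRect a b c d \ openRect a b c d, f t = g t) :
    rectIntegral f a b c d = rectIntegral g a b c d := by
  unfold rectIntegral
  congr 1
  · congr 1
    · congr 1 <;> refine intervalIntegral.integral_congr fun x hx => ?_ <;>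
        rw [uIcc_of_le hab] at hx
      exacts [h _ (mem_boundary_bottom hcd hx), h _ (mem_boundary_top hcd hx)]
    · congr 1
      refine intervalIntegral.integral_congr fun x hx => ?_
      rw [uIcc_of_le hcd] at hx
      exact h _ (mem_boundary_right hab hx)
  · congr 1
    refine intervalIntegral.integral_congr fun x hx => ?_
    rw [uIcc_of_le hcd] at hx
    exact h _ (mem_boundary_left hab hx)

lemma rectIntegral_sub {f g : ℂ → ℂ} (hab : a ≤ b) (hcd : c ≤ d)
    (hf : ∀ t ∈ closedRect a b c d \ openRect a b c d, ContinuousAt f t)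
    (hg : ∀ t ∈ closedRect a b c d \ openRect a b c d, ContinuousAt g t) :
    rectIntegral (fun t => f t - g t) a b c d =
      rectIntegral f a b c d - rectIntegral g a b c d := by
  unfold rectIntegral
  rw [intervalIntegral.integral_sub, intervalIntegral.integral_sub, intervalIntegral.integral_sub,
    intervalIntegral.integral_sub]
  · ring
  all_goals first | apply intervalIntegrable_horizontal hab | apply intervalIntegrable_vertical hcd
  all_goals intro x hx
  exacts [hf _ (mem_boundary_left hab hx), hg _ (mem_boundary_left hab hx),
    hf _ (mem_boundary_right hab hx), hg _ (mem_boundary_right hab hx),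
    hf _ (mem_boundary_top hcd hx), hg _ (mem_boundary_top hcd hx),
    hf _ (mem_boundary_bottom hcd hx), hg _ (mem_boundary_bottom hcd hx)]

lemma rectIntegral_const_mul (r : ℂ) (f : ℂ → ℂ) :
    rectIntegral (fun t => r * f t) a b c d = r * rectIntegral f a b c d := by
  simp only [rectIntegral, intervalIntegral.integral_const_mul]
  ring

lemma integral_horizontal_eq_sub {F f : ℂ → ℂ} {y : ℝ} (hab : a ≤ b)
    (hF : ∀ x ∈ Icc a b, HasDerivAt F (f (x + y * Complex.I)) (x + y * Complex.I))
    (hf : ∀ x ∈ Icc a b, ContinuousAt f (x + y * Complex.I)) :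
    ∫ x : ℝ in a..b, f (x + y * Complex.I) = F (b + y * Complex.I) - F (a + y * Complex.I) := by
  refine intervalIntegral.integral_eq_sub_of_hasDerivAt
    (f := fun x : ℝ => F (x + y * Complex.I)) (fun x hx => ?_)
    (intervalIntegrable_horizontal hab hf)
  rw [uIcc_of_le hab] at hx
  have h1 : HasDerivAt (fun x : ℝ => (x + y * Complex.I : ℂ)) 1 x :=
    (Complex.ofRealCLM.hasDerivAt (x := x)).add_const _
  have := (hF x hx).comp x h1
  rwa [mul_one] at this

lemma integral_vertical_eq_sub {F f : ℂ → ℂ} {x : ℝ} (hcd : c ≤ d)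
    (hF : ∀ y ∈ Icc c d, HasDerivAt F (f (x + y * Complex.I)) (x + y * Complex.I))
    (hf : ∀ y ∈ Icc c d, ContinuousAt f (x + y * Complex.I)) :
    Complex.I * ∫ y : ℝ in c..d, f (x + y * Complex.I) =
      F (x + d * Complex.I) - F (x + c * Complex.I) := by
  rw [← intervalIntegral.integral_const_mul]
  refine intervalIntegral.integral_eq_sub_of_hasDerivAt
    (f := fun y : ℝ => F (x + y * Complex.I)) (fun y hy => ?_)
    ((intervalIntegrable_vertical hcd hf).const_mul _)
  rw [uIcc_of_le hcd] at hy
  have h1 : HasDerivAt (fun y : ℝ => (x + y * Complex.I : ℂ)) Complex.I y := by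
    simpa using ((Complex.ofRealCLM.hasDerivAt (x := y)).mul_const Complex.I).const_add (x : ℂ)
  have := (hF y hy).comp y h1
  rwa [mul_comm] at this

lemma log_sub_log_neg_of_im_pos {z : ℂ} (hz : 0 < z.im) :
    Complex.log z - Complex.log (-z) = Real.pi * Complex.I := by
  simp only [Complex.log, norm_neg, Complex.arg_neg_eq_arg_sub_pi_of_im_pos hz]
  push_cast; ring

lemma log_sub_log_neg_of_im_neg {z : ℂ} (hz : z.im < 0) :
    Complex.log z - Complex.log (-z) = -(Real.pi * Complex.I) := by
  simp only [Complex.log, norm_neg, Complex.arg_neg_eq_arg_add_pi_of_im_neg hz]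
  push_cast; ring

/-- `log (t - p)` is a primitive along the bottom, right and top sides, and `log (-(t - p))` along
the left side, which crosses the branch cut of the former. The two primitives differ by `πi` at the
upper left corner and by `-πi` at the lower left one. -/
lemma rectIntegral_inv_sub {p : ℂ} (hp : p ∈ openRect a b c d) :
    rectIntegral (fun t => (t - p)⁻¹) a b c d = 2 * Real.pi * Complex.I := by
  obtain ⟨⟨h1, h2⟩, h3, h4⟩ := hp
  have hab : a ≤ b := (h1.trans h2).le
  have hcd : c ≤ d := (h3.trans h4).le
  have key : ∀ t : ℂ, t - p ∈ Complex.slitPlane →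
      HasDerivAt (fun t => Complex.log (t - p)) ((t - p)⁻¹) t := fun t ht => by
    have := ((hasDerivAt_id t).sub_const p).clog ht
    simpa using this
  have key' : ∀ t : ℂ, -(t - p) ∈ Complex.slitPlane →
      HasDerivAt (fun t => Complex.log (-(t - p))) ((t - p)⁻¹) t := fun t ht => by
    have := ((hasDerivAt_id t).sub_const p).neg.clog ht
    have e : (t - p)⁻¹ = -1 / -(t - p) := by rw [neg_div_neg_eq, one_div]
    rw [e]
    exact this
  have hne : ∀ t : ℂ, t - p ≠ 0 → ContinuousAt (fun t : ℂ => (t - p)⁻¹) t := fun t ht =>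
    (continuousAt_id.sub continuousAt_const).inv₀ ht
  have ne1 : ∀ t : ℂ, t - p ∈ Complex.slitPlane → t - p ≠ 0 := fun t => Complex.slitPlane_ne_zero
  have ne2 : ∀ t : ℂ, -(t - p) ∈ Complex.slitPlane → t - p ≠ 0 := fun t ht =>
    neg_ne_zero.1 (Complex.slitPlane_ne_zero ht)
  have sb : ∀ x : ℝ, (x + c * Complex.I - p : ℂ) ∈ Complex.slitPlane := fun x =>
    Or.inr (by simp; linarith)
  have st : ∀ x : ℝ, (x + d * Complex.I - p : ℂ) ∈ Complex.slitPlane := fun x =>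
    Or.inr (by simp; linarith)
  have sr : ∀ y : ℝ, (b + y * Complex.I - p : ℂ) ∈ Complex.slitPlane := fun y =>
    Or.inl (by simp; linarith)
  have sl : ∀ y : ℝ, -(a + y * Complex.I - p : ℂ) ∈ Complex.slitPlane := fun y =>
    Or.inl (by simp; linarith)
  unfold rectIntegral
  rw [integral_horizontal_eq_sub hab (fun x _ => key _ (sb x)) (fun x _ => hne _ (ne1 _ (sb x))),
    integral_horizontal_eq_sub hab (fun x _ => key _ (st x)) (fun x _ => hne _ (ne1 _ (st x))),
    integral_vertical_eq_sub hcd (fun x _ => key _ (sr x)) (fun x _ => hne _ (ne1 _ (sr x))),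
    integral_vertical_eq_sub hcd (fun x _ => key' _ (sl x)) (fun x _ => hne _ (ne2 _ (sl x)))]
  have e1 := log_sub_log_neg_of_im_pos (z := a + d * Complex.I - p) (by simp; linarith)
  have e2 := log_sub_log_neg_of_im_neg (z := a + c * Complex.I - p) (by simp; linarith)
  linear_combination e1 - e2

/-- Induction on the set of poles, with `f` universally quantified: subtract `r p / (t - p)`, whose
integral is known, and fill in the removable singularity that remains at `p`. -/
theorem rectIntegral_eq_sum_residues (hab : a ≤ b) (hcd : c ≤ d) (r : ℂ → ℂ) (S : Finset ℂ) :
    ∀ f : ℂ → ℂ, (∀ t ∈ closedRect a b c d, t ∉ S → DifferentiableAt ℂ f t) →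
      (∀ p ∈ S, p ∈ openRect a b c d) →
      (∀ p ∈ S, Tendsto (fun t => (t - p) * f t) (𝓝[≠] p) (𝓝 (r p))) →
      rectIntegral f a b c d = 2 * Real.pi * Complex.I * ∑ p ∈ S, r p := by
  classical
  induction S using Finset.induction_on with
  | empty => intro f hf _ _; simpa using rectIntegral_eq_zero hab hcd (fun t ht => hf t ht (by simp))
  | insert p S hpS ih =>
    intro f hf hS hr
    have hpR := hS p (Finset.mem_insert_self _ _)
    set F : ℂ → ℂ := fun t => f t - r p * (t - p)⁻¹ with hF
    set g : ℂ → ℂ := Function.update F p (limUnder (𝓝[≠] p) F) with hg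
    have hFd : ∀ t, t ≠ p → DifferentiableAt ℂ f t → DifferentiableAt ℂ F t := fun t ht h =>
      h.sub (((differentiableAt_id.sub_const p).inv (sub_ne_zero.2 ht)).const_mul _)
    have hgF : ∀ t, t ≠ p → g =ᶠ[𝓝 t] F := fun t ht => by
      filter_upwards [isOpen_ne.mem_nhds ht] with u hu
      exact Function.update_of_ne hu _ _
    have hgd : ∀ t ∈ closedRect a b c d, t ∉ S → DifferentiableAt ℂ g t := by
      intro t ht htS
      by_cases htp : t = p
      · subst htp
        have hs : openRect a b c d ∩ (S : Set ℂ)ᶜ ∈ 𝓝 t :=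
          ((isOpen_openRect a b c d).inter S.finite_toSet.isClosed.isOpen_compl).mem_nhds
            ⟨hpR, htS⟩
        refine (Complex.differentiableOn_update_limUnder_of_isLittleO hs ?_ ?_).differentiableAt hs
        · rintro u ⟨⟨hu1, hu2⟩, hu3⟩
          have hu3 : u ≠ t := hu3
          refine (hFd u hu3 (hf u (openRect_subset_closedRect _ _ _ _ hu1) ?_)).differentiableWithinAt
          simpa [hu3] using hu2
        · rw [Asymptotics.isLittleO_iff_tendsto' (by
            filter_upwards [self_mem_nhdsWithin] with u hu h0
            exact absurd h0 (inv_ne_zero (sub_ne_zero.2 hu)))]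
          have h1 := hr t (Finset.mem_insert_self _ _)
          -- The removable singularity criterion is about `F u - F t`, so the meaningless value of
          -- `F` at the pole enters as a constant; the factor `u - t` kills it.
          have h2 : Tendsto (fun u => (u - t) * F t) (𝓝[≠] t) (𝓝 0) := by
            have : Tendsto (fun u => (u - t) * F t) (𝓝 t) (𝓝 ((t - t) * F t)) :=
              Continuous.tendsto (by fun_prop) t
            simpa using this.mono_left nhdsWithin_le_nhds
          have h3 := (h1.sub_const (r t)).sub h2
          simp only [sub_self] at h3
          refine h3.congr' ?_
          filter_upwards [self_mem_nhdsWithin] with u hu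
          have hu' : u - t ≠ 0 := sub_ne_zero.2 hu
          rw [div_inv_eq_mul]
          simp only [hF]
          field_simp
      · refine (hFd t htp (hf t ht ?_)).congr_of_eventuallyEq (hgF t htp)
        simp [htp, htS]
    have hgr : ∀ q ∈ S, Tendsto (fun t => (t - q) * g t) (𝓝[≠] q) (𝓝 (r q)) := by
      intro q hq
      have hqp : q ≠ p := fun h => hpS (h ▸ hq)
      have h1 := hr q (Finset.mem_insert_of_mem hq)
      have h2 : Tendsto (fun u => (u - q) * (r p * (u - p)⁻¹)) (𝓝[≠] q) (𝓝 0) := by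
        have : ContinuousAt (fun u => (u - q) * (r p * (u - p)⁻¹)) q := by
          refine (by fun_prop : ContinuousAt (fun u => u - q) q).mul (continuousAt_const.mul ?_)
          exact (continuousAt_id.sub continuousAt_const).inv₀ (sub_ne_zero.2 hqp)
        have h := this.tendsto.mono_left (nhdsWithin_le_nhds (s := {q}ᶜ))
        simpa using h
      have h3 := h1.sub h2
      rw [sub_zero] at h3
      refine h3.congr' ?_
      filter_upwards [(hgF q hqp).filter_mono nhdsWithin_le_nhds] with u hu
      rw [hu]; simp only [hF]; ring
    have hI := ih g hgd (fun q hq => hS q (Finset.mem_insert_of_mem hq)) hgr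
    have hbd : ∀ t ∈ closedRect a b c d \ openRect a b c d, t ≠ p := fun t ht h => ht.2 (h ▸ hpR)
    rw [rectIntegral_congr hab hcd (g := F)
      (fun t ht => Function.update_of_ne (hbd t ht) _ _), hF,
      rectIntegral_sub hab hcd, rectIntegral_const_mul, rectIntegral_inv_sub hpR] at hI
    · rw [Finset.sum_insert hpS]
      linear_combination hI
    · intro t ht
      exact (hf t ht.1 (fun h => ht.2 (hS t h))).continuousAt
    · intro t ht
      exact continuousAt_const.mul
        ((continuousAt_id.sub continuousAt_const).inv₀ (sub_ne_zero.2 (hbd t ht)))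

/-! ### The kernel `exp (αv) / (exp v - 1)` -/

/-- The function `exp (αv) / (exp v - 1)`. -/
def kern (α : ℝ) (v : ℂ) : ℂ := Complex.exp (α * v) / (Complex.exp v - 1)

lemma differentiableAt_kern {α : ℝ} {v : ℂ} (hv : Complex.exp v ≠ 1) :
    DifferentiableAt ℂ (kern α) v := by
  unfold kern
  exact DifferentiableAt.div (by fun_prop) (by fun_prop) (sub_ne_zero.2 hv)

/-- The symmetry that reduces bounds to `Re v > 0` and later the lower half-plane to the upper. -/
lemma kern_neg (α : ℝ) (v : ℂ) : kern α (-v) = -kern (1 - α) v := by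
  unfold kern
  have h1 : Complex.exp (((1 - α : ℝ) : ℂ) * v) = Complex.exp v * Complex.exp (α * -v) := by
    rw [← Complex.exp_add]; congr 1; push_cast; ring
  have h2 : Complex.exp v - 1 = -(Complex.exp v * (Complex.exp (-v) - 1)) := by
    rw [mul_sub, ← Complex.exp_add]; simp
  rw [h1, h2, div_neg, neg_neg, mul_div_mul_left _ _ (Complex.exp_ne_zero v)]

lemma exp_ne_one_of_re_ne_zero {v : ℂ} (hv : v.re ≠ 0) : Complex.exp v ≠ 1 := by
  intro h
  have := congrArg norm h
  rw [Complex.norm_exp, norm_one, Real.exp_eq_one_iff] at this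
  exact hv this

lemma abs_exp_re_sub_one_le (v : ℂ) : |Real.exp v.re - 1| ≤ ‖Complex.exp v - 1‖ := by
  have := abs_norm_sub_norm_le (Complex.exp v) 1
  rwa [Complex.norm_exp, norm_one] at this

lemma norm_kern_le_of_le_re {α r : ℝ} (hr : 0 < r) {v : ℂ} (hv : r ≤ v.re) :
    ‖kern α v‖ ≤ Real.exp (-(1 - α) * v.re) / (1 - Real.exp (-r)) := by
  have hr1 : Real.exp (-r) < 1 := Real.exp_lt_one_iff.2 (by linarith)
  have hnum : ‖Complex.exp (α * v)‖ = Real.exp (α * v.re) := by simp [Complex.norm_exp]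
  unfold kern
  rw [norm_div, hnum]
  have h1 : Real.exp v.re * (1 - Real.exp (-r)) ≤ ‖Complex.exp v - 1‖ := by
    refine le_trans ?_ ((abs_exp_re_sub_one_le v).trans' (le_abs_self _))
    rw [mul_sub, ← Real.exp_add, mul_one]
    have : 1 ≤ Real.exp (v.re + -r) := Real.one_le_exp (by linarith)
    linarith
  have h2 : Real.exp (α * v.re) = Real.exp (-(1 - α) * v.re) * Real.exp v.re := by
    rw [← Real.exp_add]; congr 1; ring
  calc _ ≤ Real.exp (-(1 - α) * v.re) * Real.exp v.re /
        (Real.exp v.re * (1 - Real.exp (-r))) := by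
          rw [h2]
          gcongr
    _ = _ := by
      have := (Real.exp_pos v.re).ne'
      have : 1 - Real.exp (-r) ≠ 0 := by linarith
      field_simp

/-- The kernel behaves like `exp (-(1 - α)x)` to the right and `exp (αx)` to the left, so for `0 < α
< 1` it decays on both sides of the imaginary axis. -/
lemma norm_kern_le {α r : ℝ} (hr : 0 < r) {v : ℂ} (hv : r ≤ |v.re|) :
    ‖kern α v‖ ≤ Real.exp (-(min α (1 - α)) * |v.re|) / (1 - Real.exp (-r)) := by
  have hr1 : Real.exp (-r) < 1 := Real.exp_lt_one_iff.2 (by linarith)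
  rcases le_or_gt 0 v.re with h | h
  · rw [abs_of_nonneg h] at hv ⊢
    refine (norm_kern_le_of_le_re hr hv).trans ?_
    gcongr
    exact min_le_right α (1 - α)
  · rw [abs_of_neg h] at hv ⊢
    have := norm_kern_le_of_le_re (α := 1 - α) hr (v := -v) (by simpa using hv)
    rw [← norm_neg, ← kern_neg, neg_neg, sub_sub_cancel, Complex.neg_re] at this
    refine this.trans ?_
    have h0 : 0 ≤ -v.re := by linarith
    have h1 := min_le_left α (1 - α)
    gcongr

/-- These circles pass midway between the poles `2πin`. Where `|Re v| < 1`, `|Im v|` is within `1`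
of `(2N + 1)π`, so `cos (Im v) ≤ 0`, the denominator has modulus at least `1` and the numerator at
most `e`; elsewhere `norm_kern_le` gives the bound. -/
lemma norm_kern_le_of_norm_eq {α : ℝ} (hα0 : 0 ≤ α) (hα1 : α ≤ 1) (N : ℕ) {v : ℂ}
    (hv : ‖v‖ = 2 * Real.pi * N + Real.pi) : ‖kern α v‖ ≤ 3 := by
  have hpi := Real.pi_gt_three
  rcases le_or_gt 1 |v.re| with h | h
  · refine (norm_kern_le one_pos h).trans ?_
    have h1 : Real.exp (-(min α (1 - α)) * |v.re|) ≤ 1 := by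
      apply Real.exp_le_one_iff.2
      have : 0 ≤ min α (1 - α) := le_min hα0 (by linarith)
      nlinarith [abs_nonneg v.re]
    have h2 : Real.exp (-1) < 1 / 2 := by
      rw [Real.exp_neg, one_div]
      exact inv_strictAnti₀ two_pos (by linarith [Real.exp_one_gt_d9])
    rw [div_le_iff₀ (by linarith)]
    linarith
  · have hsq : v.re ^ 2 + v.im ^ 2 = (2 * Real.pi * N + Real.pi) ^ 2 := by
      rw [← hv, Complex.sq_norm, Complex.normSq_apply]; ring
    set R := 2 * Real.pi * N + Real.pi with hR
    have hRpi : Real.pi ≤ R := by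
      have : 0 ≤ 2 * Real.pi * N := by positivity
      linarith
    have hre2 : v.re ^ 2 < 1 := by
      rw [← sq_abs]; nlinarith [abs_nonneg v.re]
    have him1 : |v.im| ≤ R := abs_le_of_sq_le_sq (by nlinarith [sq_nonneg v.re]) (by linarith)
    have him2 : R - 1 ≤ |v.im| := by
      by_contra! hlt
      have : |v.im| ^ 2 < (R - 1) ^ 2 := by
        apply pow_lt_pow_left₀ hlt (abs_nonneg _) two_ne_zero
      rw [sq_abs] at this
      nlinarith
    have hcos : Real.cos v.im ≤ 0 := by
      rw [← Real.cos_abs, ← Real.cos_sub_nat_mul_two_pi _ N]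
      apply Real.cos_nonpos_of_pi_div_two_le_of_le <;> linarith
    have hre : (Complex.exp v).re ≤ 0 := by
      rw [Complex.exp_re]
      exact mul_nonpos_of_nonneg_of_nonpos (Real.exp_pos _).le hcos
    have h1 : 1 ≤ ‖Complex.exp v - 1‖ := by
      refine le_trans ?_ (Complex.abs_re_le_norm _)
      rw [Complex.sub_re, Complex.one_re, abs_of_nonpos (by linarith)]
      linarith
    have h2 : ‖Complex.exp (α * v)‖ ≤ 3 := by
      rw [Complex.norm_exp]
      have : (α * v : ℂ).re ≤ 1 := by
        simp only [Complex.mul_re, Complex.ofReal_re, Complex.ofReal_im, zero_mul, sub_zero]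
        nlinarith [le_abs_self v.re]
      refine (Real.exp_le_exp.2 this).trans ?_
      linarith [Real.exp_one_lt_d9]
    unfold kern
    rw [norm_div]
    exact (div_le_self (norm_nonneg _) h1).trans h2

/-! ### Functions with doubly exponential decay -/

lemma exp_linear_mul_exp_neg_le {σ κ x₀ : ℝ} (hκ : 0 < κ) :
    ∃ C : ℝ, 0 < C ∧ ∀ x, x₀ ≤ x →
      Real.exp (σ * x) * Real.exp (-(2 * κ) * Real.exp x) ≤ C * Real.exp (-κ * Real.exp x) := by
  suffices ∃ D : ℝ, ∀ x, x₀ ≤ x → σ * x - κ * Real.exp x ≤ D by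
    obtain ⟨D, hD⟩ := this
    refine ⟨Real.exp D, Real.exp_pos _, fun x hx => ?_⟩
    rw [← Real.exp_add, ← Real.exp_add]
    exact Real.exp_le_exp.2 (by linarith [hD x hx])
  rcases le_or_gt σ 0 with h | h
  · refine ⟨σ * x₀, fun x hx => ?_⟩
    nlinarith [Real.exp_pos x]
  -- The maximum of `σx - κ exp x`, attained where `exp x = σ/κ`.
  · refine ⟨σ * (Real.log (σ / κ) - 1), fun x _ => ?_⟩
    have h1 := Real.add_one_le_exp (x - Real.log (σ / κ))
    rw [Real.exp_sub, Real.exp_log (by positivity), le_div_iff₀ (by positivity)] at h1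
    have h2 : (x - Real.log (σ / κ) + 1) * σ ≤ Real.exp x * κ := by
      have := mul_le_mul_of_nonneg_right h1 hκ.le
      rwa [mul_assoc, div_mul_cancel₀ _ hκ.ne'] at this
    linarith

lemma integrableOn_horizontal {f : ℂ → ℂ} {x₀ θ C κ : ℝ} (hκ : 0 < κ)
    (hf : ∀ x : ℝ, x₀ ≤ x → ContinuousAt f (x + θ * Complex.I))
    (hb : ∀ x : ℝ, x₀ ≤ x → ‖f (x + θ * Complex.I)‖ ≤ C * Real.exp (-κ * Real.exp x)) :
    IntegrableOn (fun x : ℝ => f (x + θ * Complex.I)) (Ioi x₀) := by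
  have hc : ContinuousOn (fun x : ℝ => f (x + θ * Complex.I)) (Ici x₀) := fun x hx =>
    ((hf x hx).comp (f := fun x : ℝ => (x + θ * Complex.I : ℂ)) (by fun_prop)).continuousWithinAt
  rw [IntegrableOn, ← integrable_norm_iff
    ((hc.mono Ioi_subset_Ici_self).aestronglyMeasurable measurableSet_Ioi)]
  refine integrable_of_isBigO_exp_neg hκ hc.norm ?_
  · refine Asymptotics.IsBigO.of_bound |C| ?_
    filter_upwards [eventually_ge_atTop x₀] with x hx
    rw [norm_norm]
    refine (hb x hx).trans ?_
    rw [Real.norm_eq_abs, abs_of_pos (Real.exp_pos _)]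
    refine mul_le_mul (le_abs_self _) (Real.exp_le_exp.2 ?_) (Real.exp_pos _).le (abs_nonneg _)
    nlinarith [Real.add_one_le_exp x]

/-! ### Summing the residues on one ray of poles -/

/-- The argument of the kernel in logarithmic coordinates: the poles of `kern α (rayArg ε p t)`
with `|Im (t - p)| < π` are `p + log n` for positive integers `n`. -/
def rayArg (ε : ℝ) (p t : ℂ) : ℂ := ε * (2 * Real.pi * Complex.I * Complex.exp (t - p))

section

variable {ε : ℝ} {p : ℂ}

lemma hasDerivAt_rayArg (t : ℂ) : HasDerivAt (rayArg ε p) (rayArg ε p t) t := by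
  have h : HasDerivAt (fun t => Complex.exp (t - p)) (Complex.exp (t - p)) t := by
    simpa using ((hasDerivAt_id t).sub_const p).cexp
  exact (h.const_mul _).const_mul _

lemma rayArg_add_log {n : ℕ} (hn : 0 < n) :
    rayArg ε p (p + Real.log n) = ε * (2 * Real.pi * Complex.I * n) := by
  have : (0 : ℝ) < n := by exact_mod_cast hn
  rw [rayArg, add_sub_cancel_left, ← Complex.ofReal_exp, Real.exp_log this]
  simp

lemma norm_rayArg (hε : ε = 1 ∨ ε = -1) (t : ℂ) :
    ‖rayArg ε p t‖ = 2 * Real.pi * Real.exp (t.re - p.re) := by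
  have : |ε| = 1 := by rcases hε with h | h <;> simp [h]
  simp [rayArg, Complex.norm_exp, this, abs_of_pos Real.pi_pos]

lemma rayArg_re (t : ℂ) :
    (rayArg ε p t).re = -(ε * (2 * Real.pi * (Real.exp (t.re - p.re) * Real.sin (t.im - p.im)))) := by
  have : rayArg ε p t = ((ε * (2 * Real.pi) : ℝ) : ℂ) * (Complex.I * Complex.exp (t - p)) := by
    unfold rayArg; push_cast; ring
  rw [this, Complex.re_ofReal_mul, Complex.I_mul_re, Complex.exp_im]
  simp; ring

/-- At a pole `exp (t - p)` is a real integer. With `|Im (t - p)| < π` its argument must be `0`, so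
the integer is positive and the poles on the opposite ray are excluded. -/
lemma exists_nat_of_exp_rayArg_eq_one (hε : ε = 1 ∨ ε = -1) {t : ℂ} (h1 : -Real.pi < t.im - p.im)
    (h2 : t.im - p.im < Real.pi) (h : Complex.exp (rayArg ε p t) = 1) :
    ∃ n : ℕ, 0 < n ∧ t = p + Real.log n := by
  obtain ⟨m, hm⟩ := Complex.exp_eq_one_iff.1 h
  have hpi : (2 * Real.pi * Complex.I : ℂ) ≠ 0 := Complex.two_pi_I_ne_zero
  have hee : (ε : ℂ) * ε = 1 := by rcases hε with h | h <;> simp [h]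
  have he : Complex.exp (t - p) = ((ε * m : ℝ) : ℂ) := by
    have : (2 * Real.pi * Complex.I : ℂ) * Complex.exp (t - p) =
        (2 * Real.pi * Complex.I) * (ε * m : ℝ) := by
      rw [rayArg] at hm
      push_cast
      linear_combination ε * hm - (2 * Real.pi * Complex.I * Complex.exp (t - p)) * hee
    exact mul_left_cancel₀ hpi this
  have him := congrArg Complex.im he
  rw [Complex.exp_im, Complex.ofReal_im, mul_eq_zero, Complex.sub_im,
    or_iff_right (Real.exp_pos _).ne', Real.sin_eq_zero_iff_of_lt_of_lt h1 h2] at him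
  have hre := congrArg Complex.re he
  rw [Complex.exp_re, Complex.sub_im, him, Real.cos_zero, mul_one, Complex.ofReal_re,
    Complex.sub_re] at hre
  obtain ⟨n, hn⟩ : ∃ n : ℕ, (n : ℝ) = ε * m := by
    have hpos : 0 < ε * m := hre ▸ Real.exp_pos _
    refine ⟨m.natAbs, ?_⟩
    have h3 : ((m.natAbs : ℤ) : ℝ) = |(m : ℝ)| := by rw [Int.natCast_natAbs]; simp
    have h4 : |(m : ℝ)| = |ε * m| := by
      rcases hε with h | h <;> simp [h]
    rw [abs_of_pos hpos] at h4
    rw [← h4, ← h3]; simp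
  rw [← hn] at hre
  have hn0 : (0 : ℝ) < n := hre ▸ Real.exp_pos _
  refine ⟨n, by exact_mod_cast hn0, ?_⟩
  apply Complex.ext
  · rw [Complex.add_re, Complex.ofReal_re, ← hre, Real.log_exp]; ring
  · rw [Complex.add_im, Complex.ofReal_im]; linarith

lemma differentiableAt_kern_rayArg {α : ℝ} {t : ℂ} (h : Complex.exp (rayArg ε p t) ≠ 1) :
    DifferentiableAt ℂ (fun t => kern α (rayArg ε p t)) t :=
  (differentiableAt_kern h).comp t (hasDerivAt_rayArg t).differentiableAt

/-- Because `rayArg` is its own derivative, `exp (rayArg t) - 1` has derivative `2πinε` at its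
`n`-th zero; the pole is simple and this is the denominator of the residue. -/
lemma tendsto_sub_mul_kern_rayArg (hε : ε = 1 ∨ ε = -1) {α : ℝ} {g : ℂ → ℂ} {n : ℕ} (hn : 0 < n)
    (hg : ContinuousAt g (p + Real.log n)) :
    Tendsto (fun t => (t - (p + Real.log n)) * (kern α (rayArg ε p t) * g t))
      (𝓝[≠] (p + Real.log n))
      (𝓝 (Complex.exp (2 * Real.pi * Complex.I * n * ε * α) * g (p + Real.log n) /
        (ε * (2 * Real.pi * Complex.I * n)))) := by
  set q : ℂ := p + Real.log n with hq
  have hvq : rayArg ε p q = ε * (2 * Real.pi * Complex.I * n) := rayArg_add_log hn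
  have hexp : Complex.exp (rayArg ε p q) = 1 := by
    rw [hvq, Complex.exp_eq_one_iff]
    rcases hε with h | h
    · exact ⟨n, by simp [h]; ring⟩
    · exact ⟨-n, by simp [h]; ring⟩
  have hD : HasDerivAt (fun t => Complex.exp (rayArg ε p t) - 1) (rayArg ε p q) q := by
    simpa [hexp] using ((hasDerivAt_rayArg (ε := ε) (p := p) q).cexp).sub_const 1
  have hne : rayArg ε p q ≠ 0 := by
    rw [hvq]
    have : (ε : ℂ) ≠ 0 := by rcases hε with h | h <;> simp [h]
    have : (n : ℂ) ≠ 0 := by exact_mod_cast hn.ne'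
    have := Complex.two_pi_I_ne_zero
    positivity
  have h1 := (hasDerivAt_iff_tendsto_slope.1 hD).inv₀ hne
  have h2 : Tendsto (fun t => Complex.exp (α * rayArg ε p t) * g t) (𝓝[≠] q)
      (𝓝 (Complex.exp (α * rayArg ε p q) * g q)) := by
    have h3 : ContinuousAt (rayArg ε p) q := (hasDerivAt_rayArg q).continuousAt
    exact ((h3.const_mul (α : ℂ)).cexp.mul hg).tendsto.mono_left nhdsWithin_le_nhds
  have h4 := h2.mul h1
  rw [hvq] at h4
  refine Tendsto.congr' ?_ (h4.trans_eq ?_)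
  · filter_upwards [self_mem_nhdsWithin] with t ht
    simp only [slope, hexp, vsub_eq_sub, sub_self, sub_zero, smul_eq_mul, kern]
    rw [mul_inv, inv_inv]
    ring
  · congr 1
    rw [div_eq_mul_inv]
    congr 3
    ring

/-- The residue theorem on rectangles growing to the right. On the horizontal sides and on suitable
right sides the kernel stays bounded, and `g` supplies the decay. -/
theorem hasSum_residues_of_strip {α : ℝ} (hα0 : 0 ≤ α) (hα1 : α ≤ 1) (hε : ε = 1 ∨ ε = -1)
    {x₀ θ₁ θ₂ : ℝ} (hx₀ : x₀ < p.re) (h1 : θ₁ < p.im) (h2 : p.im < θ₂) (h3 : p.im - θ₁ < Real.pi)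
    (h4 : θ₂ - p.im < Real.pi) {g : ℂ → ℂ}
    (hg : ∀ t : ℂ, x₀ ≤ t.re → θ₁ ≤ t.im → t.im ≤ θ₂ → DifferentiableAt ℂ g t)
    {C κ : ℝ} (hκ : 0 < κ)
    (hgb : ∀ t : ℂ, x₀ ≤ t.re → θ₁ ≤ t.im → t.im ≤ θ₂ → ‖g t‖ ≤ C * Real.exp (-κ * Real.exp t.re)) :
    HasSum (fun n : ℕ => ε * Complex.exp (2 * Real.pi * Complex.I * (n + 1 : ℕ) * ε * α) *
        g (p + Real.log (n + 1 : ℕ)) / (n + 1 : ℕ))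
      ((∫ x in Ioi x₀, kern α (rayArg ε p (x + θ₁ * Complex.I)) * g (x + θ₁ * Complex.I)) -
        (∫ x in Ioi x₀, kern α (rayArg ε p (x + θ₂ * Complex.I)) * g (x + θ₂ * Complex.I)) -
        Complex.I * ∫ y in θ₁..θ₂, kern α (rayArg ε p (x₀ + y * Complex.I)) *
          g (x₀ + y * Complex.I)) := by
  set Φ : ℂ → ℂ := fun t => kern α (rayArg ε p t) * g t with hΦ
  have hpole : ∀ n : ℕ, x₀ ≤ (p + Real.log (n + 1 : ℕ) : ℂ).re := fun n => by
    have : 0 ≤ Real.log (n + 1 : ℕ) := Real.log_natCast_nonneg _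
    simp only [Complex.add_re, Complex.ofReal_re]
    linarith
  -- summability of the residues
  have hsum : Summable (fun n : ℕ => ε * Complex.exp (2 * Real.pi * Complex.I * (n + 1 : ℕ) * ε * α) *
        g (p + Real.log (n + 1 : ℕ)) / (n + 1 : ℕ)) := by
    refine Summable.of_norm_bounded
      (g := fun n : ℕ => C * Real.exp (-(κ * Real.exp p.re)) ^ (n + 1)) ?_ fun n => ?_
    · refine Summable.mul_left _ ?_
      rw [summable_nat_add_iff (f := fun n => Real.exp (-(κ * Real.exp p.re)) ^ n)]
      refine summable_geometric_of_lt_one (Real.exp_pos _).le (Real.exp_lt_one_iff.2 ?_)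
      have := Real.exp_pos p.re
      nlinarith
    · have hε1 : ‖(ε : ℂ)‖ = 1 := by rcases hε with h | h <;> simp [h]
      have he1 : ‖Complex.exp (2 * Real.pi * Complex.I * (n + 1 : ℕ) * ε * α)‖ = 1 := by
        have : (2 * Real.pi * Complex.I * (n + 1 : ℕ) * ε * α : ℂ) =
          ((2 * Real.pi * (n + 1 : ℕ) * ε * α : ℝ) : ℂ) * Complex.I := by push_cast; ring
        rw [this, Complex.norm_exp_ofReal_mul_I]
      rw [norm_div, norm_mul, norm_mul, hε1, he1, one_mul, one_mul, Complex.norm_natCast]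
      refine (div_le_self (norm_nonneg _) (by simp)).trans ?_
      refine (hgb _ (hpole n) (by simpa using h1.le) (by simpa using h2.le)).trans_eq ?_
      rw [← Real.exp_nat_mul]
      simp only [Complex.add_re, Complex.ofReal_re]
      rw [Real.exp_add, Real.exp_log (by positivity)]
      congr 2; ring
  refine (hsum.hasSum_iff_tendsto_nat).2 ?_
  -- rectangles
  set X : ℕ → ℝ := fun N => p.re + Real.log (N + 1 / 2) with hX
  have hXtop : Tendsto X atTop atTop := by
    refine tendsto_atTop_add_const_left _ _ (Real.tendsto_log_atTop.comp ?_)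
    exact tendsto_atTop_add_const_right _ _ tendsto_natCast_atTop_atTop
  have hXx : ∀ N : ℕ, 1 ≤ N → x₀ < X N := fun N hN => by
    have hN' : (1 : ℝ) ≤ N := by exact_mod_cast hN
    have : 0 ≤ Real.log (N + 1 / 2) := Real.log_nonneg (by linarith)
    simp only [hX]; linarith
  have hθ : θ₁ ≤ θ₂ := (h1.trans h2).le
  have hd : ∀ t : ℂ, x₀ ≤ t.re → θ₁ ≤ t.im → t.im ≤ θ₂ → (∀ n : ℕ, 0 < n → t ≠ p + Real.log n) →
      DifferentiableAt ℂ Φ t := fun t ha hb hc hn => by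
    refine (differentiableAt_kern_rayArg fun h => ?_).mul (hg t ha hb hc)
    obtain ⟨n, hn0, hn1⟩ := exists_nat_of_exp_rayArg_eq_one hε (by linarith) (by linarith) h
    exact hn n hn0 hn1
  have hrect : ∀ N : ℕ, 1 ≤ N → rectIntegral Φ x₀ (X N) θ₁ θ₂ = ∑ n ∈ Finset.range N,
      ε * Complex.exp (2 * Real.pi * Complex.I * (n + 1 : ℕ) * ε * α) *
        g (p + Real.log (n + 1 : ℕ)) / (n + 1 : ℕ) := by
    intro N hN
    have hinj : ∀ m n : ℕ, (p + Real.log (m + 1 : ℕ) : ℂ) = p + Real.log (n + 1 : ℕ) → m = n := by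
      intro m n h
      have h := Complex.ofReal_injective (add_left_cancel h)
      have := Real.log_injOn_pos (show ((m + 1 : ℕ) : ℝ) ∈ Ioi (0 : ℝ) from by
        simp only [mem_Ioi]; positivity) (show ((n + 1 : ℕ) : ℝ) ∈ Ioi (0 : ℝ) from by
        simp only [mem_Ioi]; positivity) h
      have := Nat.cast_injective this
      omega
    have hres := rectIntegral_eq_sum_residues (hXx N hN).le hθ
      (fun q => Complex.exp (α * rayArg ε p q) * g q / rayArg ε p q)
      ((Finset.range N).image fun n : ℕ => (p + Real.log (n + 1 : ℕ) : ℂ)) Φ ?_ ?_ ?_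
    · rw [hres, Finset.sum_image (fun m _ n _ h => hinj m n h), Finset.mul_sum]
      refine Finset.sum_congr rfl fun n _ => ?_
      rw [rayArg_add_log n.succ_pos]
      have hn0 : ((n + 1 : ℕ) : ℂ) ≠ 0 := by exact_mod_cast n.succ_ne_zero
      have hpi := Complex.two_pi_I_ne_zero
      have e1 : (α * (ε * (2 * Real.pi * Complex.I * (n + 1 : ℕ))) : ℂ) =
          2 * Real.pi * Complex.I * (n + 1 : ℕ) * ε * α := by ring
      rw [e1]
      have hε0 : (ε : ℂ) ≠ 0 := by rcases hε with h | h <;> simp [h]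
      have hee : (ε : ℂ) * ε = 1 := by rcases hε with h | h <;> simp [h]
      generalize Complex.exp (2 * Real.pi * Complex.I * (n + 1 : ℕ) * ε * α) = E
      generalize g (p + Real.log (n + 1 : ℕ)) = w
      generalize ((n + 1 : ℕ) : ℂ) = m at *
      generalize (2 * Real.pi * Complex.I : ℂ) = P at *
      field_simp
      linear_combination (-E * w) * hee
    · rintro t ⟨⟨ha, ha'⟩, hb, hc⟩ htS
      refine hd t ha hb hc fun n hn0 hn => htS ?_
      rw [Finset.mem_image]
      refine ⟨n - 1, ?_, by rw [hn, Nat.sub_add_cancel hn0]⟩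
      rw [Finset.mem_range]
      rw [hn] at ha'
      simp only [Complex.add_re, Complex.ofReal_re, hX, add_le_add_iff_left] at ha'
      have hn0' : (0 : ℝ) < n := by exact_mod_cast hn0
      rw [Real.log_le_log_iff hn0' (by positivity)] at ha'
      have : (n : ℝ) < (N + 1 : ℕ) := by push_cast; linarith
      have := Nat.cast_lt.1 this
      omega
    · intro q hq
      obtain ⟨n, hn, rfl⟩ := Finset.mem_image.1 hq
      rw [Finset.mem_range] at hn
      have hn' : ((n + 1 : ℕ) : ℝ) ≤ N := by exact_mod_cast hn
      refine ⟨⟨?_, ?_⟩, by simpa using h1, by simpa using h2⟩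
      · have : 0 ≤ Real.log (n + 1 : ℕ) := Real.log_natCast_nonneg _
        simp only [Complex.add_re, Complex.ofReal_re]
        linarith
      · simp only [Complex.add_re, Complex.ofReal_re, hX]
        exact add_lt_add_right (Real.log_lt_log (by positivity) (by linarith)) _
    · intro q hq
      obtain ⟨n, hn, rfl⟩ := Finset.mem_image.1 hq
      convert tendsto_sub_mul_kern_rayArg hε (α := α) n.succ_pos
        (hg _ (hpole n) (by simpa using h1.le) (by simpa using h2.le)).continuousAt using 2
      rw [rayArg_add_log n.succ_pos]
      congr 3
      ring
  -- the horizontal sides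
  have hhor : ∀ θ : ℝ, θ₁ ≤ θ → θ ≤ θ₂ → θ ≠ p.im →
      Tendsto (fun N => ∫ x : ℝ in x₀..X N, Φ (x + θ * Complex.I)) atTop
        (𝓝 (∫ x in Ioi x₀, Φ (x + θ * Complex.I))) := by
    intro θ ha hb hne
    refine intervalIntegral_tendsto_integral_Ioi x₀ ?_ hXtop
    set r := 2 * Real.pi * (Real.exp (x₀ - p.re) * |Real.sin (θ - p.im)|) with hr
    have hsin : Real.sin (θ - p.im) ≠ 0 := by
      rw [Ne, Real.sin_eq_zero_iff_of_lt_of_lt (by linarith) (by linarith)]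
      exact sub_ne_zero.2 hne
    have hr0 : 0 < r := by positivity
    have habs : ∀ x : ℝ, x₀ ≤ x → r ≤ |(rayArg ε p (x + θ * Complex.I)).re| := fun x hx => by
      rw [rayArg_re, abs_neg, abs_mul, abs_mul (2 * Real.pi), abs_mul (Real.exp _)]
      have : |ε| = 1 := by rcases hε with h | h <;> simp [h]
      rw [this, one_mul, abs_of_pos Real.two_pi_pos, abs_of_pos (Real.exp_pos _)]
      simp only [Complex.add_re, Complex.ofReal_re, Complex.mul_re, Complex.I_re, Complex.I_im,
        Complex.add_im, Complex.ofReal_im, Complex.mul_im, mul_zero, mul_one, sub_zero,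
        add_zero, zero_add]
      rw [hr]
      gcongr
    have hmin : 0 ≤ min α (1 - α) := le_min hα0 (by linarith)
    refine integrableOn_horizontal (C := 1 / (1 - Real.exp (-r)) * C) hκ (fun x hx => ?_)
      (fun x hx => ?_)
    · refine (hd _ (by simpa using hx) (by simpa using ha) (by simpa using hb)
        fun n _ h => hne ?_).continuousAt
      have := congrArg Complex.im h
      rw [Complex.add_im p, Complex.ofReal_im] at this
      simpa using this
    · have hk := norm_kern_le (α := α) hr0 (habs x hx)
      have hg' := hgb (x + θ * Complex.I) (by simpa using hx) (by simpa using ha)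
        (by simpa using hb)
      have hre : (x + θ * Complex.I : ℂ).re = x := by simp
      rw [hre] at hg'
      have hr1 : 0 < 1 - Real.exp (-r) := by
        have := Real.exp_lt_one_iff.2 (by linarith : -r < 0)
        linarith
      rw [norm_mul, mul_assoc]
      refine mul_le_mul (hk.trans ?_) hg' (norm_nonneg _) (by positivity)
      gcongr
      exact Real.exp_le_one_iff.2 (by nlinarith [abs_nonneg (rayArg ε p (x + θ * Complex.I)).re])
  -- the right side
  have hright : Tendsto (fun N => Complex.I * ∫ y : ℝ in θ₁..θ₂, Φ (X N + y * Complex.I)) atTop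
      (𝓝 0) := by
    have hlim : Tendsto (fun N => 3 * (C * Real.exp (-κ * Real.exp (X N))) * |θ₂ - θ₁|) atTop
        (𝓝 0) := by
      have : Tendsto (fun N => Real.exp (-κ * Real.exp (X N))) atTop (𝓝 0) := by
        refine Real.tendsto_exp_atBot.comp ?_
        exact (Real.tendsto_exp_atTop.comp hXtop).const_mul_atTop_of_neg (by linarith)
      simpa using ((this.const_mul C).const_mul 3).mul_const |θ₂ - θ₁|
    refine squeeze_zero_norm' ?_ hlim
    filter_upwards [eventually_ge_atTop 1] with N hN
    rw [norm_mul, Complex.norm_I, one_mul]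
    refine intervalIntegral.norm_integral_le_of_norm_le_const fun y hy => ?_
    rw [uIoc_of_le hθ] at hy
    rw [hΦ]
    simp only [norm_mul]
    have hre : (X N + y * Complex.I : ℂ).re = X N := by simp
    have him : (X N + y * Complex.I : ℂ).im = y := by simp
    refine mul_le_mul ?_ ?_ (norm_nonneg _) (by norm_num)
    · refine norm_kern_le_of_norm_eq hα0 hα1 N ?_
      rw [norm_rayArg hε, hre]
      simp only [hX, add_sub_cancel_left]
      rw [Real.exp_log (by positivity)]
      ring
    · have := hgb (X N + y * Complex.I) (by rw [hre]; exact (hXx N hN).le) (by rw [him]; exact hy.1.le)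
        (by rw [him]; exact hy.2)
      rwa [hre] at this
  have hall := (((hhor θ₁ le_rfl hθ h1.ne).sub (hhor θ₂ hθ le_rfl h2.ne')).add hright).sub_const
    (Complex.I * ∫ y in θ₁..θ₂, Φ (x₀ + y * Complex.I))
  rw [add_zero] at hall
  refine hall.congr' ?_
  filter_upwards [eventually_ge_atTop 1] with N hN
  rw [← hrect N hN, rectIntegral]

end

/-! ### The integrand in logarithmic coordinates -/

/-- Where `l exp t` keeps a fixed angle from the imaginary axis, the kernel decays doubly
exponentially in `Re t`; half of the rate is spent on absorbing `exp (st)`. -/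
lemma exists_norm_kern_mul_exp_le {β : ℝ} (hβ0 : 0 < β) (hβ1 : β < 1) {l s : ℂ} {x₀ θ₁ θ₂ q : ℝ}
    (hq : 0 < q) (h : ∀ t : ℂ, θ₁ ≤ t.im → t.im ≤ θ₂ →
      q * Real.exp t.re ≤ |(l * Complex.exp t).re|) :
    ∃ C κ : ℝ, 0 < κ ∧ ∀ t : ℂ, x₀ ≤ t.re → θ₁ ≤ t.im → t.im ≤ θ₂ →
      ‖kern β (l * Complex.exp t) * Complex.exp (s * t)‖ ≤ C * Real.exp (-κ * Real.exp t.re) := by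
  set m := min β (1 - β) with hm
  have hm0 : 0 < m := lt_min hβ0 (by linarith)
  have hκ : 0 < m * q / 2 := by positivity
  obtain ⟨C, hC, hCb⟩ := exp_linear_mul_exp_neg_le (σ := s.re) (x₀ := x₀) hκ
  set r := q * Real.exp x₀ with hr
  have hr0 : 0 < r := by positivity
  have hr1 : 0 < 1 - Real.exp (-r) := by
    have := Real.exp_lt_one_iff.2 (by linarith : -r < 0)
    linarith
  set D := Real.exp (|s.im| * (|θ₁| + |θ₂|)) with hD
  refine ⟨1 / (1 - Real.exp (-r)) * D * C, m * q / 2, hκ, fun t hx h1 h2 => ?_⟩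
  have hre : r ≤ |(l * Complex.exp t).re| := by
    refine le_trans ?_ (h t h1 h2)
    rw [hr]; gcongr
  have hk := norm_kern_le (α := β) hr0 hre
  have he : ‖Complex.exp (s * t)‖ ≤ D * Real.exp (s.re * t.re) := by
    rw [Complex.norm_exp, hD, ← Real.exp_add, Complex.mul_re]
    apply Real.exp_le_exp.2
    have h3 : |t.im| ≤ |θ₁| + |θ₂| := by
      rw [abs_le]
      constructor
      · linarith [neg_abs_le θ₁, abs_nonneg θ₂]
      · linarith [le_abs_self θ₂, abs_nonneg θ₁]
    have h4 : -(s.im * t.im) ≤ |s.im| * (|θ₁| + |θ₂|) := by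
      refine (neg_le_abs _).trans ?_
      rw [abs_mul]
      gcongr
    linarith
  have hk2 : Real.exp (-m * |(l * Complex.exp t).re|) ≤
      Real.exp (-(2 * (m * q / 2)) * Real.exp t.re) := by
    apply Real.exp_le_exp.2
    nlinarith [h t h1 h2]
  calc _ ≤ (Real.exp (-(2 * (m * q / 2)) * Real.exp t.re) / (1 - Real.exp (-r))) *
        (D * Real.exp (s.re * t.re)) := by
        rw [norm_mul]
        gcongr
        exact hk.trans (by gcongr)
    _ = 1 / (1 - Real.exp (-r)) * D * (Real.exp (s.re * t.re) *
        Real.exp (-(2 * (m * q / 2)) * Real.exp t.re)) := by ring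
    _ ≤ 1 / (1 - Real.exp (-r)) * D * (C * Real.exp (-(m * q / 2) * Real.exp t.re)) := by
        exact mul_le_mul_of_nonneg_left (hCb _ hx) (by positivity)
    _ = _ := by ring

lemma exp_ne_one_of_norm_lt {v : ℂ} (h0 : v ≠ 0) (h : ‖v‖ < 2 * Real.pi) :
    Complex.exp v ≠ 1 := by
  intro h1
  obtain ⟨m, hm⟩ := Complex.exp_eq_one_iff.1 h1
  have hm0 : m ≠ 0 := by rintro rfl; exact h0 (by simpa using hm)
  rw [hm, norm_mul, Complex.norm_intCast] at h
  have h2 : ‖(2 * Real.pi * Complex.I : ℂ)‖ = 2 * Real.pi := by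
    simp [abs_of_pos Real.pi_pos]
  have h3 : (1 : ℝ) ≤ |(m : ℝ)| := by exact_mod_cast Int.one_le_abs hm0
  rw [h2] at h
  nlinarith [Real.pi_pos]

/-- The product of kernels in logarithmic coordinates. -/
def logIntegrand (k : ℝ) (w s : ℂ) (α β : ℝ) (t : ℂ) : ℂ :=
  kern α (-(w * k * Complex.exp t)) * kern β (k * Complex.exp t) * Complex.exp (s * t)

/-- The base point of the rays of poles of the kernels, in logarithmic coordinates. -/
def poleLog (k : ℝ) (w : ℂ) : ℂ := Real.log (2 * Real.pi / k) + Real.pi / 2 * Complex.I - Complex.log w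

/-- The sum of the residues of `logIntegrand` at the `n`-th poles in the strip `0 < Im t < π`. -/
def residueTerm (k : ℝ) (w s : ℂ) (α β : ℝ) (n : ℕ) : ℂ :=
  (n : ℂ) ^ (s - 1) *
    (Complex.exp (s * poleLog k 1) * Complex.exp (2 * Real.pi * Complex.I * n * β) *
        kern α (-(2 * Real.pi * Complex.I * n * w)) -
      Complex.exp (s * poleLog k w) * Complex.exp (-(2 * Real.pi * Complex.I * n * α)) *
        kern β (2 * Real.pi * Complex.I * n / w))

section

variable {k : ℝ} {w s : ℂ} {α β : ℝ}

lemma exp_poleLog (hk : 0 < k) (hw : w ≠ 0) :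
    Complex.exp (poleLog k w) = 2 * Real.pi * Complex.I / (k * w) := by
  have : (k : ℂ) ≠ 0 := by exact_mod_cast hk.ne'
  rw [poleLog, Complex.exp_sub, Complex.exp_add, Complex.exp_log hw, ← Complex.ofReal_exp,
    Real.exp_log (by positivity), Complex.exp_pi_div_two_mul_I]
  push_cast
  field_simp

lemma poleLog_re : (poleLog k w).re = Real.log (2 * Real.pi / k) - Real.log ‖w‖ := by
  unfold poleLog
  rw [Complex.sub_re, Complex.add_re, Complex.ofReal_re, Complex.log_re]
  simp

lemma poleLog_im : (poleLog k w).im = Real.pi / 2 - w.arg := by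
  unfold poleLog
  rw [Complex.sub_im, Complex.add_im, Complex.ofReal_im, Complex.log_im]
  simp

lemma rayArg_poleLog (hk : 0 < k) (hw : w ≠ 0) (ε : ℝ) (t : ℂ) :
    rayArg ε (poleLog k w) t = ε * (w * k * Complex.exp t) := by
  have h1 : (k : ℂ) ≠ 0 := by exact_mod_cast hk.ne'
  have h2 := Complex.I_ne_zero
  have h3 : (Real.pi : ℂ) ≠ 0 := by exact_mod_cast Real.pi_ne_zero
  rw [rayArg, Complex.exp_sub, exp_poleLog hk hw]
  field_simp

lemma exp_poleLog_add_log (hk : 0 < k) (hw : w ≠ 0) {n : ℕ} (hn : 0 < n) :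
    Complex.exp (poleLog k w + Real.log n) = 2 * Real.pi * Complex.I * n / (k * w) := by
  rw [Complex.exp_add, exp_poleLog hk hw, ← Complex.ofReal_exp,
    Real.exp_log (by exact_mod_cast hn), Complex.ofReal_natCast]
  ring

lemma exp_mul_poleLog_add_log {n : ℕ} (hn : 0 < n) :
    Complex.exp (s * (poleLog k w + Real.log n)) / n =
      (n : ℂ) ^ (s - 1) * Complex.exp (s * poleLog k w) := by
  have hn0 : (n : ℂ) ≠ 0 := by exact_mod_cast hn.ne'
  rw [mul_add, Complex.exp_add, Complex.cpow_sub _ _ hn0, Complex.cpow_one,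
    Complex.cpow_def_of_ne_zero hn0, ← Complex.natCast_log, mul_comm s (Real.log n : ℂ)]
  ring

/-- The shift replaces `u` by `-u`, and the two signs from `kern_neg` cancel. -/
lemma logIntegrand_add_pi_mul_I (t : ℂ) :
    logIntegrand k w s α β (t + Real.pi * Complex.I) =
      Complex.exp (Real.pi * Complex.I * s) * logIntegrand k w s (1 - α) (1 - β) t := by
  unfold logIntegrand
  rw [Complex.exp_add, Complex.exp_pi_mul_I, mul_add, Complex.exp_add]
  have h1 : kern β (k * (Complex.exp t * -1)) = -kern (1 - β) (k * Complex.exp t) := by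
    rw [← kern_neg]; congr 1; ring
  have h2 : kern α (-(w * k * (Complex.exp t * -1))) =
      -kern (1 - α) (-(w * k * Complex.exp t)) := by
    rw [← kern_neg]; congr 1; ring
  rw [h1, h2, mul_comm s (Real.pi * Complex.I)]
  ring

lemma differentiableAt_logIntegrand {t : ℂ} (h1 : Complex.exp (-(w * k * Complex.exp t)) ≠ 1)
    (h2 : Complex.exp (k * Complex.exp t) ≠ 1) :
    DifferentiableAt ℂ (logIntegrand k w s α β) t := by
  unfold logIntegrand
  refine DifferentiableAt.mul (DifferentiableAt.mul ?_ ?_) (by fun_prop)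
  · exact (differentiableAt_kern h1).comp t
      (f := fun t => -(w * k * Complex.exp t)) (by fun_prop)
  · exact (differentiableAt_kern h2).comp t (f := fun t => k * Complex.exp t) (by fun_prop)

lemma differentiableAt_logIntegrand_of_re_le (hk : 0 < k) (hw : w ≠ 0) {x₀ : ℝ}
    (hx1 : x₀ < (poleLog k 1).re) (hxw : x₀ < (poleLog k w).re) {t : ℂ} (ht : t.re ≤ x₀) :
    DifferentiableAt ℂ (logIntegrand k w s α β) t := by
  have hnorm : ∀ v : ℂ, v ≠ 0 → x₀ < (poleLog k v).re →
      ‖v * k * Complex.exp t‖ < 2 * Real.pi := fun v hv hx => by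
    have h := norm_rayArg (p := poleLog k v) (Or.inl rfl) t
    rw [rayArg_poleLog hk hv, Complex.ofReal_one, one_mul] at h
    rw [h]
    have : Real.exp (t.re - (poleLog k v).re) < 1 := Real.exp_lt_one_iff.2 (by linarith)
    nlinarith [Real.pi_pos]
  have hk0 : (k : ℂ) ≠ 0 := by exact_mod_cast hk.ne'
  refine differentiableAt_logIntegrand (exp_ne_one_of_norm_lt ?_ ?_) (exp_ne_one_of_norm_lt ?_ ?_)
  · exact neg_ne_zero.2 (mul_ne_zero (mul_ne_zero hw hk0) (Complex.exp_ne_zero _))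
  · rw [norm_neg]; exact hnorm w hw hxw
  · exact mul_ne_zero hk0 (Complex.exp_ne_zero _)
  · simpa using hnorm 1 one_ne_zero hx1

lemma arg_mem_of_pos (hwr : 0 < w.re) (hwi : 0 < w.im) : 0 < w.arg ∧ w.arg < Real.pi / 2 := by
  refine ⟨?_, ?_⟩
  · refine lt_of_le_of_ne (Complex.arg_nonneg_iff.2 hwi.le) fun h => ?_
    have := (Complex.arg_eq_zero_iff.1 h.symm).2
    linarith
  · have h1 := Complex.abs_arg_lt_pi_div_two_iff.2 (Or.inl hwr)
    exact (le_abs_self _).trans_lt h1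

lemma mul_exp_re_eq (hw : w ≠ 0) (t : ℂ) : (w * k * Complex.exp t).re =
    k * ‖w‖ * (Real.exp t.re * Real.cos (t.im + w.arg)) := by
  have h1 : w * k * Complex.exp t = (k : ℝ) * Complex.exp (Complex.log w + t) := by
    rw [Complex.exp_add, Complex.exp_log hw]; ring
  rw [h1, Complex.re_ofReal_mul, Complex.exp_re, Complex.add_re, Complex.add_im, Complex.log_re,
    Complex.log_im, Real.exp_add, Real.exp_log (norm_pos_iff.2 hw), add_comm w.arg]
  ring

lemma cos_le_abs_cos {θ M : ℝ} (hM : M ≤ Real.pi) (h : |θ| ≤ M) : Real.cos M ≤ Real.cos θ := by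
  rw [← Real.cos_abs θ]
  exact Real.cos_le_cos_of_nonneg_of_le_pi (abs_nonneg _) hM h

/-- The rays of poles lie at heights `π/2 - φ` and `π/2`, where `φ = arg w > 0`. Cutting the strip
halfway between them, at `π/2 - φ/2`, leaves one ray in each piece, with the other kernel decaying
there; the integrals along the cut cancel. -/
theorem hasSum_residueTerm_half (hk : 0 < k) (hwr : 0 < w.re) (hwi : 0 < w.im)
    (hα0 : 0 < α) (hα1 : α < 1) (hβ0 : 0 < β) (hβ1 : β < 1) {x₀ : ℝ}
    (hx1 : x₀ < (poleLog k 1).re) (hxw : x₀ < (poleLog k w).re) :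
    HasSum (fun n : ℕ => residueTerm k w s α β (n + 1))
      ((∫ x in Ioi x₀, logIntegrand k w s α β (x + (0 : ℝ) * Complex.I)) -
        (∫ x in Ioi x₀, logIntegrand k w s α β (x + Real.pi * Complex.I)) -
        Complex.I * ∫ y in (0 : ℝ)..Real.pi, logIntegrand k w s α β (x₀ + y * Complex.I)) := by
  have hw : w ≠ 0 := fun h => by simp [h] at hwr
  have hk0 : (k : ℂ) ≠ 0 := by exact_mod_cast hk.ne'
  have hwn : 0 < ‖w‖ := norm_pos_iff.2 hw
  obtain ⟨hφ0, hφ1⟩ := arg_mem_of_pos hwr hwi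
  set φ := w.arg with hφ
  have hpi := Real.pi_pos
  -- the first strip
  have hs1 : ∀ t : ℂ, 0 ≤ t.im → t.im ≤ Real.pi / 2 - φ / 2 →
      k * Real.cos (Real.pi / 2 - φ / 2) * Real.exp t.re ≤ |(k * Complex.exp t : ℂ).re| := by
    intro t h1 h2
    refine le_trans ?_ (le_abs_self _)
    rw [Complex.re_ofReal_mul, Complex.exp_re, mul_assoc, mul_comm (Real.cos _)]
    gcongr
    exact cos_le_abs_cos (by linarith) (abs_le.2 ⟨by linarith, h2⟩)
  have hq1 : 0 < k * Real.cos (Real.pi / 2 - φ / 2) :=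
    mul_pos hk (Real.cos_pos_of_mem_Ioo ⟨by linarith, by linarith⟩)
  obtain ⟨C1, κ1, hκ1, hb1⟩ :=
    exists_norm_kern_mul_exp_le (s := s) (x₀ := x₀) hβ0 hβ1 hq1 hs1
  have hpos_of : ∀ (l t : ℂ) (q : ℝ), 0 < q → q * Real.exp t.re ≤ |(l * Complex.exp t).re| →
      Complex.exp (l * Complex.exp t) ≠ 1 := fun l t q hq h =>
    exp_ne_one_of_re_ne_zero (abs_pos.1 (lt_of_lt_of_le (by positivity) h))
  have H1 := hasSum_residues_of_strip (ε := -1) (p := poleLog k w) (θ₁ := 0)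
    (θ₂ := Real.pi / 2 - φ / 2) (g := fun t => kern β (k * Complex.exp t) * Complex.exp (s * t))
    hα0.le hα1.le (Or.inr rfl) hxw
    (by rw [poleLog_im]; linarith) (by rw [poleLog_im]; linarith) (by rw [poleLog_im]; linarith)
    (by rw [poleLog_im]; linarith)
    (fun t _ ha hb => ((differentiableAt_kern (hpos_of _ t _ hq1 (hs1 t ha hb))).comp t
      (f := fun t => k * Complex.exp t) (by fun_prop)).mul (by fun_prop)) hκ1 hb1
  -- the second strip
  set M := max (Real.pi / 2 - φ / 2) φ with hM
  have hM2 : M < Real.pi / 2 := max_lt (by linarith) hφ1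
  have hMl : Real.pi / 2 - φ / 2 ≤ M := le_max_left _ _
  have hMr : φ ≤ M := le_max_right _ _
  have hs2 : ∀ t : ℂ, Real.pi / 2 - φ / 2 ≤ t.im → t.im ≤ Real.pi →
      k * ‖w‖ * Real.cos M * Real.exp t.re ≤ |(-(w * k) * Complex.exp t : ℂ).re| := by
    intro t h1 h2
    rw [neg_mul, Complex.neg_re]
    refine le_trans ?_ (le_abs_self _)
    rw [mul_exp_re_eq hw, mul_assoc (k * ‖w‖), mul_comm (Real.cos _), ← mul_neg, ← mul_neg,
      ← Real.cos_sub_pi]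
    gcongr
    exact cos_le_abs_cos (by linarith) (abs_le.2 ⟨by linarith, by linarith⟩)
  have hq2 : 0 < k * ‖w‖ * Real.cos M :=
    mul_pos (by positivity) (Real.cos_pos_of_mem_Ioo ⟨by linarith, by linarith⟩)
  obtain ⟨C2, κ2, hκ2, hb2⟩ :=
    exists_norm_kern_mul_exp_le (s := s) (x₀ := x₀) hα0 hα1 hq2 hs2
  have H2 := hasSum_residues_of_strip (ε := 1) (p := poleLog k 1) (θ₁ := Real.pi / 2 - φ / 2)
    (θ₂ := Real.pi) (g := fun t => kern α (-(w * k) * Complex.exp t) * Complex.exp (s * t))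
    hβ0.le hβ1.le (Or.inl rfl) hx1
    (by rw [poleLog_im, Complex.arg_one]; linarith) (by rw [poleLog_im, Complex.arg_one]; linarith)
    (by rw [poleLog_im, Complex.arg_one]; linarith) (by rw [poleLog_im, Complex.arg_one]; linarith)
    (fun t _ ha hb => ((differentiableAt_kern (hpos_of _ t _ hq2 (hs2 t ha hb))).comp t
      (f := fun t => -(w * k) * Complex.exp t) (by fun_prop)).mul (by fun_prop)) hκ2 hb2
  have e1 : ∀ t, kern α (rayArg (-1) (poleLog k w) t) *
      (kern β (k * Complex.exp t) * Complex.exp (s * t)) = logIntegrand k w s α β t := fun t => by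
    rw [rayArg_poleLog hk hw, logIntegrand]; simp [mul_assoc]
  have e2 : ∀ t, kern β (rayArg 1 (poleLog k 1) t) *
      (kern α (-(w * k) * Complex.exp t) * Complex.exp (s * t)) = logIntegrand k w s α β t :=
    fun t => by
      rw [rayArg_poleLog hk one_ne_zero, logIntegrand, neg_mul, Complex.ofReal_one, one_mul, one_mul]
      ring
  simp only [e1] at H1
  simp only [e2] at H2
  have hcont : ∀ y : ℝ, ContinuousAt (logIntegrand k w s α β) (x₀ + y * Complex.I) := fun y =>
    (differentiableAt_logIntegrand_of_re_le hk hw hx1 hxw (by simp)).continuousAt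
  have hint : (∫ y in (0 : ℝ)..Real.pi, logIntegrand k w s α β (x₀ + y * Complex.I)) =
      (∫ y in (0 : ℝ)..(Real.pi / 2 - φ / 2), logIntegrand k w s α β (x₀ + y * Complex.I)) +
      ∫ y in (Real.pi / 2 - φ / 2)..Real.pi, logIntegrand k w s α β (x₀ + y * Complex.I) :=
    (intervalIntegral.integral_add_adjacent_intervals
      (intervalIntegrable_vertical (by linarith) fun y _ => hcont y)
      (intervalIntegrable_vertical (by linarith) fun y _ => hcont y)).symm
  convert H1.add H2 using 1
  · funext n
    have hN := n.succ_pos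
    have f1 := exp_mul_poleLog_add_log (k := k) (w := w) (s := s) hN
    have f2 := exp_mul_poleLog_add_log (k := k) (w := 1) (s := s) hN
    have g1 : (k : ℂ) * (2 * Real.pi * Complex.I * (n + 1 : ℕ) / (k * w)) =
        2 * Real.pi * Complex.I * (n + 1 : ℕ) / w := by field_simp
    have g2 : -(w * k) * (2 * Real.pi * Complex.I * (n + 1 : ℕ) / (k * 1)) =
        -(2 * Real.pi * Complex.I * (n + 1 : ℕ) * w) := by field_simp
    have g3 : (2 * Real.pi * Complex.I * (n + 1 : ℕ) * (-1 : ℝ) * α : ℂ) =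
        -(2 * Real.pi * Complex.I * (n + 1 : ℕ) * α) := by push_cast; ring
    have g4 : (2 * Real.pi * Complex.I * (n + 1 : ℕ) * (1 : ℝ) * β : ℂ) =
        2 * Real.pi * Complex.I * (n + 1 : ℕ) * β := by push_cast; ring
    rw [exp_poleLog_add_log hk hw hN, exp_poleLog_add_log hk one_ne_zero hN, g1, g2, g3, g4,
      mul_div_assoc, mul_div_assoc _ (_ * _) ((n + 1 : ℕ) : ℂ), mul_div_assoc, f1,
      mul_div_assoc (kern α _), f2, residueTerm]
    push_cast
    ring
  · rw [hint]
    ring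

/-- The strip `π < Im t < 2π` is the previous one shifted by `πi`; the integrals along `Im t = π`
cancel. -/
theorem hasSum_residueTerm (hk : 0 < k) (hwr : 0 < w.re) (hwi : 0 < w.im)
    (hα0 : 0 < α) (hα1 : α < 1) (hβ0 : 0 < β) (hβ1 : β < 1) {x₀ : ℝ}
    (hx1 : x₀ < (poleLog k 1).re) (hxw : x₀ < (poleLog k w).re) :
    HasSum (fun n : ℕ => residueTerm k w s α β (n + 1) +
        Complex.exp (Real.pi * Complex.I * s) * residueTerm k w s (1 - α) (1 - β) (n + 1))
      ((∫ x in Ioi x₀, logIntegrand k w s α β (x + (0 : ℝ) * Complex.I)) -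
        (∫ x in Ioi x₀, logIntegrand k w s α β (x + (2 * Real.pi : ℝ) * Complex.I)) -
        Complex.I * ∫ y in (0 : ℝ)..2 * Real.pi, logIntegrand k w s α β (x₀ + y * Complex.I)) := by
  have hw : w ≠ 0 := fun h => by simp [h] at hwr
  have hpi := Real.pi_pos
  have H1 := hasSum_residueTerm_half (s := s) hk hwr hwi hα0 hα1 hβ0 hβ1 hx1 hxw
  have H2 := (hasSum_residueTerm_half (s := s) (α := 1 - α) (β := 1 - β) hk hwr hwi (by linarith)
    (by linarith) (by linarith) (by linarith) hx1 hxw).mul_left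
    (Complex.exp (Real.pi * Complex.I * s))
  have hcont : ∀ y : ℝ, ContinuousAt (logIntegrand k w s α β) (x₀ + y * Complex.I) := fun y =>
    (differentiableAt_logIntegrand_of_re_le hk hw hx1 hxw (by simp)).continuousAt
  have hint : (∫ y in (0 : ℝ)..2 * Real.pi, logIntegrand k w s α β (x₀ + y * Complex.I)) =
      (∫ y in (0 : ℝ)..Real.pi, logIntegrand k w s α β (x₀ + y * Complex.I)) +
      ∫ y in Real.pi..2 * Real.pi, logIntegrand k w s α β (x₀ + y * Complex.I) :=
    (intervalIntegral.integral_add_adjacent_intervals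
      (intervalIntegrable_vertical (by linarith) fun y _ => hcont y)
      (intervalIntegrable_vertical (by linarith) fun y _ => hcont y)).symm
  have hshift : ∀ x θ : ℝ, Complex.exp (Real.pi * Complex.I * s) *
      logIntegrand k w s (1 - α) (1 - β) (x + θ * Complex.I) =
      logIntegrand k w s α β (x + (θ + Real.pi : ℝ) * Complex.I) := fun x θ => by
    rw [← logIntegrand_add_pi_mul_I]; congr 1; push_cast; ring
  have hv : Complex.exp (Real.pi * Complex.I * s) *
      (∫ y in (0 : ℝ)..Real.pi, logIntegrand k w s (1 - α) (1 - β) (x₀ + y * Complex.I)) =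
      ∫ y in Real.pi..2 * Real.pi, logIntegrand k w s α β (x₀ + y * Complex.I) := by
    rw [← intervalIntegral.integral_const_mul]
    simp only [hshift]
    rw [intervalIntegral.integral_comp_add_right
      (fun y : ℝ => logIntegrand k w s α β (x₀ + y * Complex.I)), zero_add, two_mul]
  convert H1.add H2 using 1
  rw [hint, ← hv, mul_sub, mul_sub, ← integral_const_mul, ← integral_const_mul]
  simp only [hshift]
  rw [zero_add, ← two_mul]
  ring

end

/-! ### The loop integral -/

/-- The product of kernels in the integrand of the loop integrals. -/
def kernProd (k : ℝ) (w : ℂ) (α β : ℝ) (u : ℂ) : ℂ := kern α (-(w * k * u)) * kern β (k * u)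

lemma branchPow_of_im_pos {u : ℂ} (hu : 0 < u.im) (s : ℂ) :
    branchPow u s = Complex.exp (s * Complex.log u) := by
  have := log_sub_log_neg_of_im_pos hu
  rw [branchPow]
  congr 2
  linear_combination -this

lemma branchPow_of_im_neg {u : ℂ} (hu : u.im < 0) (s : ℂ) :
    branchPow u (s - 1) =
      Complex.exp (2 * Real.pi * Complex.I * s) * Complex.exp ((s - 1) * Complex.log u) := by
  have h := log_sub_log_neg_of_im_neg hu
  have h2 : (s - 1) * (Complex.log (-u) + Real.pi * Complex.I) =
      2 * Real.pi * Complex.I * s + (s - 1) * Complex.log u - 2 * Real.pi * Complex.I := by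
    linear_combination (1 - s) * h
  rw [branchPow, h2, Complex.exp_sub, Complex.exp_two_pi_mul_I, div_one, Complex.exp_add]

/-- Since `-exp t = exp (t - πi)`, the branch `0 < arg u < 2π` becomes the principal logarithm after
a shift; the last factor `exp t` is the Jacobian of `u = exp t`. -/
lemma branchPow_exp_mul_exp {t : ℂ} (h1 : 0 < t.im) (h2 : t.im ≤ 2 * Real.pi) (s : ℂ) :
    branchPow (Complex.exp t) (s - 1) * Complex.exp t = Complex.exp (s * t) := by
  have h : -Complex.exp t = Complex.exp (t - Real.pi * Complex.I) := by
    rw [Complex.exp_sub, Complex.exp_pi_mul_I, div_neg, div_one]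
  have him : (t - Real.pi * Complex.I).im = t.im - Real.pi := by simp
  rw [branchPow, h, Complex.log_exp (by rw [him]; linarith) (by rw [him]; linarith),
    sub_add_cancel, ← Complex.exp_add]
  congr 1; ring

section

variable {k : ℝ} {w s : ℂ} {α β δ ε : ℝ}

lemma exp_ne_one_of_abs_im_lt (hk : 0 < k) {u : ℂ} (hu : u ≠ 0) (h : |u.im| < 2 * Real.pi / k) :
    Complex.exp (k * u) ≠ 1 := by
  intro h1
  obtain ⟨m, hm⟩ := Complex.exp_eq_one_iff.1 h1
  have him := congrArg Complex.im hm
  rw [Complex.im_ofReal_mul] at him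
  have him' : k * u.im = m * (2 * Real.pi) := by simpa using him
  have hm0 : m ≠ 0 := by
    rintro rfl
    have : (k : ℂ) ≠ 0 := by exact_mod_cast hk.ne'
    simp [this, hu] at hm
  have h3 : (1 : ℝ) ≤ |(m : ℝ)| := by exact_mod_cast Int.one_le_abs hm0
  rw [lt_div_iff₀ hk, ← abs_of_pos hk, ← abs_mul, mul_comm, him', abs_mul,
    abs_of_pos Real.two_pi_pos] at h
  nlinarith [Real.pi_pos]

/-- Multiplying the pole equation by the conjugate of `w` shows that `u` is a real multiple of `i`
times that conjugate, so its imaginary part is an integer multiple of `2π Re w / (k|w|²)`. -/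
lemma exp_neg_mul_ne_one_of_abs_im_lt (hk : 0 < k) (hwr : 0 < w.re) {u : ℂ} (hu : u ≠ 0)
    (h : |u.im| * (k * Complex.normSq w) < 2 * Real.pi * w.re) :
    Complex.exp (-(w * k * u)) ≠ 1 := by
  intro h1
  obtain ⟨m, hm⟩ := Complex.exp_eq_one_iff.1 h1
  have hw : w ≠ 0 := fun h => by simp [h] at hwr
  have h2 : ((k * Complex.normSq w : ℝ) : ℂ) * u =
      ((-(m * (2 * Real.pi)) : ℝ) : ℂ) * (Complex.I * (starRingEnd ℂ) w) := by
    push_cast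
    rw [← Complex.mul_conj]
    linear_combination (-(starRingEnd ℂ) w) * hm
  have him := congrArg Complex.im h2
  rw [Complex.im_ofReal_mul, Complex.im_ofReal_mul] at him
  have him' : k * Complex.normSq w * u.im = -(m * (2 * Real.pi)) * w.re := by simpa using him
  have hm0 : m ≠ 0 := by
    rintro rfl
    have : (k : ℂ) ≠ 0 := by exact_mod_cast hk.ne'
    simp [this, hu, hw] at hm
  have h3 : (1 : ℝ) ≤ |(m : ℝ)| := by exact_mod_cast Int.one_le_abs hm0
  have hn : 0 < k * Complex.normSq w := mul_pos hk (Complex.normSq_pos.2 hw)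
  rw [mul_comm, ← abs_of_pos hn, ← abs_mul, him', abs_mul, abs_neg, abs_mul,
    abs_of_pos Real.two_pi_pos, abs_of_pos hwr] at h
  nlinarith [Real.pi_pos, mul_pos Real.pi_pos hwr]

/-- The half-width of the widest strip around the real axis without nonzero poles. -/
def stripWidth (k : ℝ) (w : ℂ) : ℝ :=
  min (2 * Real.pi / k) (2 * Real.pi * w.re / (k * Complex.normSq w))

lemma stripWidth_pos (hk : 0 < k) (hwr : 0 < w.re) : 0 < stripWidth k w := by
  have hw : w ≠ 0 := fun h => by simp [h] at hwr
  have := Complex.normSq_pos.2 hw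
  have := Real.pi_pos
  exact lt_min (by positivity) (by positivity)

lemma exp_ne_one_of_abs_im_lt_stripWidth (hk : 0 < k) (hwr : 0 < w.re) {u : ℂ} (hu : u ≠ 0)
    (h : |u.im| < stripWidth k w) :
    Complex.exp (k * u) ≠ 1 ∧ Complex.exp (-(w * k * u)) ≠ 1 := by
  have hw : w ≠ 0 := fun h => by simp [h] at hwr
  have hn : 0 < k * Complex.normSq w := mul_pos hk (Complex.normSq_pos.2 hw)
  refine ⟨exp_ne_one_of_abs_im_lt hk hu (h.trans_le (min_le_left _ _)),
    exp_neg_mul_ne_one_of_abs_im_lt hk hwr hu ?_⟩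
  rw [← lt_div_iff₀ hn]
  exact h.trans_le (min_le_right _ _)

lemma differentiableAt_kernProd (hk : 0 < k) (hwr : 0 < w.re) {u : ℂ} (hu : u ≠ 0)
    (h : |u.im| < stripWidth k w) : DifferentiableAt ℂ (kernProd k w α β) u := by
  obtain ⟨h1, h2⟩ := exp_ne_one_of_abs_im_lt_stripWidth hk hwr hu h
  unfold kernProd
  exact ((differentiableAt_kern h2).comp u (f := fun u : ℂ => -(w * k * u)) (by fun_prop)).mul
    ((differentiableAt_kern h1).comp u (f := fun u : ℂ => k * u) (by fun_prop))

lemma mem_slitPlane_of_pos {u : ℂ} (h : 0 < u.re + ε * u.im) : u ∈ Complex.slitPlane := by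
  by_cases h0 : u.im = 0
  · left; rw [h0] at h; linarith
  · exact Or.inr h0

lemma differentiableAt_kernProd_mul_exp (hk : 0 < k) (hwr : 0 < w.re) {u : ℂ}
    (h0 : u ∈ Complex.slitPlane) (h : |u.im| < stripWidth k w) :
    DifferentiableAt ℂ (fun u => kernProd k w α β u * Complex.exp ((s - 1) * Complex.log u)) u :=
  (differentiableAt_kernProd hk hwr (Complex.slitPlane_ne_zero h0) h).mul
    ((differentiableAt_id.clog h0).const_mul (s - 1)).cexp

/-- `kern β` alone provides the decay, at rate `(1 - β)k`; half of it absorbs the power of `u`. The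
other kernel is merely bounded, so the endpoint values of `α` are allowed. -/
lemma exists_norm_kernProd_mul_exp_le (hk : 0 < k) (hwr : 0 < w.re) (hα0 : 0 ≤ α) (hα1 : α ≤ 1)
    (hβ1 : β < 1) (δ : ℝ) (s : ℂ) :
    ∃ C κ X : ℝ, 0 < κ ∧ ∀ u : ℂ, X ≤ u.re → |u.im| ≤ δ →
      ‖kernProd k w α β u * Complex.exp ((s - 1) * Complex.log u)‖ ≤ C * Real.exp (-κ * u.re) := by
  set c := |s.re - 1| + 1 with hc
  have hc0 : 0 < c := by positivity
  set κ := (1 - β) * k / 2 with hκ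
  have hκ0 : 0 < κ := by
    have : 0 < 1 - β := by linarith
    positivity
  set D := Real.exp (κ * δ + c * (Real.log (c / κ) - 1) + |s.im| * Real.pi) with hD
  have hr1 : ∀ r : ℝ, 0 < r → 0 < 1 - Real.exp (-r) := fun r hr => by
    have := Real.exp_lt_one_iff.2 (by linarith : -r < 0)
    linarith
  -- Chosen so that `Re u ≥ X` gives both `Re u ≥ 1` and `|Re (wku)| ≥ 1`.
  set X := max 1 ((1 + k * (|w.im| * δ)) / (k * w.re)) with hX
  refine ⟨1 / (1 - Real.exp (-1)) * (1 / (1 - Real.exp (-k))) * D, κ, X, hκ0,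
    fun u hu him => ?_⟩
  have hu1 : 1 ≤ u.re := (le_max_left _ _).trans hu
  have hu2 : 1 + k * (|w.im| * δ) ≤ u.re * (k * w.re) := by
    rw [← div_le_iff₀ (by positivity)]
    exact (le_max_right _ _).trans hu
  have hn1 : 1 ≤ ‖u‖ := hu1.trans ((le_abs_self _).trans (Complex.abs_re_le_norm u))
  have hn2 : ‖u‖ ≤ u.re + δ := by
    refine (Complex.norm_le_abs_re_add_abs_im u).trans ?_
    rw [abs_of_pos (by linarith)]
    linarith
  have b1 : ‖kern α (-(w * k * u))‖ ≤ 1 / (1 - Real.exp (-1)) := by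
    have hre : (-(w * k * u)).re = -(k * (w.re * u.re - w.im * u.im)) := by
      have : w * k * u = (k : ℝ) * (w * u) := by ring
      rw [Complex.neg_re, this, Complex.re_ofReal_mul, Complex.mul_re]
    have h1 : w.im * u.im ≤ |w.im| * δ := by
      refine (le_abs_self _).trans ?_
      rw [abs_mul]; gcongr
    have h2 : 1 ≤ |(-(w * k * u)).re| := by
      rw [hre, abs_neg]
      refine le_trans ?_ (le_abs_self _)
      nlinarith
    refine (norm_kern_le one_pos h2).trans ?_
    have := hr1 1 one_pos
    gcongr
    apply Real.exp_le_one_iff.2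
    have : 0 ≤ min α (1 - α) := le_min hα0 (by linarith)
    nlinarith
  have b2 : ‖kern β (k * u)‖ ≤ Real.exp (-(2 * κ) * u.re) * (1 / (1 - Real.exp (-k))) := by
    have hre : (k * u : ℂ).re = k * u.re := Complex.re_ofReal_mul _ _
    have := norm_kern_le_of_le_re (α := β) hk (v := k * u) (by rw [hre]; nlinarith)
    rw [hre] at this
    refine this.trans_eq ?_
    rw [hκ, mul_one_div]
    congr 2; ring
  have b3 : ‖Complex.exp ((s - 1) * Complex.log u)‖ ≤ D * Real.exp (κ * u.re) := by
    rw [Complex.norm_exp, hD, ← Real.exp_add]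
    apply Real.exp_le_exp.2
    rw [Complex.mul_re, Complex.log_re, Complex.log_im, Complex.sub_re, Complex.sub_im,
      Complex.one_re, Complex.one_im, sub_zero]
    have h1 : -(s.im * u.arg) ≤ |s.im| * Real.pi := by
      refine (neg_le_abs _).trans ?_
      rw [abs_mul]
      gcongr
      exact Complex.abs_arg_le_pi u
    have hlog0 : 0 ≤ Real.log ‖u‖ := Real.log_nonneg hn1
    have h2 : (s.re - 1) * Real.log ‖u‖ ≤ c * Real.log ‖u‖ := by
      gcongr
      linarith [le_abs_self (s.re - 1)]
    have h3 : c * Real.log ‖u‖ ≤ κ * ‖u‖ + c * (Real.log (c / κ) - 1) := by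
      have hpos : 0 < ‖u‖ := by linarith
      have h4 := Real.log_le_sub_one_of_pos (show 0 < ‖u‖ / (c / κ) by positivity)
      rw [Real.log_div hpos.ne' (by positivity)] at h4
      have h5 : c * (‖u‖ / (c / κ)) = κ * ‖u‖ := by field_simp
      nlinarith
    nlinarith
  have hk1 := hr1 k hk
  have h11 := hr1 1 one_pos
  calc _ ≤ 1 / (1 - Real.exp (-1)) * (Real.exp (-(2 * κ) * u.re) * (1 / (1 - Real.exp (-k)))) *
        (D * Real.exp (κ * u.re)) := by
        unfold kernProd
        rw [norm_mul, norm_mul]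
        gcongr
    _ = 1 / (1 - Real.exp (-1)) * (1 / (1 - Real.exp (-k))) * D *
        (Real.exp (-(2 * κ) * u.re) * Real.exp (κ * u.re)) := by ring
    _ = _ := by
      rw [← Real.exp_add]
      congr 2; ring

lemma integrableOn_kernProd_mul_exp (hk : 0 < k) (hwr : 0 < w.re) (hα0 : 0 ≤ α) (hα1 : α ≤ 1)
    (hβ1 : β < 1) (hδ0 : 0 < |δ|) (hδ : |δ| < stripWidth k w) (s : ℂ) :
    IntegrableOn (fun x : ℝ => kernProd k w α β (x + δ * Complex.I) *
      Complex.exp ((s - 1) * Complex.log (x + δ * Complex.I))) (Ioi 0) := by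
  obtain ⟨C, κ, X, hκ, hb⟩ := exists_norm_kernProd_mul_exp_le hk hwr hα0 hα1 hβ1 |δ| s
  have hc : ContinuousOn (fun x : ℝ => kernProd k w α β (x + δ * Complex.I) *
      Complex.exp ((s - 1) * Complex.log (x + δ * Complex.I))) (Ici 0) := by
    intro x _
    have hx : (x + δ * Complex.I : ℂ) ∈ Complex.slitPlane := Or.inr (by simpa using hδ0)
    exact ((differentiableAt_kernProd_mul_exp (α := α) (β := β) (s := s) hk hwr hx
      (by simpa using hδ)).continuousAt.comp (f := fun x : ℝ => (x + δ * Complex.I : ℂ))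
      (by fun_prop)).continuousWithinAt
  rw [IntegrableOn, ← integrable_norm_iff
    ((hc.mono Ioi_subset_Ici_self).aestronglyMeasurable measurableSet_Ioi)]
  refine integrable_of_isBigO_exp_neg hκ hc.norm (Asymptotics.IsBigO.of_bound C ?_)
  filter_upwards [eventually_ge_atTop X] with x hx
  have := hb (x + δ * Complex.I) (by simpa using hx) (by simp)
  rw [norm_norm, Real.norm_eq_abs, abs_of_pos (Real.exp_pos _)]
  simpa using this

lemma logIntegrand_eq_mul_exp {t : ℂ} (h1 : -Real.pi < t.im) (h2 : t.im ≤ Real.pi) :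
    logIntegrand k w s α β t = kernProd k w α β (Complex.exp t) *
      Complex.exp ((s - 1) * Complex.log (Complex.exp t)) * Complex.exp t := by
  rw [Complex.log_exp h1 h2, logIntegrand, kernProd, mul_assoc _ (Complex.exp _) (Complex.exp _),
    ← Complex.exp_add]
  congr 2; ring

lemma convex_truncatedStrip (m ε : ℝ) : Convex ℝ {u : ℂ | |u.im| < m ∧ 0 < u.re + ε * u.im} := by
  have h1 : Convex ℝ {u : ℂ | |u.im| < m} := by
    have : {u : ℂ | |u.im| < m} = Complex.imLm ⁻¹' (Ioo (-m) m) := by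
      ext u; simp [abs_lt]
    rw [this]
    exact (convex_Ioo _ _).linear_preimage _
  have h2 : Convex ℝ {u : ℂ | 0 < u.re + ε * u.im} :=
    (convex_Ioi (0 : ℝ)).linear_preimage (Complex.reLm + ε • Complex.imLm)
  exact h1.inter h2

lemma isOpen_truncatedStrip (m ε : ℝ) : IsOpen {u : ℂ | |u.im| < m ∧ 0 < u.re + ε * u.im} :=
  (isOpen_lt (f := fun u : ℂ => |u.im|) (g := fun _ => m) (by fun_prop) (by fun_prop)).inter
    (isOpen_lt (f := fun _ : ℂ => (0 : ℝ)) (g := fun u => u.re + ε * u.im) (by fun_prop)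
      (by fun_prop))

/-- Cauchy's theorem moves the half-line at height `εδ` to the quarter circle from `εiδ` to `δ`
followed by `[δ, ∞)`. It is carried out with one primitive `P`: both integrals are differences of
values of `P`, and `P (X + εiδ) - P X → 0`. -/
theorem integral_horizontal_eq_logIntegrand (hk : 0 < k) (hwr : 0 < w.re)
    (hα0 : 0 < α) (hα1 : α < 1) (hβ0 : 0 < β) (hβ1 : β < 1) (hδ0 : 0 < δ)
    (hδ : δ < stripWidth k w) (hε : ε = 1 ∨ ε = -1) :
    ∫ x in Ioi (0 : ℝ), kernProd k w α β (x + (ε * δ : ℝ) * Complex.I) *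
        Complex.exp ((s - 1) * Complex.log (x + (ε * δ : ℝ) * Complex.I)) =
      (∫ x in Ioi (Real.log δ), logIntegrand k w s α β (x + (0 : ℝ) * Complex.I)) -
        Complex.I * ∫ y in (0 : ℝ)..(ε * (Real.pi / 2)),
          logIntegrand k w s α β (Real.log δ + y * Complex.I) := by
  have hpi := Real.pi_pos
  set m := stripWidth k w with hm
  set G : ℂ → ℂ := fun u => kernProd k w α β u * Complex.exp ((s - 1) * Complex.log u) with hG
  -- The slanted cut keeps the domain convex and free of `0`, the only pole in the strip, while
  -- leaving room for the quarter circle; convexity yields the primitive.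
  set V : Set ℂ := {u : ℂ | |u.im| < m ∧ 0 < u.re + ε * u.im} with hV
  set Φ := logIntegrand k w s α β with hΦ
  have hGd : ∀ u ∈ V, DifferentiableAt ℂ G u := fun u hu =>
    differentiableAt_kernProd_mul_exp hk hwr (mem_slitPlane_of_pos hu.2) hu.1
  obtain ⟨P, hP⟩ := (convex_truncatedStrip m ε).exists_forall_hasDerivWithinAt
    (fun u hu => (hGd u hu).differentiableWithinAt)
  replace hP : ∀ u ∈ V, HasDerivAt P (G u) u := fun u hu =>
    (hP u hu).hasDerivAt ((isOpen_truncatedStrip m ε).mem_nhds hu)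
  have hε2 : ε * ε = 1 := by rcases hε with h | h <;> simp [h]
  have hεa : |ε| = 1 := by rcases hε with h | h <;> simp [h]
  have hm0 : 0 < m := hδ0.trans hδ
  have hΦP : ∀ t : ℂ, -Real.pi < t.im → t.im ≤ Real.pi → Complex.exp t ∈ V →
      HasDerivAt (fun t => P (Complex.exp t)) (Φ t) t := fun t h1 h2 h3 => by
    rw [hΦ, logIntegrand_eq_mul_exp h1 h2]
    exact (hP _ h3).comp t (Complex.hasDerivAt_exp t)
  have hΦc : ∀ t : ℂ, Complex.exp t ∈ V → ContinuousAt Φ t := fun t h3 => by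
    obtain ⟨h1, h2⟩ := exp_ne_one_of_abs_im_lt_stripWidth hk hwr (Complex.exp_ne_zero t) h3.1
    exact (differentiableAt_logIntegrand h2 h1).continuousAt
  have hreal : ∀ x : ℝ, Complex.exp (x + (0 : ℝ) * Complex.I) = (Real.exp x : ℝ) := fun x => by
    simp
  have hpos : ∀ x : ℝ, 0 < x → (x : ℂ) ∈ V := fun x hx => by
    refine ⟨by simpa using hm0, by simpa using hx⟩
  have hline : ∀ x : ℝ, 0 ≤ x → (x + (ε * δ : ℝ) * Complex.I : ℂ) ∈ V := fun x hx => by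
    refine ⟨?_, ?_⟩
    · simpa [abs_mul, hεa, abs_of_pos hδ0] using hδ
    · have : 0 < x + ε * (ε * δ) := by rw [← mul_assoc, hε2]; linarith
      simpa using this
  -- the integral over the vertical segment
  have harc : Complex.I * ∫ y in (0 : ℝ)..(ε * (Real.pi / 2)), Φ (Real.log δ + y * Complex.I) =
      P ((0 : ℝ) + (ε * δ : ℝ) * Complex.I) - P δ := by
    have hexp : ∀ y : ℝ, Complex.exp (Real.log δ + y * Complex.I) =
        ⟨δ * Real.cos y, δ * Real.sin y⟩ := fun y => by
      rw [Complex.exp_add, ← Complex.ofReal_exp, Real.exp_log hδ0, Complex.exp_mul_I,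
        Complex.mk_eq_add_mul_I]
      push_cast; ring
    have hmem : ∀ y : ℝ, |y| ≤ Real.pi / 2 → 0 ≤ ε * y →
        Complex.exp (Real.log δ + y * Complex.I) ∈ V := fun y hy hεy => by
      rw [hexp]
      obtain ⟨hy1, hy2⟩ := abs_le.1 hy
      have hc := Real.cos_nonneg_of_neg_pi_div_two_le_of_le hy1 hy2
      have hs : 0 ≤ ε * Real.sin y := by
        rcases hε with h | h
        · rw [h, one_mul] at hεy ⊢
          exact Real.sin_nonneg_of_nonneg_of_le_pi hεy (by linarith)
        · rw [h] at hεy ⊢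
          have := Real.sin_nonpos_of_nonpos_of_neg_pi_le (x := y) (by linarith) (by linarith)
          linarith
      have hsq : (ε * Real.sin y) ^ 2 + Real.cos y ^ 2 = 1 := by
        rw [← Real.sin_sq_add_cos_sq y]; linear_combination (Real.sin y ^ 2) * hε2
      refine ⟨?_, ?_⟩
      · have h1 : |δ * Real.sin y| ≤ δ := by
          rw [abs_mul, abs_of_pos hδ0]
          exact mul_le_of_le_one_right hδ0.le (Real.abs_sin_le_one y)
        exact h1.trans_lt hδ
      · have h1 : 0 < Real.cos y + ε * Real.sin y := by nlinarith
        have h2 : 0 < δ * Real.cos y + ε * (δ * Real.sin y) := by nlinarith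
        exact h2
    have h0 : Complex.exp (Real.log δ + (0 : ℝ) * Complex.I) = δ := by
      rw [hexp]; apply Complex.ext <;> simp
    have h1 : Complex.exp (Real.log δ + (ε * (Real.pi / 2) : ℝ) * Complex.I) =
        (0 : ℝ) + (ε * δ : ℝ) * Complex.I := by
      rw [hexp]
      rcases hε with h | h <;> apply Complex.ext <;> simp [h]
    rcases hε with h | h
    · subst h
      have := integral_vertical_eq_sub (F := fun t => P (Complex.exp t)) (f := Φ)
        (x := Real.log δ) (c := 0) (d := 1 * (Real.pi / 2)) (by linarith)
        (fun y hy => hΦP _ (by simpa using by linarith [hy.1]) (by simpa using by linarith [hy.2])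
          (hmem y (abs_le.2 ⟨by linarith [hy.1], by linarith [hy.2]⟩) (by linarith [hy.1])))
        (fun y hy => hΦc _
          (hmem y (abs_le.2 ⟨by linarith [hy.1], by linarith [hy.2]⟩) (by linarith [hy.1])))
      rw [this, h0, h1]
    · subst h
      have := integral_vertical_eq_sub (F := fun t => P (Complex.exp t)) (f := Φ)
        (x := Real.log δ) (c := -1 * (Real.pi / 2)) (d := 0) (by linarith)
        (fun y hy => hΦP _ (by simpa using by linarith [hy.1]) (by simpa using by linarith [hy.2])
          (hmem y (abs_le.2 ⟨by linarith [hy.1], by linarith [hy.2]⟩) (by linarith [hy.2])))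
        (fun y hy => hΦc _
          (hmem y (abs_le.2 ⟨by linarith [hy.1], by linarith [hy.2]⟩) (by linarith [hy.2])))
      rw [intervalIntegral.integral_symm, mul_neg, this, h0, h1]
      ring
  -- the bound at infinity
  obtain ⟨C, κ, X₀, hκ, hb⟩ := exists_norm_kernProd_mul_exp_le (k := k) (w := w) (α := α) (β := β)
    hk hwr hα0.le hα1.le hβ1 δ s
  have hdiff : Tendsto (fun X : ℝ => P (X + (ε * δ : ℝ) * Complex.I) - P X) atTop (𝓝 0) := by
    have hlim : Tendsto (fun X : ℝ => C * Real.exp (-κ * X) * δ) atTop (𝓝 0) := by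
      have : Tendsto (fun X : ℝ => Real.exp (-κ * X)) atTop (𝓝 0) :=
        Real.tendsto_exp_atBot.comp (tendsto_id.const_mul_atTop_of_neg (by linarith))
      simpa using (this.const_mul C).mul_const δ
    refine squeeze_zero_norm' ?_ hlim
    filter_upwards [eventually_ge_atTop X₀, eventually_gt_atTop 0] with X hX hX0
    have hseg : ∀ u ∈ segment ℝ (X : ℂ) (X + (ε * δ : ℝ) * Complex.I),
        u ∈ V ∧ u.re = X ∧ |u.im| ≤ δ := by
      rintro u ⟨p, q, hp, hq, hpq, rfl⟩
      have h1 : (p • (X : ℂ) + q • (X + (ε * δ : ℝ) * Complex.I) : ℂ).re = X := by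
        have : p * X + q * X = X := by rw [← add_mul, hpq, one_mul]
        simpa using this
      have h2 : (p • (X : ℂ) + q • (X + (ε * δ : ℝ) * Complex.I) : ℂ).im = q * (ε * δ) := by simp
      refine ⟨(convex_truncatedStrip m ε) (hpos X hX0) (hline X hX0.le) hp hq hpq, h1, ?_⟩
      rw [h2, abs_mul, abs_mul, hεa, one_mul, abs_of_pos hδ0, abs_of_nonneg hq]
      exact mul_le_of_le_one_left hδ0.le (by linarith)
    have := (convex_segment (𝕜 := ℝ) (X : ℂ) (X + (ε * δ : ℝ) * Complex.I)).norm_image_sub_le_of_norm_hasDerivWithin_le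
      (f := P) (f' := G) (C := C * Real.exp (-κ * X))
      (fun u hu => (hP u (hseg u hu).1).hasDerivWithinAt) (fun u hu => by
        have := hb u (by rw [(hseg u hu).2.1]; exact hX) (hseg u hu).2.2
        rwa [(hseg u hu).2.1] at this)
      (left_mem_segment _ _ _) (right_mem_segment _ _ _)
    refine this.trans_eq ?_
    rw [add_sub_cancel_left, norm_mul, Complex.norm_I, mul_one, Complex.norm_real, norm_mul,
      Real.norm_eq_abs, Real.norm_eq_abs, hεa, one_mul, abs_of_pos hδ0]
  have hδa : |ε * δ| = δ := by rw [abs_mul, hεa, one_mul, abs_of_pos hδ0]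
  have hI1 : Tendsto (fun X : ℝ => P (X + (ε * δ : ℝ) * Complex.I) -
      P ((0 : ℝ) + (ε * δ : ℝ) * Complex.I)) atTop
      (𝓝 (∫ x in Ioi (0 : ℝ), G (x + (ε * δ : ℝ) * Complex.I))) := by
    have hint : IntegrableOn (fun x : ℝ => G (x + (ε * δ : ℝ) * Complex.I)) (Ioi 0) :=
      integrableOn_kernProd_mul_exp hk hwr hα0.le hα1.le hβ1 (by rw [hδa]; exact hδ0)
        (by rw [hδa]; exact hδ) s
    refine (intervalIntegral_tendsto_integral_Ioi 0 hint tendsto_id).congr' ?_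
    filter_upwards [eventually_ge_atTop 0] with X hX
    exact integral_horizontal_eq_sub hX (fun x hx => hP _ (hline x hx.1))
      (fun x hx => (hGd _ (hline x hx.1)).continuousAt)
  have hI2 : Tendsto (fun X : ℝ => P X - P δ) atTop
      (𝓝 (∫ x in Ioi (Real.log δ), Φ (x + (0 : ℝ) * Complex.I))) := by
    have hq : 0 < k := hk
    obtain ⟨C', κ', hκ', hb'⟩ : ∃ C κ : ℝ, 0 < κ ∧ ∀ x : ℝ, Real.log δ ≤ x →
        ‖Φ (x + (0 : ℝ) * Complex.I)‖ ≤ C * Real.exp (-κ * Real.exp x) := by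
      obtain ⟨C', κ', hκ', hb'⟩ := exists_norm_kern_mul_exp_le (β := β) (l := k) (s := s)
        (x₀ := Real.log δ) (θ₁ := 0) (θ₂ := 0) (q := k) hβ0 hβ1 hk (fun t h1 h2 => by
          rw [Complex.re_ofReal_mul, Complex.exp_re, le_antisymm h2 h1, Real.cos_zero, mul_one]
          exact le_abs_self _)
      have hr0 : 0 < k * w.re * δ := by positivity
      refine ⟨1 / (1 - Real.exp (-(k * w.re * δ))) * C', κ', hκ', fun x hx => ?_⟩
      have h1 := hb' (x + (0 : ℝ) * Complex.I) (by simpa using hx) (by simp) (by simp)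
      have hδx : δ ≤ Real.exp x := by rwa [← Real.log_le_iff_le_exp hδ0]
      have hre : (-(w * k * Complex.exp (x + (0 : ℝ) * Complex.I))).re =
          -(k * w.re * Real.exp x) := by
        have : w * k * (Real.exp x : ℝ) = (k * Real.exp x : ℝ) * w := by push_cast; ring
        rw [hreal, Complex.neg_re, this, Complex.re_ofReal_mul]; ring
      have h2 := norm_kern_le (α := α) hr0
        (v := -(w * k * Complex.exp (x + (0 : ℝ) * Complex.I))) (by
          rw [hre, abs_neg, abs_of_pos (by positivity)]; gcongr)
      have h3 : 0 < 1 - Real.exp (-(k * w.re * δ)) := by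
        have := Real.exp_lt_one_iff.2 (by linarith : -(k * w.re * δ) < 0)
        linarith
      rw [hΦ, logIntegrand, mul_assoc (kern α _), norm_mul, mul_assoc (1 / _)]
      have h4 : (x + (0 : ℝ) * Complex.I : ℂ).re = x := by simp
      rw [h4] at h1
      refine mul_le_mul (h2.trans ?_) h1 (norm_nonneg _) (by positivity)
      gcongr
      apply Real.exp_le_one_iff.2
      have h5 : 0 ≤ min α (1 - α) := le_min hα0.le (by linarith)
      nlinarith [abs_nonneg (-(w * k * Complex.exp (x + (0 : ℝ) * Complex.I))).re]
    have hmem : ∀ x : ℝ, Complex.exp (x + (0 : ℝ) * Complex.I) ∈ V := fun x => by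
      rw [hreal]; exact hpos _ (Real.exp_pos _)
    refine (intervalIntegral_tendsto_integral_Ioi _ (integrableOn_horizontal hκ'
      (fun x _ => hΦc _ (hmem x)) hb') Real.tendsto_log_atTop).congr' ?_
    filter_upwards [eventually_ge_atTop δ] with X hX
    have hX0 : 0 < X := hδ0.trans_le hX
    have := integral_horizontal_eq_sub (F := fun t => P (Complex.exp t)) (f := Φ) (y := 0)
      (Real.log_le_log hδ0 hX) (fun x _ => hΦP _ (by simpa using hpi) (by simpa using hpi.le)
        (hmem x)) (fun x _ => hΦc _ (hmem x))
    rw [this]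
    simp only [hreal]
    rw [Real.exp_log hδ0, Real.exp_log hX0]
  have hfin := tendsto_nhds_unique hdiff
    (((hI1.sub hI2).add_const (P ((0 : ℝ) + (ε * δ : ℝ) * Complex.I) - P δ)).congr fun X => by ring)
  rw [harc]
  linear_combination -hfin

end

/-! ### The loop integral as a sum of residues -/

section

variable {k : ℝ} {w s : ℂ} {α β δ : ℝ}

lemma log_lt_poleLog_re (hk : 0 < k) (hwr : 0 < w.re) (hδ0 : 0 < δ) (hδ : δ < stripWidth k w) :
    Real.log δ < (poleLog k 1).re ∧ Real.log δ < (poleLog k w).re := by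
  have hw : w ≠ 0 := fun h => by simp [h] at hwr
  have hn : 0 < ‖w‖ := norm_pos_iff.2 hw
  have hns : 0 < k * Complex.normSq w := mul_pos hk (Complex.normSq_pos.2 hw)
  have h1 : δ < 2 * Real.pi / k := hδ.trans_le (min_le_left _ _)
  have h2 : δ < 2 * Real.pi * w.re / (k * Complex.normSq w) := hδ.trans_le (min_le_right _ _)
  have hpi := Real.pi_pos
  rw [poleLog_re, poleLog_re, norm_one, Real.log_one, sub_zero]
  refine ⟨Real.log_lt_log hδ0 h1, ?_⟩
  rw [← Real.log_div (by positivity) hn.ne']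
  refine Real.log_lt_log hδ0 (h2.trans_le ?_)
  rw [div_div, div_le_div_iff₀ hns (by positivity), Complex.normSq_eq_norm_sq]
  have : w.re ≤ ‖w‖ := (le_abs_self _).trans (Complex.abs_re_le_norm w)
  have h3 : 0 ≤ 2 * Real.pi * k * ‖w‖ := by positivity
  nlinarith

lemma logIntegrand_add_two_pi_mul_I (t : ℂ) :
    logIntegrand k w s α β (t + (2 * Real.pi : ℝ) * Complex.I) =
      Complex.exp (2 * Real.pi * Complex.I * s) * logIntegrand k w s α β t := by
  unfold logIntegrand
  have h : Complex.exp (t + (2 * Real.pi : ℝ) * Complex.I) = Complex.exp t := by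
    rw [Complex.exp_add]; push_cast; rw [Complex.exp_two_pi_mul_I, mul_one]
  rw [h, mul_add, Complex.exp_add]
  have h2 : s * ((2 * Real.pi : ℝ) * Complex.I) = 2 * Real.pi * Complex.I * s := by
    push_cast; ring
  rw [h2]
  ring

lemma integrand_upper (hδ0 : 0 < δ) (x : ℝ) :
    kernProd k w α β (x + δ * Complex.I) * branchPow (x + δ * Complex.I) (s - 1) =
      kernProd k w α β (x + δ * Complex.I) *
        Complex.exp ((s - 1) * Complex.log (x + δ * Complex.I)) := by
  rw [branchPow_of_im_pos (by simpa using hδ0)]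

lemma integrand_lower (hδ0 : 0 < δ) (x : ℝ) :
    kernProd k w α β (x - δ * Complex.I) * branchPow (x - δ * Complex.I) (s - 1) =
      Complex.exp (2 * Real.pi * Complex.I * s) * (kernProd k w α β (x + (-δ : ℝ) * Complex.I) *
        Complex.exp ((s - 1) * Complex.log (x + (-δ : ℝ) * Complex.I))) := by
  have h : (x - δ * Complex.I : ℂ) = x + (-δ : ℝ) * Complex.I := by push_cast; ring
  rw [h, branchPow_of_im_neg (by simpa using hδ0)]
  ring

lemma integrand_arc (hδ0 : 0 < δ) {y : ℝ} (hy : y ∈ Icc (Real.pi / 2) (3 * Real.pi / 2)) :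
    kernProd k w α β (δ * Complex.exp (y * Complex.I)) *
        branchPow (δ * Complex.exp (y * Complex.I)) (s - 1) *
        (δ * Complex.I * Complex.exp (y * Complex.I)) =
      Complex.I * logIntegrand k w s α β (Real.log δ + y * Complex.I) := by
  have hpi := Real.pi_pos
  have h : (δ * Complex.exp (y * Complex.I) : ℂ) = Complex.exp (Real.log δ + y * Complex.I) := by
    rw [Complex.exp_add, ← Complex.ofReal_exp, Real.exp_log hδ0]
  have him : (Real.log δ + y * Complex.I : ℂ).im = y := by
    rw [Complex.add_im, Complex.ofReal_im]; simp
  have hb := branchPow_exp_mul_exp (t := Real.log δ + y * Complex.I) (by rw [him]; linarith [hy.1])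
    (by rw [him]; linarith [hy.2]) s
  have h2 : (δ * Complex.I * Complex.exp (y * Complex.I) : ℂ) =
      Complex.I * Complex.exp (Real.log δ + y * Complex.I) := by rw [← h]; ring
  rw [h2, h, logIntegrand, ← hb, kernProd]
  ring

/-- The closed range of `α` is needed because the sums include pairs with `M = kc`, even though
their weight is zero. -/
theorem loopIntegrable_kernProd (hk : 0 < k) (hwr : 0 < w.re) (hα0 : 0 ≤ α) (hα1 : α ≤ 1)
    (hβ1 : β < 1) (hδ0 : 0 < δ) (hδ : δ < stripWidth k w) (s : ℂ) :
    LoopIntegrable δ (fun u => kernProd k w α β u * branchPow u (s - 1)) := by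
  have hpi := Real.pi_pos
  have hw : w ≠ 0 := fun h => by simp [h] at hwr
  obtain ⟨hx1, hxw⟩ := log_lt_poleLog_re hk hwr hδ0 hδ
  refine ⟨?_, ?_, ?_⟩
  · simp only [integrand_upper hδ0]
    exact integrableOn_kernProd_mul_exp hk hwr hα0 hα1 hβ1 (abs_pos.2 hδ0.ne')
      (by rwa [abs_of_pos hδ0]) s
  · have h : IntervalIntegrable
        (fun y : ℝ => Complex.I * logIntegrand k w s α β (Real.log δ + y * Complex.I)) volume
        (Real.pi / 2) (3 * Real.pi / 2) :=
      (intervalIntegrable_vertical (by linarith) fun y _ =>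
        (differentiableAt_logIntegrand_of_re_le hk hw hx1 hxw
          (by rw [Complex.add_re, Complex.ofReal_re]; simp)).continuousAt).const_mul _
    refine h.congr fun y hy => ?_
    rw [uIoc_of_le (by linarith)] at hy
    exact (integrand_arc hδ0 (Ioc_subset_Icc_self hy)).symm
  · simp only [integrand_lower hδ0]
    exact (integrableOn_kernProd_mul_exp hk hwr hα0 hα1 hβ1 (abs_pos.2 (by linarith))
      (by rwa [abs_neg, abs_of_pos hδ0]) s).const_mul _

/-- In logarithmic coordinates the loop deforms to the boundary of the half-strip `Re t > log δ`, `0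
< Im t < 2π`, traversed negatively; hence the minus sign. -/
theorem hasSum_loopIntegral (hk : 0 < k) (hwr : 0 < w.re) (hwi : 0 < w.im)
    (hα0 : 0 < α) (hα1 : α < 1) (hβ0 : 0 < β) (hβ1 : β < 1) (hδ0 : 0 < δ)
    (hδ : δ < stripWidth k w) (s : ℂ) :
    HasSum (fun n : ℕ => -(residueTerm k w s α β (n + 1) +
        Complex.exp (Real.pi * Complex.I * s) * residueTerm k w s (1 - α) (1 - β) (n + 1)))
      (loopIntegral δ (fun u => kernProd k w α β u * branchPow u (s - 1))) := by
  have hpi := Real.pi_pos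
  have hw : w ≠ 0 := fun h => by simp [h] at hwr
  obtain ⟨hx1, hxw⟩ := log_lt_poleLog_re hk hwr hδ0 hδ
  refine Eq.subst (motive := fun a => HasSum _ a) (Eq.symm ?_)
    (hasSum_residueTerm (s := s) hk hwr hwi hα0 hα1 hβ0 hβ1 hx1 hxw).neg
  have hU := integral_horizontal_eq_logIntegrand (s := s) hk hwr hα0 hα1 hβ0 hβ1 hδ0 hδ
    (Or.inl rfl)
  have hL := integral_horizontal_eq_logIntegrand (s := s) hk hwr hα0 hα1 hβ0 hβ1 hδ0 hδ
    (Or.inr rfl)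
  simp only [one_mul, neg_mul] at hU hL
  set Φ := logIntegrand k w s α β with hΦ
  have hE : ∀ t, Complex.exp (2 * Real.pi * Complex.I * s) * Φ t =
      Φ (t + (2 * Real.pi : ℝ) * Complex.I) := fun t => (logIntegrand_add_two_pi_mul_I t).symm
  -- On the lower half-line the branch differs from the principal one by `exp (2πis)`; this moves
  -- the arc over `[-π/2, 0]` to `[3π/2, 2π]`, closing the circle.
  have hV : Complex.exp (2 * Real.pi * Complex.I * s) *
      (∫ y in (0 : ℝ)..-(Real.pi / 2), Φ (Real.log δ + y * Complex.I)) =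
      -∫ y in (3 * Real.pi / 2)..2 * Real.pi, Φ (Real.log δ + y * Complex.I) := by
    rw [← intervalIntegral.integral_const_mul, ← intervalIntegral.integral_symm]
    have h : ∀ y : ℝ, Complex.exp (2 * Real.pi * Complex.I * s) *
        Φ (Real.log δ + y * Complex.I) = Φ (Real.log δ + (y + 2 * Real.pi : ℝ) * Complex.I) :=
      fun y => by rw [hE]; congr 1; push_cast; ring
    simp only [h]
    rw [intervalIntegral.integral_comp_add_right
      (fun y : ℝ => Φ (Real.log δ + y * Complex.I))]
    congr 1 <;> ring
  have hH : Complex.exp (2 * Real.pi * Complex.I * s) *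
      (∫ x in Ioi (Real.log δ), Φ (x + (0 : ℝ) * Complex.I)) =
      ∫ x in Ioi (Real.log δ), Φ (x + (2 * Real.pi : ℝ) * Complex.I) := by
    rw [← integral_const_mul]
    simp only [hE]
    simp
  have hA : (∫ y in (Real.pi / 2)..(3 * Real.pi / 2),
      kernProd k w α β (δ * Complex.exp (y * Complex.I)) *
        branchPow (δ * Complex.exp (y * Complex.I)) (s - 1) *
        (δ * Complex.I * Complex.exp (y * Complex.I))) =
      Complex.I * ∫ y in (Real.pi / 2)..(3 * Real.pi / 2), Φ (Real.log δ + y * Complex.I) := by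
    rw [← intervalIntegral.integral_const_mul]
    refine intervalIntegral.integral_congr fun y hy => ?_
    rw [uIcc_of_le (by linarith)] at hy
    exact integrand_arc hδ0 hy
  have hi : ∀ c d : ℝ, c ≤ d → IntervalIntegrable
      (fun y : ℝ => Φ (Real.log δ + y * Complex.I)) volume c d := fun c d hcd =>
    intervalIntegrable_vertical hcd fun y _ =>
      (differentiableAt_logIntegrand_of_re_le hk hw hx1 hxw
        (by rw [Complex.add_re, Complex.ofReal_re]; simp)).continuousAt
  have hsplit : (∫ y in (0 : ℝ)..2 * Real.pi, Φ (Real.log δ + y * Complex.I)) =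
      (∫ y in (0 : ℝ)..(Real.pi / 2), Φ (Real.log δ + y * Complex.I)) +
      (∫ y in (Real.pi / 2)..(3 * Real.pi / 2), Φ (Real.log δ + y * Complex.I)) +
      ∫ y in (3 * Real.pi / 2)..2 * Real.pi, Φ (Real.log δ + y * Complex.I) := by
    rw [intervalIntegral.integral_add_adjacent_intervals (hi _ _ (by linarith))
      (hi _ _ (by linarith)), intervalIntegral.integral_add_adjacent_intervals
      (hi _ _ (by linarith)) (hi _ _ (by linarith))]
  unfold loopIntegral
  simp only [integrand_upper hδ0, integrand_lower hδ0]
  rw [integral_const_mul, hU, hL, hA, hsplit, ← hH, mul_sub]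
  linear_combination (-Complex.I) * hV

end

/-! ### Admissible radii -/

section

variable {k : ℕ} {w : ℂ} {δ : ℝ}

lemma abs_im_le_infDist (u : ℂ) : |u.im| ≤ Metric.infDist u nonnegAxis := by
  refine (Metric.le_infDist ⟨0, by simp [nonnegAxis]⟩).2 fun v hv => ?_
  have h := Complex.abs_im_le_norm (u - v)
  rw [Complex.sub_im, hv.2, sub_zero] at h
  rwa [dist_eq_norm]

lemma infDist_nonnegAxis_le {u : ℂ} (hu : 0 ≤ u.re) : Metric.infDist u nonnegAxis ≤ |u.im| := by
  have hmem : ((u.re : ℝ) : ℂ) ∈ nonnegAxis := ⟨by simpa using hu, by simp⟩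
  refine (Metric.infDist_le_dist_of_mem hmem).trans_eq ?_
  have : u - (u.re : ℝ) = (u.im : ℝ) * Complex.I := by
    linear_combination -(Complex.re_add_im u)
  rw [dist_eq_norm, this]
  simp

/-- The poles `2πi/k` and `2πi/(kw)` have nonnegative real part, so their distance to the axis is at
most their imaginary part, and they force the bound. Conversely `|Im u|` never exceeds the distance
to the axis. -/
theorem isLoopRadius_iff (hk : 0 < k) (hwr : 0 < w.re) (hwi : 0 < w.im) :
    IsLoopRadius k w δ ↔ 0 < δ ∧ δ < stripWidth k w := by
  have hk' : (0 : ℝ) < k := by exact_mod_cast hk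
  have hkc : (k : ℂ) ≠ 0 := by exact_mod_cast hk.ne'
  have hw : w ≠ 0 := fun h => by simp [h] at hwr
  have hns : 0 < k * Complex.normSq w := mul_pos hk' (Complex.normSq_pos.2 hw)
  have hpi := Real.pi_pos
  have hpi0 := Complex.two_pi_I_ne_zero
  refine and_congr_right fun hδ0 => ⟨fun h => ?_, fun h u hu h0 => ?_⟩
  · refine lt_min ?_ ?_
    · by_contra! hle
      have him : (2 * Real.pi * Complex.I / k : ℂ) = (0 : ℝ) + (2 * Real.pi / k : ℝ) * Complex.I := by
        push_cast; ring
      have := h (2 * Real.pi * Complex.I / k) ?_ ?_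
      · exact div_ne_zero hpi0 hkc this
      · rw [him]
        refine (infDist_nonnegAxis_le (by simp)).trans ?_
        have : |((0 : ℝ) + (2 * Real.pi / k : ℝ) * Complex.I : ℂ).im| = 2 * Real.pi / k := by
          rw [Complex.add_im, Complex.im_ofReal_mul, Complex.ofReal_im, Complex.I_im, mul_one,
            zero_add, abs_of_pos (by positivity)]
        rwa [this]
      · rw [mul_div_cancel₀ _ hkc, Complex.exp_two_pi_mul_I]; simp
    · by_contra! hle
      have hu : (2 * Real.pi * Complex.I / (k * w) : ℂ) =
          (2 * Real.pi / (k * Complex.normSq w) : ℝ) * (Complex.I * (starRingEnd ℂ) w) := by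
        push_cast
        rw [← Complex.mul_conj]
        have : (starRingEnd ℂ) w ≠ 0 := by simpa using hw
        field_simp
      have hc : 0 < 2 * Real.pi / (k * Complex.normSq w) := by positivity
      have := h (2 * Real.pi * Complex.I / (k * w)) ?_ ?_
      · exact div_ne_zero hpi0 (mul_ne_zero hkc hw) this
      · rw [hu]
        refine (infDist_nonnegAxis_le ?_).trans ?_
        · rw [Complex.re_ofReal_mul]
          refine mul_nonneg hc.le ?_
          simpa using hwi.le
        · rw [Complex.im_ofReal_mul]
          have : (Complex.I * (starRingEnd ℂ) w).im = w.re := by simp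
          rw [this, abs_of_pos (by positivity), div_mul_eq_mul_div]
          exact hle
      · have : -w * k * (2 * Real.pi * Complex.I / (k * w)) = -(2 * Real.pi * Complex.I) := by
          field_simp
        rw [this, Complex.exp_neg, Complex.exp_two_pi_mul_I]; simp
  · by_contra hu0
    obtain ⟨h1, h2⟩ := exp_ne_one_of_abs_im_lt_stripWidth hk' hwr hu0
      (((abs_im_le_infDist u).trans hu).trans_lt h)
    rcases mul_eq_zero.1 h0 with h3 | h3
    · apply h2
      rw [← sub_eq_zero, ← h3]
      push_cast
      congr 2; ring
    · apply h1
      rw [← sub_eq_zero, ← h3]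
      push_cast
      rfl

theorem exists_isLoopRadius (hk : 0 < k) (hwr : 0 < w.re) (hwi : 0 < w.im) :
    ∃ δ : ℝ, IsLoopRadius k w δ := by
  have := stripWidth_pos (k := k) (by exact_mod_cast hk) hwr
  exact ⟨stripWidth k w / 2, (isLoopRadius_iff hk hwr hwi).2 ⟨by linarith, by linarith⟩⟩

end

/-! ### Sums over residue classes -/

lemma sum_filter_dvd_eq_sum_zmod {k : ℕ} [NeZero k] {c : ℤ} (hc : 0 < c) (B : ℤ)
    (g : ZMod k → ℂ) :
    ∑ N ∈ (Finset.Ico 0 (k * c : ℤ)).filter (fun N => c ∣ N - B),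
      g (((N - B) / c : ℤ) : ZMod k) = ∑ x, g x := by
  have hk : (0 : ℤ) < k := by exact_mod_cast NeZero.pos k
  have hK : 0 < (k * c : ℤ) := by positivity
  have key : ∀ t : ℤ, (B + c * (t % k)) % (k * c) = (B + c * t) % (k * c) := fun t => by
    change _ ≡ _ [ZMOD _]
    rw [Int.modEq_iff_dvd]
    refine ⟨t / k, ?_⟩
    have := Int.emod_add_mul_ediv t k
    linear_combination (-c) * this
  refine Finset.sum_nbij' (fun N => (((N - B) / c : ℤ) : ZMod k))
    (fun x => (B + c * x.val) % (k * c)) (fun _ _ => Finset.mem_univ _) ?_ ?_ ?_ (fun _ _ => rfl)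
  · intro x _
    rw [Finset.mem_filter, Finset.mem_Ico]
    refine ⟨⟨Int.emod_nonneg _ hK.ne', Int.emod_lt_of_pos _ hK⟩, ?_⟩
    rw [Int.emod_def]
    exact ⟨x.val - k * ((B + c * x.val) / (k * c)), by ring⟩
  · intro N hN
    rw [Finset.mem_filter, Finset.mem_Ico] at hN
    obtain ⟨⟨h0, h1⟩, t, ht⟩ := hN
    simp only [ht, Int.mul_ediv_cancel_left _ hc.ne', ZMod.val_intCast]
    rw [key, ← ht, add_sub_cancel, Int.emod_eq_of_lt h0 h1]
  · intro x _
    have h : (B + c * (x.val : ℤ)) % (k * c) - B =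
        c * (x.val - k * ((B + c * x.val) / (k * c))) := by rw [Int.emod_def]; ring
    simp only [h, Int.mul_ediv_cancel_left _ hc.ne']
    simp

/-- A geometric series; its exponents `r + ρ` explain why `1 - ρ` is the parameter of the kernel in
the residue sums. -/
lemma hasSum_kern_one_sub (ρ : ℝ) {v : ℂ} (hv : 0 < v.re) :
    HasSum (fun r : ℕ => Complex.exp (-((r + ρ) * v))) (kern (1 - ρ) v) := by
  have hn : ‖Complex.exp (-v)‖ < 1 := by
    rw [Complex.norm_exp]
    exact Real.exp_lt_one_iff.2 (by simpa using hv)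
  have h := (hasSum_geometric_of_norm_lt_one hn).mul_left (Complex.exp (-(ρ * v)))
  have hne : Complex.exp v - 1 ≠ 0 := sub_ne_zero.2 (exp_ne_one_of_re_ne_zero hv.ne')
  have e : kern (1 - ρ) v = Complex.exp (-(ρ * v)) * (1 - Complex.exp (-v))⁻¹ := by
    have h1 : (1 - Complex.exp (-v)) = (Complex.exp v - 1) * Complex.exp (-v) := by
      rw [sub_mul, ← Complex.exp_add]; simp
    have h2 : Complex.exp (((1 - ρ : ℝ) : ℂ) * v) = Complex.exp (-(ρ * v)) * Complex.exp v := by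
      rw [← Complex.exp_add]; congr 1; push_cast; ring
    rw [kern, h1, h2, mul_inv, Complex.exp_neg v, inv_inv]
    ring
  rw [e]
  refine h.congr_fun fun r => ?_
  rw [← Complex.exp_nat_mul, ← Complex.exp_add]
  congr 1; ring

/-- Expand each kernel geometrically and put `m = M + Kr`: the residue classes modulo `K` reassemble
into one series. -/
lemma sum_Ico_mul_kern {K : ℕ} (hK : 0 < K) {v : ℂ} (hv : 0 < v.re) {φ : ℤ → ℂ}
    (hφ : ∀ m r : ℤ, φ (m + K * r) = φ m) (hb : ∀ m, ‖φ m‖ ≤ 1) :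
    ∑ M ∈ Finset.Ico (0 : ℤ) K, φ M * kern (1 - M / K) v =
      ∑' m : ℕ, φ m * Complex.exp (-(m * v / K)) := by
  have : NeZero K := ⟨hK.ne'⟩
  have hK0 : (K : ℂ) ≠ 0 := by exact_mod_cast hK.ne'
  have hsum : Summable fun m : ℕ => φ m * Complex.exp (-(m * v / K)) := by
    have hn : ‖Complex.exp (-(v / K))‖ < 1 := by
      rw [Complex.norm_exp]
      refine Real.exp_lt_one_iff.2 ?_
      rw [Complex.neg_re, Complex.div_natCast_re]
      have : 0 < v.re / K := by positivity
      linarith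
    refine Summable.of_norm_bounded (summable_geometric_of_lt_one (norm_nonneg _) hn) fun m => ?_
    rw [norm_mul, ← norm_pow, ← Complex.exp_nat_mul]
    have e : -(m * v / K) = m * -(v / K) := by ring
    rw [e]
    exact mul_le_of_le_one_left (norm_nonneg _) (hb _)
  rw [Nat.sumByResidueClasses hsum K]
  refine Finset.sum_nbij' (fun M => (M : ZMod K)) (fun x => (x.val : ℤ))
    (fun _ _ => Finset.mem_univ _) ?_ ?_ ?_ ?_
  · intro x _
    rw [Finset.mem_Ico]
    exact ⟨by positivity, by exact_mod_cast ZMod.val_lt x⟩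
  · intro M hM
    rw [Finset.mem_Ico] at hM
    simp only [ZMod.val_intCast]
    exact Int.emod_eq_of_lt hM.1 hM.2
  · intro x _
    simp
  · intro M hM
    rw [Finset.mem_Ico] at hM
    have hval : (((M : ZMod K).val : ℕ) : ℤ) = M := by
      rw [ZMod.val_intCast, Int.emod_eq_of_lt hM.1 hM.2]
    have hval' : (((M : ZMod K).val : ℕ) : ℂ) = M := by exact_mod_cast congrArg (Int.cast : ℤ → ℂ) hval
    rw [← (hasSum_kern_one_sub (M / K : ℝ) hv).tsum_eq, ← tsum_mul_left]
    refine tsum_congr fun r => ?_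
    push_cast
    rw [hval, hφ, hval']
    congr 2
    field_simp
    ring

/-! ### Gauss sums and character series at the poles -/

section

variable {k : ℕ}

lemma conjChar_eq_inv (χ : DirichletCharacter ℂ k) : conjChar χ = χ⁻¹ := by
  ext x
  rw [← MulChar.star_apply']
  rfl

/-- Primitivity makes this valid for every `n`, including those not prime to `k`, where both sides
vanish. -/
lemma sum_mul_stdAddChar [NeZero k] {η : DirichletCharacter ℂ k} (hη : η.IsPrimitive) (n : ℤ) :
    ∑ x : ZMod k, η x * ZMod.stdAddChar ((n : ZMod k) * x) = η⁻¹ n * G η := by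
  have := gaussSum_mulShift_of_isPrimitive (e := ZMod.stdAddChar) hη (n : ZMod k)
  simpa [gaussSum, G] using this

lemma isPrimitive_inv {η : DirichletCharacter ℂ k} (hη : η.IsPrimitive) : η⁻¹.IsPrimitive := by
  rw [DirichletCharacter.isPrimitive_def] at hη ⊢
  rwa [DirichletCharacter.conductor_inv]

lemma norm_exp_two_pi_I_mul_real (x : ℝ) : ‖Complex.exp (2 * Real.pi * Complex.I * x)‖ = 1 := by
  have : (2 * Real.pi * Complex.I * x : ℂ) = ((2 * Real.pi * x : ℝ) : ℂ) * Complex.I := by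
    push_cast; ring
  rw [this, Complex.norm_exp_ofReal_mul_I]

lemma exp_two_pi_I_mul_add_int (x : ℂ) (m : ℤ) :
    Complex.exp (2 * Real.pi * Complex.I * (x + m)) = Complex.exp (2 * Real.pi * Complex.I * x) := by
  have h : 2 * Real.pi * Complex.I * (m : ℂ) = m * (2 * Real.pi * Complex.I) := by ring
  rw [mul_add, Complex.exp_add, h, Complex.exp_int_mul_two_pi_mul_I, mul_one]

/-- The pairs `(M, N)` modulo `kc` with `N ≡ dM` modulo `c`. -/
def congruentPairs (k : ℕ) (c d : ℤ) : Finset (ℤ × ℤ) :=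
  (Finset.Ico 0 (k * c : ℤ) ×ˢ Finset.Ico 0 (k * c : ℤ)).filter fun p => c ∣ d * p.1 - p.2

/-- The weight of the pair `(M, N)`. -/
def pairWeight (ψ : DirichletCharacter ℂ k) (c d : ℤ) (p : ℤ × ℤ) : ℂ :=
  ψ⁻¹ p.1 * ψ ((d * p.1 - p.2) / c : ℤ)

/-- The character sum at the `n`-th pole: `∑_{m ≥ 0} η(m) exp(2πimnz/k)`. -/
def charSeries (η : DirichletCharacter ℂ k) (z : ℂ) (n : ℕ) : ℂ :=
  ∑' m : ℕ, η m * Complex.exp (2 * Real.pi * Complex.I * m * n * z / k)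

lemma sum_congruentPairs_fst (c d : ℤ) (F : ℤ → ℤ → ℂ) :
    ∑ p ∈ congruentPairs k c d, F p.1 p.2 = ∑ M ∈ Finset.Ico 0 (k * c : ℤ),
      ∑ N ∈ (Finset.Ico 0 (k * c : ℤ)).filter (fun N => c ∣ N - d * M), F M N := by
  rw [congruentPairs, Finset.sum_filter, Finset.sum_product]
  refine Finset.sum_congr rfl fun M _ => ?_
  rw [Finset.sum_filter]
  refine Finset.sum_congr rfl fun N _ => ?_
  simp only [dvd_sub_comm]

/-- The determinant makes `a` the inverse of `d` modulo `c`, so the congruence can be solved for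
`M`. -/
lemma sum_congruentPairs_snd {a b c d : ℤ} (hdet : a * d - b * c = 1) (F : ℤ → ℤ → ℂ) :
    ∑ p ∈ congruentPairs k c d, F p.1 p.2 = ∑ N ∈ Finset.Ico 0 (k * c : ℤ),
      ∑ M ∈ (Finset.Ico 0 (k * c : ℤ)).filter (fun M => c ∣ M - a * N), F M N := by
  rw [congruentPairs, Finset.sum_filter, Finset.sum_product_right]
  refine Finset.sum_congr rfl fun N _ => ?_
  rw [Finset.sum_filter]
  refine Finset.sum_congr rfl fun M _ => ?_
  have : c ∣ d * M - N ↔ c ∣ M - a * N := by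
    constructor
    · rintro ⟨x, hx⟩; exact ⟨a * x - b * M, by linear_combination a * hx - M * hdet⟩
    · rintro ⟨y, hy⟩; exact ⟨d * y + b * N, by linear_combination d * hy + N * hdet⟩
  simp only [this]

/-- With `N = dM + ct`, the sum over `t` is a Gauss sum, and the leftover phase `exp (-2πindM/(kc))`
cancels the `d` of `cz + d` in the geometric expansion over `M`, leaving a series in `z`. -/
theorem sum_pairWeight_mul_kern_fst [NeZero k] {ψ : DirichletCharacter ℂ k} (hψ : ψ.IsPrimitive) {c d : ℤ}
    (hc : 0 < c) {z : ℂ} (hz : 0 < z.im) {n : ℕ} (hn : 0 < n) :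
    ∑ p ∈ congruentPairs k c d, pairWeight ψ c d p *
        (Complex.exp (-(2 * Real.pi * Complex.I * n * (p.2 / (k * c)))) *
          kern (1 - p.1 / (k * c)) (-(2 * Real.pi * Complex.I * n * (c * z + d)))) =
      G ψ * ψ⁻¹ n * charSeries ψ⁻¹ z n := by
  obtain ⟨c, rfl⟩ := Int.eq_ofNat_of_zero_le hc.le
  have hc' : 0 < c := by exact_mod_cast hc
  have hk : 0 < k := NeZero.pos k
  have hk0 : (k : ℂ) ≠ 0 := by exact_mod_cast hk.ne'
  have hc0 : (c : ℂ) ≠ 0 := by exact_mod_cast hc'.ne'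
  have hkc : 0 < k * c := by positivity
  set E : ℤ → ℂ := fun M => Complex.exp (2 * Real.pi * Complex.I * ((-(n * d * M / (k * c)) : ℝ) : ℂ))
    with hE
  have hinner : ∀ M : ℤ, ∑ N ∈ (Finset.Ico 0 (k * (c : ℤ) : ℤ)).filter (fun N => (c : ℤ) ∣ N - d * M),
      ψ ((d * M - N) / (c : ℤ) : ℤ) * Complex.exp (-(2 * Real.pi * Complex.I * n * (N / (k * c)))) =
      E M * (ψ⁻¹ n * G ψ) := by
    intro M
    have h1 := sum_filter_dvd_eq_sum_zmod hc (d * M)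
      (fun x : ZMod k => E M * (ψ (-x) * ZMod.stdAddChar (((n : ℤ) : ZMod k) * (-x))))
    have h0 := Equiv.sum_comp (Equiv.neg (ZMod k))
      (fun x : ZMod k => ψ x * ZMod.stdAddChar (((n : ℤ) : ZMod k) * x))
    simp only [Equiv.neg_apply] at h0
    rw [← Finset.mul_sum Finset.univ, h0,
      sum_mul_stdAddChar hψ, Int.cast_natCast] at h1
    rw [← h1]
    refine Finset.sum_congr rfl fun N hN => ?_
    obtain ⟨t, ht⟩ := (Finset.mem_filter.1 hN).2
    have ht' : d * M - N = c * (-t) := by linear_combination -ht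
    rw [ht, ht', Int.mul_ediv_cancel_left _ hc.ne', Int.mul_ediv_cancel_left _ hc.ne']
    have h2 : (n : ZMod k) * -((t : ℤ) : ZMod k) = ((-(n * t) : ℤ) : ZMod k) := by push_cast; ring
    rw [h2, ZMod.stdAddChar_coe, mul_left_comm, ← Complex.exp_add, Int.cast_neg]
    congr 2
    have ht2 : (N : ℂ) = d * M + c * t := by
      have : N = d * M + c * t := by linear_combination ht
      rw [this]; push_cast; ring
    rw [ht2]
    push_cast
    field_simp
    ring
  unfold pairWeight
  rw [sum_congruentPairs_fst c d (fun M N => ψ⁻¹ M * ψ ((d * M - N) / (c : ℤ) : ℤ) *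
    (Complex.exp (-(2 * Real.pi * Complex.I * n * (N / (k * (c : ℤ))))) *
      kern (1 - M / (k * (c : ℤ))) (-(2 * Real.pi * Complex.I * n * ((c : ℤ) * z + d)))))]
  have hv : 0 < (-(2 * Real.pi * Complex.I * n * ((c : ℤ) * z + d))).re := by
    have e : -(2 * Real.pi * Complex.I * n * ((c : ℤ) * z + d)) =
        ((2 * Real.pi * n : ℝ) : ℂ) * (-(Complex.I * ((c : ℝ) * z + (d : ℝ)))) := by
      push_cast; ring
    rw [e, Complex.re_ofReal_mul]
    have : (-(Complex.I * ((c : ℝ) * z + (d : ℝ)))).re = c * z.im := by simp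
    rw [this]
    have := Real.pi_pos
    positivity
  have hks := sum_Ico_mul_kern hkc hv (φ := fun m => ψ⁻¹ m * E m) ?_ ?_
  · push_cast at hks ⊢
    calc _ = G ψ * ψ⁻¹ n * ∑ M ∈ Finset.Ico (0 : ℤ) (k * c), ψ⁻¹ M * E M *
          kern (1 - M / (k * c)) (-(2 * Real.pi * Complex.I * n * (c * z + d))) := by
          rw [Finset.mul_sum]
          refine Finset.sum_congr rfl fun M _ => ?_
          have h3 := congrArg (fun x => x * (ψ⁻¹ M *
            kern (1 - M / (k * c)) (-(2 * Real.pi * Complex.I * n * (c * z + d))))) (hinner M)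
          simp only [Finset.sum_mul] at h3
          refine (Eq.trans (Finset.sum_congr rfl fun N _ => ?_) h3).trans ?_ <;> ring
      _ = _ := by
          rw [hks, charSeries]
          congr 1
          refine tsum_congr fun m => ?_
          rw [mul_assoc, ← Complex.exp_add, Int.cast_natCast]
          congr 2
          push_cast
          field_simp
          ring
  · intro m r
    have h1 : ((m + (k * c : ℕ) * r : ℤ) : ZMod k) = m := by push_cast; simp
    simp only [h1]
    congr 1
    have h2 : ((-(n * d * (m + (k * c : ℕ) * r : ℤ) / (k * c)) : ℝ) : ℂ) =
        ((-(n * d * m / (k * c)) : ℝ) : ℂ) + (-(n * d * r) : ℤ) := by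
      push_cast
      field_simp
      ring
    simp only [hE, h2]
    exact exp_two_pi_I_mul_add_int _ _
  · intro m
    rw [norm_mul, norm_exp_two_pi_I_mul_real, mul_one]
    exact DirichletCharacter.norm_le_one _ _

/-- With `M = aN + ct` one has `(dM - N)/c = bN + dt`, so `hκ` separates `N` from `t`. The sum over
`t` is a Gauss sum, and the remaining exponent is `a/c - 1/(c(cz + d)) = (az + b)/(cz + d)`. -/
theorem sum_pairWeight_mul_kern_snd [NeZero k] {ψ θ : DirichletCharacter ℂ k} (hθ : θ.IsPrimitive)
    {a b c d : ℤ} (hdet : a * d - b * c = 1) (hc : 0 < c) {κ : ℂ}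
    (hκ : ∀ N y : ℤ, ψ⁻¹ (a * N + c * y : ℤ) * ψ (b * N + d * y : ℤ) = κ * (θ N * θ⁻¹ y))
    {z : ℂ} (hz : 0 < z.im) {n : ℕ} (hn : 0 < n) :
    ∑ p ∈ congruentPairs k c d, pairWeight ψ c d p *
        (Complex.exp (2 * Real.pi * Complex.I * n * (p.1 / (k * c))) *
          kern (1 - p.2 / (k * c)) (2 * Real.pi * Complex.I * n / (c * z + d))) =
      κ * G θ⁻¹ * θ n * charSeries θ ((a * z + b) / (c * z + d)) n := by
  obtain ⟨c, rfl⟩ := Int.eq_ofNat_of_zero_le hc.le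
  have hc' : 0 < c := by exact_mod_cast hc
  have hk : 0 < k := NeZero.pos k
  have hk0 : (k : ℂ) ≠ 0 := by exact_mod_cast hk.ne'
  have hc0 : (c : ℂ) ≠ 0 := by exact_mod_cast hc'.ne'
  have hkc : 0 < k * c := by positivity
  have hwim : ((c : ℝ) * z + (d : ℝ) : ℂ).im = c * z.im := by simp
  have hw0 : ((c : ℂ) * z + d) ≠ 0 := fun h => by
    have := congrArg Complex.im h
    push_cast at hwim
    rw [hwim] at this
    have h2 : (c : ℝ) * z.im ≠ 0 := by positivity
    exact h2 (by simpa using this)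
  set E : ℤ → ℂ := fun N => Complex.exp (2 * Real.pi * Complex.I * ((n * a * N / (k * c) : ℝ) : ℂ))
    with hE
  have hinner : ∀ N : ℤ, ∑ M ∈ (Finset.Ico 0 (k * (c : ℤ) : ℤ)).filter (fun M => (c : ℤ) ∣ M - a * N),
      ψ⁻¹ M * ψ ((d * M - N) / (c : ℤ) : ℤ) *
        Complex.exp (2 * Real.pi * Complex.I * n * (M / (k * c))) =
      κ * θ N * E N * (θ n * G θ⁻¹) := by
    intro N
    have h1 := sum_filter_dvd_eq_sum_zmod hc (a * N)
      (fun x : ZMod k => κ * θ N * E N * (θ⁻¹ x * ZMod.stdAddChar (((n : ℤ) : ZMod k) * x)))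
    rw [← Finset.mul_sum Finset.univ, sum_mul_stdAddChar (isPrimitive_inv hθ), Int.cast_natCast, inv_inv] at h1
    rw [← h1]
    refine Finset.sum_congr rfl fun M hM => ?_
    obtain ⟨t, ht⟩ := (Finset.mem_filter.1 hM).2
    have hM' : M = a * N + c * t := by linear_combination ht
    have ht' : d * M - N = c * (b * N + d * t) := by linear_combination d * ht + N * hdet
    rw [ht, ht', Int.mul_ediv_cancel_left _ hc.ne', Int.mul_ediv_cancel_left _ hc.ne']
    have hκ' := hκ N t
    rw [← hM'] at hκ'
    rw [hκ']
    have h2 : (n : ZMod k) * ((t : ℤ) : ZMod k) = ((n * t : ℤ) : ZMod k) := by push_cast; ring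
    rw [h2, ZMod.stdAddChar_coe]
    have h3 : Complex.exp (2 * Real.pi * Complex.I * n * (M / (k * c))) =
        E N * Complex.exp (2 * Real.pi * Complex.I * (n * t : ℤ) / k) := by
      rw [hE, ← Complex.exp_add, hM']
      congr 1
      push_cast
      field_simp
    rw [h3]
    ring
  unfold pairWeight
  rw [sum_congruentPairs_snd hdet (fun M N => ψ⁻¹ M * ψ ((d * M - N) / (c : ℤ) : ℤ) *
    (Complex.exp (2 * Real.pi * Complex.I * n * (M / (k * (c : ℤ)))) *
      kern (1 - N / (k * (c : ℤ))) (2 * Real.pi * Complex.I * n / ((c : ℤ) * z + d))))]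
  have hv : 0 < (2 * Real.pi * Complex.I * n / ((c : ℤ) * z + d)).re := by
    have e : 2 * Real.pi * Complex.I * n / ((c : ℤ) * z + d) =
        ((2 * Real.pi * n : ℝ) : ℂ) * (Complex.I * ((c : ℝ) * z + (d : ℝ))⁻¹) := by
      push_cast; ring
    rw [e, Complex.re_ofReal_mul, Complex.I_mul_re, Complex.inv_im, hwim]
    have := Real.pi_pos
    have hns : 0 < Complex.normSq ((c : ℝ) * z + (d : ℝ)) := Complex.normSq_pos.2 (by
      push_cast; exact hw0)
    have : 0 < c * z.im / Complex.normSq ((c : ℝ) * z + (d : ℝ)) := by positivity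
    rw [neg_div, neg_neg]
    positivity
  have hks := sum_Ico_mul_kern hkc hv (φ := fun m => θ m * E m) ?_ ?_
  · push_cast at hks ⊢
    calc _ = κ * G θ⁻¹ * θ n * ∑ N ∈ Finset.Ico (0 : ℤ) (k * c), θ N * E N *
          kern (1 - N / (k * c)) (2 * Real.pi * Complex.I * n / (c * z + d)) := by
          rw [Finset.mul_sum]
          refine Finset.sum_congr rfl fun N _ => ?_
          have h3 := congrArg (fun x => x *
            kern (1 - N / (k * c)) (2 * Real.pi * Complex.I * n / (c * z + d))) (hinner N)
          simp only [Finset.sum_mul] at h3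
          refine (Eq.trans (Finset.sum_congr rfl fun M _ => ?_) h3).trans ?_ <;> ring
      _ = _ := by
          rw [hks, charSeries]
          congr 1
          refine tsum_congr fun m => ?_
          rw [mul_assoc, ← Complex.exp_add, Int.cast_natCast]
          congr 2
          have hdet' : (a : ℂ) * d - b * c = 1 := by exact_mod_cast hdet
          push_cast
          field_simp
          linear_combination (n * m : ℂ) * hdet'
  · intro m r
    have h1 : ((m + (k * c : ℕ) * r : ℤ) : ZMod k) = m := by push_cast; simp
    simp only [h1]
    congr 1
    have h2 : ((n * a * (m + (k * c : ℕ) * r : ℤ) / (k * c) : ℝ) : ℂ) =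
        ((n * a * m / (k * c) : ℝ) : ℂ) + (n * a * r : ℤ) := by
      push_cast
      field_simp
    simp only [hE, h2]
    exact exp_two_pi_I_mul_add_int _ _
  · intro m
    rw [norm_mul, norm_exp_two_pi_I_mul_real, mul_one]
    exact DirichletCharacter.norm_le_one _ _

end

/-! ### The sum of the residues -/

lemma floor_intCast_div_intCast (x : ℤ) {c : ℤ} (hc : 0 < c) : ⌊(x : ℝ) / c⌋ = x / c := by
  have hc' : (0 : ℝ) < c := by exact_mod_cast hc
  rw [Int.floor_eq_iff, le_div_iff₀ hc', div_lt_iff₀ hc']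
  have h1 := Int.emod_add_mul_ediv x c
  have h2 := Int.emod_nonneg x hc.ne'
  have h3 := Int.emod_lt_of_pos x hc
  constructor
  · have : x / c * c ≤ x := by nlinarith
    exact_mod_cast this
  · have : x < (x / c + 1) * c := by nlinarith
    exact_mod_cast this

lemma fIntegrand_eq {k : ℕ} (hk : 0 < k) (μ ν : ℕ) (j : ℤ) (z s : ℂ) {c : ℤ} (hc : 0 < c) (d : ℤ) :
    fIntegrand k μ ν j z s c d = fun u => kernProd k (c * z + d) ((μ * c + j : ℤ) / (k * c))
      ((c * ν + d * j % c : ℤ) / (k * c)) u * branchPow u (s - 1) := by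
  funext u
  have hkc : (k : ℂ) ≠ 0 := by exact_mod_cast hk.ne'
  have hcc : (c : ℂ) ≠ 0 := by exact_mod_cast hc.ne'
  have hcr : (c : ℝ) ≠ 0 := by exact_mod_cast hc.ne'
  have hfr : Int.fract ((d * j : ℝ) / c) = ((d * j % c : ℤ) : ℝ) / c := by
    have h := floor_intCast_div_intCast (d * j) hc
    push_cast at h
    rw [Int.fract, h, Int.emod_def]
    push_cast
    field_simp
  unfold fIntegrand kernProd kern
  rw [hfr]
  congr 1
  congr 1
  · congr 2
    · push_cast
      field_simp
    · congr 1; push_cast; ring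
  · congr 2
    · push_cast
      field_simp

section

variable {k : ℕ}

/-- Division with remainder by `c`: `M` determines `μ` and `j`, the congruence fixes `N` modulo `c`,
and `ν` is the remaining quotient. -/
lemma sum_range_range_Icc_eq {c : ℤ} (hc : 0 < c) (d : ℤ) (F : ℤ → ℤ → ℂ) :
    ∑ μ ∈ Finset.range k, ∑ ν ∈ Finset.range k, ∑ j ∈ Finset.Icc 1 c,
        F (μ * c + j) (c * ν + d * j % c) =
      ∑ p ∈ (Finset.Icc 1 (k * c : ℤ) ×ˢ Finset.Ico 0 (k * c : ℤ)).filter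
        (fun p => c ∣ d * p.1 - p.2), F p.1 p.2 := by
  have e : ∑ μ ∈ Finset.range k, ∑ ν ∈ Finset.range k, ∑ j ∈ Finset.Icc 1 c,
        F (μ * c + j) (c * ν + d * j % c) =
      ∑ q ∈ Finset.range k ×ˢ (Finset.range k ×ˢ Finset.Icc 1 c),
        F (q.1 * c + q.2.2) (c * q.2.1 + d * q.2.2 % c) := by
    rw [Finset.sum_product]
    exact Finset.sum_congr rfl fun μ _ => by rw [Finset.sum_product]
  rw [e]
  refine Finset.sum_nbij' (fun q => ((q.1 * c + q.2.2 : ℤ), (c * q.2.1 + d * q.2.2 % c : ℤ)))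
    -- The shift by one appears because `j` runs over `1, …, c` instead of `0, …, c - 1`.
    (fun p => (((p.1 - 1) / c).toNat, (p.2 / c).toNat, (p.1 - 1) % c + 1)) ?_ ?_ ?_ ?_
    (fun _ _ => rfl)
  · rintro ⟨μ, ν, j⟩ hq
    simp only [Finset.mem_product, Finset.mem_range, Finset.mem_Icc] at hq
    obtain ⟨hμ, hν, hj1, hj2⟩ := hq
    have hμ' : (μ : ℤ) + 1 ≤ k := by exact_mod_cast hμ
    have hν' : (ν : ℤ) + 1 ≤ k := by exact_mod_cast hν
    have hμ0 : (0 : ℤ) ≤ μ := by positivity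
    have hν0 : (0 : ℤ) ≤ ν := by positivity
    have h2 := Int.emod_nonneg (d * j) hc.ne'
    have h3 := Int.emod_lt_of_pos (d * j) hc
    simp only [Finset.mem_filter, Finset.mem_product, Finset.mem_Icc, Finset.mem_Ico]
    refine ⟨⟨⟨?_, ?_⟩, ?_, ?_⟩, ?_⟩
    · nlinarith
    · nlinarith
    · nlinarith
    · nlinarith
    · refine ⟨d * μ - ν + d * j / c, ?_⟩
      have := Int.emod_add_mul_ediv (d * j) c
      linear_combination -this
  · rintro ⟨M, N⟩ hp
    simp only [Finset.mem_filter, Finset.mem_product, Finset.mem_Icc, Finset.mem_Ico] at hp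
    obtain ⟨⟨⟨hM1, hM2⟩, hN1, hN2⟩, -⟩ := hp
    simp only [Finset.mem_product, Finset.mem_range, Finset.mem_Icc]
    have h2 := Int.emod_nonneg (M - 1) hc.ne'
    have h3 := Int.emod_lt_of_pos (M - 1) hc
    refine ⟨?_, ?_, by linarith, by linarith⟩
    · rw [Int.toNat_lt (Int.ediv_nonneg (by linarith) hc.le)]
      exact Int.ediv_lt_of_lt_mul hc (by linarith)
    · rw [Int.toNat_lt (Int.ediv_nonneg hN1 hc.le)]
      exact Int.ediv_lt_of_lt_mul hc hN2
  · rintro ⟨μ, ν, j⟩ hq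
    simp only [Finset.mem_product, Finset.mem_range, Finset.mem_Icc] at hq
    obtain ⟨-, -, hj1, hj2⟩ := hq
    have h2 := Int.emod_nonneg (d * j) hc.ne'
    have h3 := Int.emod_lt_of_pos (d * j) hc
    have e1 : (μ * c + j - 1 : ℤ) / c = μ := by
      have : (μ * c + j - 1 : ℤ) = (j - 1) + c * μ := by ring
      rw [this, Int.add_mul_ediv_left _ _ hc.ne', Int.ediv_eq_zero_of_lt (by linarith) (by linarith),
        zero_add]
    have e2 : (c * ν + d * j % c : ℤ) / c = ν := by
      rw [add_comm, Int.add_mul_ediv_left _ _ hc.ne', Int.ediv_eq_zero_of_lt h2 h3, zero_add]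
    have e3 : (μ * c + j - 1 : ℤ) % c = j - 1 := by
      have : (μ * c + j - 1 : ℤ) = (j - 1) + c * μ := by ring
      rw [this, Int.add_mul_emod_self_left, Int.emod_eq_of_lt (by linarith) (by linarith)]
    simp only [e1, e2, e3, Int.toNat_natCast, sub_add_cancel]
  · rintro ⟨M, N⟩ hp
    simp only [Finset.mem_filter, Finset.mem_product, Finset.mem_Icc, Finset.mem_Ico] at hp
    obtain ⟨⟨⟨hM1, hM2⟩, hN1, hN2⟩, x, hx⟩ := hp
    have e1 : (((M - 1) / c).toNat : ℤ) = (M - 1) / c :=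
      Int.toNat_of_nonneg (Int.ediv_nonneg (by linarith) hc.le)
    have e2 : ((N / c).toNat : ℤ) = N / c := Int.toNat_of_nonneg (Int.ediv_nonneg hN1 hc.le)
    have h1 := Int.emod_add_mul_ediv (M - 1) c
    have h2 := Int.emod_add_mul_ediv N c
    have e3 : d * ((M - 1) % c + 1) % c = N % c := by
      have : d * ((M - 1) % c + 1) = N + c * (x - d * ((M - 1) / c)) := by
        linear_combination d * h1 + hx
      rw [this, Int.add_mul_emod_self_left]
    simp only [e1, e2, e3, Prod.mk.injEq]
    constructor <;> linarith

lemma inv_apply_mul_apply (ψ : DirichletCharacter ℂ k) {x : ZMod k} (hx : IsUnit x) :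
    ψ⁻¹ x * ψ x = 1 := by
  rw [← MulChar.mul_apply, inv_mul_cancel]
  exact MulChar.one_apply hx

lemma inv_neg_mul_neg (ψ : DirichletCharacter ℂ k) (x y : ZMod k) :
    ψ⁻¹ (-x) * ψ (-y) = ψ⁻¹ x * ψ y := by
  have h := inv_apply_mul_apply ψ (x := -1) isUnit_one.neg
  rw [← neg_one_mul x, ← neg_one_mul y, map_mul, map_mul]
  linear_combination (ψ⁻¹ x * ψ y) * h

lemma apply_intCast_eq_zero (hk1 : k ≠ 1) (η : DirichletCharacter ℂ k) {N : ℤ} (h : (k : ℤ) ∣ N) :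
    η N = 0 := by
  have : Nontrivial (ZMod k) := ZMod.nontrivial_iff.2 hk1
  rw [(ZMod.intCast_zmod_eq_zero_iff_dvd N k).2 h]
  exact MulChar.map_zero η

/-- The pairs `(M, N)` with `0 < M, N < kc` and `N ≡ dM` modulo `c`. -/
def interiorPairs (k : ℕ) (c d : ℤ) : Finset (ℤ × ℤ) :=
  (Finset.Ioo 0 (k * c : ℤ) ×ˢ Finset.Ioo 0 (k * c : ℤ)).filter fun p => c ∣ d * p.1 - p.2

variable {ψ θ : DirichletCharacter ℂ k} {a b c d : ℤ} {κ : ℂ}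

/-- For `k ∣ M` the first factor vanishes; for `k ∣ N` the factorization `hκ` exhibits the factor `θ
N = 0`. -/
lemma pairWeight_eq_zero (hk1 : k ≠ 1) (hdet : a * d - b * c = 1) (hc : 0 < c)
    (hκ : ∀ N y : ℤ, ψ⁻¹ (a * N + c * y : ℤ) * ψ (b * N + d * y : ℤ) = κ * (θ N * θ⁻¹ y))
    {p : ℤ × ℤ} (hp : c ∣ d * p.1 - p.2) (h : (k : ℤ) ∣ p.1 ∨ (k : ℤ) ∣ p.2) :
    pairWeight ψ c d p = 0 := by
  obtain ⟨x, hx⟩ := hp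
  unfold pairWeight
  rcases h with h | h
  · rw [apply_intCast_eq_zero hk1 _ h, zero_mul]
  · have h1 : p.1 = a * p.2 + c * (a * x - b * p.1) := by
      linear_combination a * hx - p.1 * hdet
    have h2 : x = b * p.2 + d * (a * x - b * p.1) := by
      linear_combination b * hx - x * hdet
    have := hκ p.2 (a * x - b * p.1)
    rw [← h1, ← h2, apply_intCast_eq_zero hk1 _ h] at this
    rw [hx, Int.mul_ediv_cancel_left _ hc.ne', this]
    ring

/-- Reconciles the range `1 ≤ M ≤ kc` of the theorem, the range `0 ≤ M < kc` of the geometric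
expansion, and the open range on which the residue sums converge: they differ by pairs of weight
zero. -/
lemma sum_interiorPairs_eq (hk1 : k ≠ 1) (hdet : a * d - b * c = 1) (hc : 0 < c)
    (hκ : ∀ N y : ℤ, ψ⁻¹ (a * N + c * y : ℤ) * ψ (b * N + d * y : ℤ) = κ * (θ N * θ⁻¹ y))
    {S : Finset (ℤ × ℤ)} (h1 : interiorPairs k c d ⊆ S) (h2 : ∀ p ∈ S, c ∣ d * p.1 - p.2)
    (h3 : ∀ p ∈ S, p.1 ∈ Icc 0 (k * c : ℤ) ∧ p.2 ∈ Icc 0 (k * c : ℤ)) (X : ℤ × ℤ → ℂ) :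
    ∑ p ∈ interiorPairs k c d, pairWeight ψ c d p * X p = ∑ p ∈ S, pairWeight ψ c d p * X p := by
  refine Finset.sum_subset h1 fun p hp hpn => ?_
  rw [pairWeight_eq_zero hk1 hdet hc hκ (h2 p hp), zero_mul]
  obtain ⟨⟨h4, h5⟩, h6, h7⟩ := h3 p hp
  by_contra! hcon
  apply hpn
  have key : ∀ N : ℤ, 0 ≤ N → N ≤ k * c → ¬ (k : ℤ) ∣ N → N ∈ Finset.Ioo 0 (k * c : ℤ) := by
    intro N hN0 hN1 hN
    rw [Finset.mem_Ioo]
    refine ⟨lt_of_le_of_ne hN0 ?_, lt_of_le_of_ne hN1 ?_⟩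
    · rintro rfl; exact hN (dvd_zero _)
    · rintro rfl; exact hN (dvd_mul_right _ _)
  rw [interiorPairs, Finset.mem_filter, Finset.mem_product]
  exact ⟨⟨key _ h4 h5 hcon.1, key _ h6 h7 hcon.2⟩, h2 p hp⟩

/-- Modulo `k` the reflection negates both arguments of the weight, and `ψ⁻¹(-1) ψ(-1) = 1`. -/
lemma sum_interiorPairs_reflect (hc : 0 < c) (X : ℤ × ℤ → ℂ) :
    ∑ p ∈ interiorPairs k c d, pairWeight ψ c d p * X (k * c - p.1, k * c - p.2) =
      ∑ p ∈ interiorPairs k c d, pairWeight ψ c d p * X p := by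
  have hmem : ∀ p ∈ interiorPairs k c d,
      ((k * c - p.1, k * c - p.2) : ℤ × ℤ) ∈ interiorPairs k c d := by
    rintro ⟨M, N⟩ hp
    simp only [interiorPairs, Finset.mem_filter, Finset.mem_product, Finset.mem_Ioo] at hp ⊢
    obtain ⟨⟨⟨h1, h2⟩, h3, h4⟩, x, hx⟩ := hp
    refine ⟨⟨⟨by linarith, by linarith⟩, by linarith, by linarith⟩, (d - 1) * k - x, ?_⟩
    linear_combination -hx
  refine Finset.sum_nbij' (fun p => (k * c - p.1, k * c - p.2))
    (fun p => (k * c - p.1, k * c - p.2)) hmem hmem (fun p _ => by simp) (fun p _ => by simp)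
    fun p hp => ?_
  congr 1
  obtain ⟨x, hx⟩ := (Finset.mem_filter.1 hp).2
  have h : d * (k * c - p.1) - (k * c - p.2) = c * ((d - 1) * k - x) := by linear_combination -hx
  unfold pairWeight
  simp only
  rw [hx, h, Int.mul_ediv_cancel_left _ hc.ne', Int.mul_ediv_cancel_left _ hc.ne']
  push_cast
  simp only [CharP.cast_eq_zero, zero_mul, mul_zero, zero_sub]
  rw [inv_neg_mul_neg]

/-- The series `∑_{n ≥ 1} n^(s-1) η(n) ∑_{m ≥ 0} η(m) exp(2πimnz/k)`. -/
def charSum (η : DirichletCharacter ℂ k) (z s : ℂ) : ℂ :=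
  ∑' n : ℕ, ((n + 1 : ℕ) : ℂ) ^ (s - 1) * (η (n + 1 : ℕ) * charSeries η z (n + 1))

lemma residueTerm_one_sub (w s : ℂ) (α β : ℝ) (n : ℕ) :
    residueTerm k w s (1 - α) (1 - β) n = (n : ℂ) ^ (s - 1) *
      (Complex.exp (s * poleLog k 1) * (Complex.exp (-(2 * Real.pi * Complex.I * n * β)) *
        kern (1 - α) (-(2 * Real.pi * Complex.I * n * w))) -
      Complex.exp (s * poleLog k w) * (Complex.exp (2 * Real.pi * Complex.I * n * α) *
        kern (1 - β) (2 * Real.pi * Complex.I * n / w))) := by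
  have h1 : Complex.exp (2 * Real.pi * Complex.I * n * (1 - β : ℝ)) =
      Complex.exp (-(2 * Real.pi * Complex.I * n * β)) := by
    have := exp_two_pi_I_mul_add_int (-(n * β)) n
    rw [Int.cast_natCast] at this
    convert this using 2
    · push_cast; ring
    · ring
  have h2 : Complex.exp (-(2 * Real.pi * Complex.I * n * (1 - α : ℝ))) =
      Complex.exp (2 * Real.pi * Complex.I * n * α) := by
    have := exp_two_pi_I_mul_add_int (n * α) (-n)
    convert this using 2
    · push_cast; ring
    · ring
  rw [residueTerm, h1, h2]
  ring

theorem sum_residueTerm [NeZero k] (hψ : ψ.IsPrimitive) (hθ : θ.IsPrimitive) (hk1 : k ≠ 1)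
    (hdet : a * d - b * c = 1) (hc : 0 < c)
    (hκ : ∀ N y : ℤ, ψ⁻¹ (a * N + c * y : ℤ) * ψ (b * N + d * y : ℤ) = κ * (θ N * θ⁻¹ y))
    {z : ℂ} (hz : 0 < z.im) (s : ℂ) {n : ℕ} (hn : 0 < n) :
    ∑ p ∈ interiorPairs k c d, pairWeight ψ c d p *
        residueTerm k (c * z + d) s (1 - p.1 / (k * c)) (1 - p.2 / (k * c)) n =
      Complex.exp (s * poleLog k 1) * G ψ *
          ((n : ℂ) ^ (s - 1) * (ψ⁻¹ n * charSeries ψ⁻¹ z n)) -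
        Complex.exp (s * poleLog k (c * z + d)) * κ * G θ⁻¹ *
          ((n : ℂ) ^ (s - 1) * (θ n * charSeries θ ((a * z + b) / (c * z + d)) n)) := by
  have hsub : interiorPairs k c d ⊆ congruentPairs k c d := by
    refine Finset.filter_subset_filter _ (Finset.product_subset_product ?_ ?_) <;>
    exact fun x hx => Finset.mem_Ico.2 ⟨(Finset.mem_Ioo.1 hx).1.le, (Finset.mem_Ioo.1 hx).2⟩
  rw [sum_interiorPairs_eq hk1 hdet hc hκ hsub (fun p hp => (Finset.mem_filter.1 hp).2)
    (fun p hp => by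
      have := Finset.mem_product.1 (Finset.mem_filter.1 hp).1
      rw [Finset.mem_Ico, Finset.mem_Ico] at this
      exact ⟨⟨this.1.1, this.1.2.le⟩, this.2.1, this.2.2.le⟩)
    (fun p => residueTerm k (c * z + d) s (1 - p.1 / (k * c)) (1 - p.2 / (k * c)) n)]
  have h1 := sum_pairWeight_mul_kern_fst hψ (d := d) hc hz hn
  have h2 := sum_pairWeight_mul_kern_snd hθ hdet hc hκ hz hn
  have h3 : ∀ p : ℤ × ℤ, pairWeight ψ c d p *
      residueTerm k (c * z + d) s (1 - p.1 / (k * c)) (1 - p.2 / (k * c)) n =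
      (n : ℂ) ^ (s - 1) * Complex.exp (s * poleLog k 1) * (pairWeight ψ c d p *
        (Complex.exp (-(2 * Real.pi * Complex.I * n * (p.2 / (k * c)))) *
          kern (1 - p.1 / (k * c)) (-(2 * Real.pi * Complex.I * n * (c * z + d))))) -
      (n : ℂ) ^ (s - 1) * Complex.exp (s * poleLog k (c * z + d)) * (pairWeight ψ c d p *
        (Complex.exp (2 * Real.pi * Complex.I * n * (p.1 / (k * c))) *
          kern (1 - p.2 / (k * c)) (2 * Real.pi * Complex.I * n / (c * z + d)))) := fun p => by
    rw [residueTerm_one_sub]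
    push_cast
    ring
  simp only [h3]
  rw [Finset.sum_sub_distrib, ← Finset.mul_sum, ← Finset.mul_sum, h1, h2]
  ring

end

/-! ### Convergence of the double series -/

lemma summable_norm_natCast_cpow_mul_pow (s : ℂ) {ρ : ℝ} (h0 : 0 ≤ ρ) (h1 : ρ < 1) :
    Summable fun n : ℕ => ‖((n + 1 : ℕ) : ℂ) ^ (s - 1)‖ * ρ ^ (n + 1) := by
  set m := ⌈|s.re|⌉₊ with hm
  have h := summable_norm_pow_mul_geometric_of_norm_lt_one m (r := ρ)
    (by rwa [Real.norm_eq_abs, abs_of_nonneg h0])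
  rw [← summable_nat_add_iff 1] at h
  refine Summable.of_nonneg_of_le (fun n => by positivity) (fun n => ?_) h
  rw [norm_mul, norm_pow, norm_pow, Real.norm_eq_abs ρ, abs_of_nonneg h0]
  gcongr
  rw [Complex.norm_natCast_cpow_of_pos n.succ_pos, Real.norm_natCast, ← Real.rpow_natCast]
  refine Real.rpow_le_rpow_of_exponent_le (by simp) ?_
  rw [Complex.sub_re, Complex.one_re]
  have := Nat.le_ceil |s.re|
  linarith [le_abs_self s.re]

section

variable {k : ℕ}

lemma norm_exp_series (n m : ℕ) (z : ℂ) :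
    ‖Complex.exp (2 * Real.pi * Complex.I * m * n * z / k)‖ =
      Real.exp (-(2 * Real.pi * z.im / k)) ^ (n * m) := by
  rw [Complex.norm_exp, ← Real.exp_nat_mul]
  congr 1
  have : 2 * Real.pi * Complex.I * m * n * z / k =
      ((2 * Real.pi * m * n / k : ℝ) : ℂ) * (Complex.I * z) := by push_cast; ring
  rw [this, Complex.re_ofReal_mul, Complex.I_mul_re]
  push_cast
  ring

variable [NeZero k]

lemma exp_neg_two_pi_im_lt_one {z : ℂ} (hz : 0 < z.im) :
    Real.exp (-(2 * Real.pi * z.im / k)) < 1 := by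
  have : (0 : ℝ) < k := by exact_mod_cast NeZero.pos k
  have := Real.pi_pos
  rw [Real.exp_lt_one_iff, neg_lt_zero]
  positivity

theorem A₁Converges_of_im_pos (χ : DirichletCharacter ℂ k) {z : ℂ} (hz : 0 < z.im) (s : ℂ) :
    A₁Converges χ z s := by
  set ρ := Real.exp (-(2 * Real.pi * z.im / k)) with hρ
  have hρ0 : 0 < ρ := Real.exp_pos _
  have hρ1 : ρ < 1 := exp_neg_two_pi_im_lt_one hz
  have h1 := summable_norm_natCast_cpow_mul_pow s hρ0.le hρ1
  have h2 := summable_geometric_of_lt_one hρ0.le hρ1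
  have h3 := h1.mul_of_nonneg h2 (fun n => by positivity) (fun m => by positivity)
  have h4 : Summable fun p : ℕ × ℕ => ‖A₁Term χ z s p.1.succPNat p.2.succPNat‖ := by
    refine Summable.of_nonneg_of_le (fun p => norm_nonneg _) (fun p => ?_) h3
    rw [A₁Term, norm_mul, norm_mul, norm_mul, norm_mul, norm_pow, norm_neg, norm_one, one_pow,
      one_mul, norm_exp_series]
    have h5 : ρ ^ (((p.1.succPNat : ℕ+) : ℕ) * ((p.2.succPNat : ℕ+) : ℕ)) ≤
        ρ ^ (p.1 + 1) * ρ ^ p.2 := by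
      rw [← pow_add]
      refine pow_le_pow_of_le_one hρ0.le hρ1.le ?_
      simp only [Nat.succPNat_coe, Nat.succ_eq_add_one]
      nlinarith [Nat.zero_le (p.1 * p.2)]
    have h6 := DirichletCharacter.norm_le_one χ (((p.2.succPNat : ℕ+) : ℕ) : ZMod k)
    have h7 := DirichletCharacter.norm_le_one χ (((p.1.succPNat : ℕ+) : ℕ) : ZMod k)
    calc _ ≤ 1 * 1 * ‖(((p.1.succPNat : ℕ+) : ℕ) : ℂ) ^ (s - 1)‖ *
          (ρ ^ (p.1 + 1) * ρ ^ p.2) := by gcongr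
      _ = _ := by simp only [Nat.succPNat_coe, Nat.succ_eq_add_one]; ring
  exact (Equiv.pnatEquivNat.symm.prodCongr Equiv.pnatEquivNat.symm).summable_iff.1 h4

lemma summable_charSeries (η : DirichletCharacter ℂ k) {z : ℂ} (hz : 0 < z.im) {n : ℕ}
    (hn : 0 < n) :
    Summable fun m : ℕ => η m * Complex.exp (2 * Real.pi * Complex.I * m * n * z / k) := by
  have hρ1 := exp_neg_two_pi_im_lt_one (k := k) hz
  refine Summable.of_norm_bounded (summable_geometric_of_lt_one (Real.exp_pos _).le hρ1)
    fun m => ?_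
  rw [norm_mul, norm_exp_series]
  refine (mul_le_of_le_one_left (by positivity) (DirichletCharacter.norm_le_one η _)).trans ?_
  exact pow_le_pow_of_le_one (Real.exp_pos _).le hρ1.le (Nat.le_mul_of_pos_left _ hn)

/-- Decay in `n` depends on the term `m = 0` being zero, which is where `k ≠ 1` enters. -/
lemma norm_charSeries_le (hk1 : k ≠ 1) (η : DirichletCharacter ℂ k) {z : ℂ} (hz : 0 < z.im) {n : ℕ}
    (hn : 0 < n) :
    ‖charSeries η z n‖ ≤ Real.exp (-(2 * Real.pi * z.im / k)) ^ n *
      (1 - Real.exp (-(2 * Real.pi * z.im / k)))⁻¹ := by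
  set ρ := Real.exp (-(2 * Real.pi * z.im / k)) with hρ
  have hρ0 : 0 < ρ := Real.exp_pos _
  have hρ1 : ρ < 1 := exp_neg_two_pi_im_lt_one hz
  have h0 : η ((0 : ℕ) : ZMod k) = 0 := by
    have := apply_intCast_eq_zero hk1 η (dvd_zero (k : ℤ))
    simpa using this
  rw [charSeries, (summable_charSeries η hz hn).tsum_eq_zero_add, h0, zero_mul, zero_add]
  refine tsum_of_norm_bounded ((hasSum_geometric_of_lt_one hρ0.le hρ1).mul_left (ρ ^ n)) fun m => ?_
  rw [norm_mul, norm_exp_series]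
  refine (mul_le_of_le_one_left (by positivity) (DirichletCharacter.norm_le_one η _)).trans ?_
  rw [← pow_add]
  exact pow_le_pow_of_le_one hρ0.le hρ1.le (by nlinarith)

lemma summable_charSum (hk1 : k ≠ 1) (η : DirichletCharacter ℂ k) {z : ℂ} (hz : 0 < z.im) (s : ℂ) :
    Summable fun n : ℕ =>
      ((n + 1 : ℕ) : ℂ) ^ (s - 1) * (η (n + 1 : ℕ) * charSeries η z (n + 1)) := by
  set ρ := Real.exp (-(2 * Real.pi * z.im / k)) with hρ
  have h := (summable_norm_natCast_cpow_mul_pow s (Real.exp_pos _).le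
    (exp_neg_two_pi_im_lt_one (k := k) hz)).mul_right (1 - ρ)⁻¹
  refine Summable.of_norm_bounded h fun n => ?_
  rw [norm_mul, norm_mul, mul_assoc]
  refine mul_le_mul_of_nonneg_left ?_ (norm_nonneg _)
  exact (mul_le_of_le_one_left (norm_nonneg _) (DirichletCharacter.norm_le_one η _)).trans
    (norm_charSeries_le hk1 η hz n.succ_pos)

lemma tsum_neg_one_pow_mul {g : ℕ → ℂ} (hg : Summable g) :
    ∑' m : ℕ, (-1) ^ m * g m = 2 * (∑' m : ℕ, g (2 * m)) - ∑' m, g m := by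
  have h2 : Summable fun m : ℕ => g (2 * m) :=
    hg.comp_injective (mul_right_injective₀ two_ne_zero)
  have h3 : Summable fun m : ℕ => g (2 * m + 1) :=
    hg.comp_injective fun m n h => by simpa using h
  have h4 : ∀ m : ℕ, (-1 : ℂ) ^ (2 * m) * g (2 * m) = g (2 * m) := fun m => by
    rw [pow_mul]; simp
  have h5 : ∀ m : ℕ, (-1 : ℂ) ^ (2 * m + 1) * g (2 * m + 1) = -g (2 * m + 1) := fun m => by
    rw [pow_succ, pow_mul]; simp
  rw [← tsum_even_add_odd h2 h3, ← tsum_even_add_odd (by simpa only [h4] using h2)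
    (by simpa only [h5] using h3.neg)]
  simp only [h4, h5, tsum_neg]
  ring

/-- Write `(-1)^m` as `2·[m even] - 1`; the even `m` contribute the series at `2z` with the factor
`χ 2`. -/
theorem A₁_eq_charSum (hk1 : k ≠ 1) (χ : DirichletCharacter ℂ k) {z : ℂ} (hz : 0 < z.im) (s : ℂ) :
    A₁ χ z s = 2 * χ 2 * charSum χ (2 * z) s - charSum χ z s := by
  have h0 : χ ((0 : ℕ) : ZMod k) = 0 := by
    have := apply_intCast_eq_zero hk1 χ (dvd_zero (k : ℤ))
    simpa using this
  have hz2 : 0 < (2 * z).im := by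
    have : (2 * z).im = 2 * z.im := by simp
    rw [this]; positivity
  have hinner : ∀ n : ℕ, ∑' m : ℕ+, A₁Term χ z s n.succPNat m =
      ((n + 1 : ℕ) : ℂ) ^ (s - 1) * (χ (n + 1 : ℕ) *
        (2 * χ 2 * charSeries χ (2 * z) (n + 1) - charSeries χ z (n + 1))) := by
    intro n
    have hg := summable_charSeries χ hz n.succ_pos
    have h1 := tsum_neg_one_pow_mul hg
    have h2 : ∑' m : ℕ, χ (2 * m : ℕ) *
        Complex.exp (2 * Real.pi * Complex.I * (2 * m : ℕ) * (n + 1 : ℕ) * z / k) =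
        χ 2 * charSeries χ (2 * z) (n + 1) := by
      rw [charSeries, ← tsum_mul_left]
      refine tsum_congr fun m => ?_
      rw [Nat.cast_mul, map_mul, mul_assoc]
      congr 2
      push_cast
      congr 1
      ring
    simp only [Nat.succ_eq_add_one] at h1
    rw [h2] at h1
    have hs : Summable fun m : ℕ => (-1 : ℂ) ^ m * (χ m *
        Complex.exp (2 * Real.pi * Complex.I * m * (n + 1 : ℕ) * z / k)) :=
      Summable.of_norm (by simpa [norm_mul] using hg.norm)
    rw [hs.tsum_eq_zero_add, h0, zero_mul, mul_zero, zero_add] at h1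
    rw [tsum_pnat_eq_tsum_succ (f := fun m : ℕ => (-1 : ℂ) ^ m * χ m * χ (n + 1 : ℕ) *
      ((n + 1 : ℕ) : ℂ) ^ (s - 1) *
      Complex.exp (2 * Real.pi * Complex.I * m * (n + 1 : ℕ) * z / k)) |> Eq.trans
        (tsum_congr fun m => by simp only [A₁Term, Nat.succPNat_coe, Nat.succ_eq_add_one])]
    have h6 : 2 * χ 2 * charSeries χ (2 * z) (n + 1) - charSeries χ z (n + 1) =
        ∑' m : ℕ, (-1 : ℂ) ^ (m + 1) * (χ (m + 1 : ℕ) *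
          Complex.exp (2 * Real.pi * Complex.I * (m + 1 : ℕ) * (n + 1 : ℕ) * z / k)) := by
      rw [mul_assoc]; exact h1.symm
    rw [h6, ← mul_assoc, ← tsum_mul_left]
    exact tsum_congr fun m => by ring
  have h5 : A₁ χ z s = ∑' n : ℕ, ∑' m : ℕ+, A₁Term χ z s n.succPNat m := by
    rw [A₁, ← Equiv.pnatEquivNat.symm.tsum_eq]
    rfl
  rw [h5]
  simp only [hinner]
  rw [charSum, charSum, ← tsum_mul_left, ← ((summable_charSum hk1 χ hz2 s).mul_left
    (2 * χ 2)).tsum_sub (summable_charSum hk1 χ hz s)]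
  exact tsum_congr fun n => by ring

end

/-! ### The transformation formula -/

section

variable {k : ℕ} {a b c d : ℤ} {z : ℂ}

lemma im_mobius_pos (hdet : a * d - b * c = 1) (hw : (c : ℂ) * z + d ≠ 0) (hz : 0 < z.im) :
    0 < (((a : ℂ) * z + b) / (c * z + d)).im := by
  have hdet' : (a : ℝ) * d - b * c = 1 := by exact_mod_cast hdet
  have h : (((a : ℂ) * z + b) / (c * z + d)).im = z.im / Complex.normSq (c * z + d) := by
    rw [Complex.div_im, ← sub_div]
    congr 1
    simp only [Complex.add_im, Complex.add_re, Complex.mul_im, Complex.mul_re, Complex.intCast_re,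
      Complex.intCast_im]
    linear_combination z.im * hdet'
  rw [h]
  exact div_pos hz (Complex.normSq_pos.2 hw)

lemma intCast_add_emod_mem {μ : ℕ} (hμ : μ < k) {c : ℤ} (hc : 0 < c) {r : ℤ} (h0 : 0 ≤ r)
    (h1 : r ≤ c) :
    0 ≤ ((μ * c + r : ℤ) : ℝ) / (k * c) ∧ ((μ * c + r : ℤ) : ℝ) / (k * c) ≤ 1 := by
  have hk : 0 < k := by omega
  have hkc : (0 : ℝ) < k * c := by
    have : (0 : ℝ) < c := by exact_mod_cast hc
    have : (0 : ℝ) < k := by exact_mod_cast hk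
    positivity
  have hμ' : (μ : ℤ) + 1 ≤ k := by exact_mod_cast hμ
  have hμ0 : (0 : ℤ) ≤ μ := by positivity
  constructor
  · refine div_nonneg ?_ hkc.le
    have : 0 ≤ (μ * c + r : ℤ) := by positivity
    exact_mod_cast this
  · rw [div_le_one hkc]
    have : (μ * c + r : ℤ) ≤ k * c := by nlinarith
    exact_mod_cast this

theorem loopIntegrable_fIntegrand (hk : 0 < k) {μ ν : ℕ} (hμ : μ < k) (hν : ν < k) (hc : 0 < c)
    {j : ℤ} (hj1 : 1 ≤ j) (hj2 : j ≤ c) (hwr : 0 < ((c : ℂ) * z + d).re)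
    (hwi : 0 < ((c : ℂ) * z + d).im) {δ : ℝ} (hδ : IsLoopRadius k (c * z + d) δ) (s : ℂ) :
    LoopIntegrable δ (fIntegrand k μ ν j z s c d) := by
  rw [isLoopRadius_iff hk hwr hwi] at hδ
  rw [fIntegrand_eq hk μ ν j z s hc d]
  have h1 := intCast_add_emod_mem hμ hc (by linarith) hj2
  have hkc : (0 : ℝ) < k * c := by
    have : (0 : ℝ) < c := by exact_mod_cast hc
    have : (0 : ℝ) < k := by exact_mod_cast hk
    positivity
  refine loopIntegrable_kernProd (by exact_mod_cast hk) hwr h1.1 h1.2 ?_ hδ.1 hδ.2 s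
  rw [div_lt_one hkc]
  have hν' : (ν : ℤ) + 1 ≤ k := by exact_mod_cast hν
  have h3 := Int.emod_lt_of_pos (d * j) hc
  have : (c * ν + d * j % c : ℤ) < k * c := by nlinarith
  exact_mod_cast this

variable [NeZero k] {ψ θ : DirichletCharacter ℂ k} {κ : ℂ}

/-- The transformation formula of the series `charSum`, in terms of the loop integrals. -/
theorem sum_mul_f (hψ : ψ.IsPrimitive) (hθ : θ.IsPrimitive) (hk1 : k ≠ 1)
    (hdet : a * d - b * c = 1) (hc : 0 < c)
    (hκ : ∀ N y : ℤ, ψ⁻¹ (a * N + c * y : ℤ) * ψ (b * N + d * y : ℤ) = κ * (θ N * θ⁻¹ y))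
    (hz : 0 < z.im) (hwr : 0 < ((c : ℂ) * z + d).re) {δ : ℝ}
    (hδ : IsLoopRadius k (c * z + d) δ) (s : ℂ) :
    ∑ μ ∈ Finset.range k, ∑ ν ∈ Finset.range k, ∑ j ∈ Finset.Icc 1 c,
        ψ⁻¹ ((μ * c + j : ℤ) : ZMod k) * ψ ((⌊(d * j : ℝ) / c⌋ + d * μ - ν : ℤ) : ZMod k) *
          f δ k μ ν j z s c d =
      -((1 + Complex.exp (Real.pi * Complex.I * s)) *
        (Complex.exp (s * poleLog k 1) * G ψ * charSum ψ⁻¹ z s -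
          Complex.exp (s * poleLog k (c * z + d)) * κ * G θ⁻¹ *
            charSum θ ((a * z + b) / (c * z + d)) s)) := by
  have hk : 0 < k := NeZero.pos k
  have hkR : (0 : ℝ) < k := by exact_mod_cast hk
  have hcR : (0 : ℝ) < c := by exact_mod_cast hc
  have hkc : (0 : ℝ) < k * c := by positivity
  have hwi : 0 < ((c : ℂ) * z + d).im := by
    have : ((c : ℂ) * z + d).im = c * z.im := by simp
    rw [this]; positivity
  have hδ' := (isLoopRadius_iff hk hwr hwi).1 hδ
  have hTz := im_mobius_pos hdet (fun h => by simp [h] at hwr) hz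
  set w : ℂ := c * z + d with hw
  set L : ℤ × ℤ → ℂ := fun p => loopIntegral δ
    (fun u => kernProd k w (p.1 / (k * c)) (p.2 / (k * c)) u * branchPow u (s - 1)) with hL
  have h1 : ∑ μ ∈ Finset.range k, ∑ ν ∈ Finset.range k, ∑ j ∈ Finset.Icc 1 c,
        ψ⁻¹ ((μ * c + j : ℤ) : ZMod k) * ψ ((⌊(d * j : ℝ) / c⌋ + d * μ - ν : ℤ) : ZMod k) *
          f δ k μ ν j z s c d =
      ∑ μ ∈ Finset.range k, ∑ ν ∈ Finset.range k, ∑ j ∈ Finset.Icc 1 c,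
        (fun M N : ℤ => pairWeight ψ c d (M, N) * L (M, N)) (μ * c + j) (c * ν + d * j % c) := by
    refine Finset.sum_congr rfl fun μ _ => Finset.sum_congr rfl fun ν _ =>
      Finset.sum_congr rfl fun j _ => ?_
    have hfl : ⌊(d * j : ℝ) / c⌋ = d * j / c := by
      have := floor_intCast_div_intCast (d * j) hc
      push_cast at this
      exact this
    have hdiv : (d * (μ * c + j) - (c * ν + d * j % c)) / c = d * j / c + d * μ - ν := by
      have h := Int.emod_add_mul_ediv (d * j) c
      have h' : d * (μ * c + j) - (c * ν + d * j % c) = c * (d * j / c + d * μ - ν) := by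
        linear_combination -h
      rw [h', Int.mul_ediv_cancel_left _ hc.ne']
    simp only [pairWeight, hL, f]
    rw [fIntegrand_eq hk μ ν j z s hc d, hfl, hdiv]
  have hsub : interiorPairs k c d ⊆ (Finset.Icc 1 (k * c : ℤ) ×ˢ Finset.Ico 0 (k * c : ℤ)).filter
      (fun p => c ∣ d * p.1 - p.2) := by
    refine Finset.filter_subset_filter _ (Finset.product_subset_product ?_ ?_)
    · exact fun x hx => Finset.mem_Icc.2 ⟨(Finset.mem_Ioo.1 hx).1, (Finset.mem_Ioo.1 hx).2.le⟩
    · exact fun x hx => Finset.mem_Ico.2 ⟨(Finset.mem_Ioo.1 hx).1.le, (Finset.mem_Ioo.1 hx).2⟩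
  have hint := sum_interiorPairs_eq hk1 hdet hc hκ hsub (fun p hp => (Finset.mem_filter.1 hp).2)
    (fun p hp => by
      have := Finset.mem_product.1 (Finset.mem_filter.1 hp).1
      rw [Finset.mem_Icc, Finset.mem_Ico] at this
      exact ⟨⟨by linarith [this.1.1], this.1.2⟩, this.2.1, this.2.2.le⟩) L
  refine (h1.trans ((sum_range_range_Icc_eq hc d
    fun M N => pairWeight ψ c d (M, N) * L (M, N)).trans hint.symm)).trans ?_
  have hdivmem : ∀ x : ℤ, x ∈ Finset.Ioo 0 (k * c : ℤ) →
      0 < (x : ℝ) / (k * c) ∧ (x : ℝ) / (k * c) < 1 := fun x hx => by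
    rw [Finset.mem_Ioo] at hx
    refine ⟨div_pos (by exact_mod_cast hx.1) hkc, (div_lt_one hkc).2 (by exact_mod_cast hx.2)⟩
  have h2 : HasSum (fun n : ℕ => ∑ p ∈ interiorPairs k c d, pairWeight ψ c d p *
      -(residueTerm k w s (p.1 / (k * c)) (p.2 / (k * c)) (n + 1) +
        Complex.exp (Real.pi * Complex.I * s) *
          residueTerm k w s (1 - p.1 / (k * c)) (1 - p.2 / (k * c)) (n + 1)))
      (∑ p ∈ interiorPairs k c d, pairWeight ψ c d p * L p) := by
    refine hasSum_sum fun p hp => HasSum.mul_left _ ?_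
    have hp' := Finset.mem_product.1 (Finset.mem_filter.1 hp).1
    have hα := hdivmem _ hp'.1
    have hβ := hdivmem _ hp'.2
    exact hasSum_loopIntegral hkR hwr hwi hα.1 hα.2 hβ.1 hβ.2 hδ'.1 hδ'.2 s
  set E := Complex.exp (Real.pi * Complex.I * s) with hE
  -- By reflection the terms for `(α, β)` and for `(1 - α, 1 - β)` have the same weighted sum, so `1
  -- + E` factors out.
  have h3 : ∀ n : ℕ, ∑ p ∈ interiorPairs k c d, pairWeight ψ c d p *
      -(residueTerm k w s (p.1 / (k * c)) (p.2 / (k * c)) (n + 1) +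
        E * residueTerm k w s (1 - p.1 / (k * c)) (1 - p.2 / (k * c)) (n + 1)) =
      -((1 + E) * (Complex.exp (s * poleLog k 1) * G ψ *
          (((n + 1 : ℕ) : ℂ) ^ (s - 1) * (ψ⁻¹ (n + 1 : ℕ) * charSeries ψ⁻¹ z (n + 1))) -
        Complex.exp (s * poleLog k w) * κ * G θ⁻¹ *
          (((n + 1 : ℕ) : ℂ) ^ (s - 1) * (θ (n + 1 : ℕ) *
            charSeries θ ((a * z + b) / w) (n + 1))))) := fun n => by
    have h4 := sum_residueTerm hψ hθ hk1 hdet hc hκ hz s n.succ_pos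
    have h5 := sum_interiorPairs_reflect (k := k) (d := d) (ψ := ψ) hc
      (fun p => residueTerm k w s (1 - p.1 / (k * c)) (1 - p.2 / (k * c)) (n + 1))
    have h6 : ∀ x : ℤ, (1 - ((k * c - x : ℤ) : ℝ) / (k * c)) = x / (k * c) := fun x => by
      push_cast
      field_simp
      ring
    simp only [h6] at h5
    simp only [Nat.succ_eq_add_one] at h4
    rw [← h4]
    simp only [mul_neg, Finset.sum_neg_distrib, mul_add, Finset.sum_add_distrib, h5]
    rw [add_mul, one_mul, Finset.mul_sum]
    congr 2
    exact Finset.sum_congr rfl fun p _ => by ring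
  simp only [h3] at h2
  refine h2.unique (HasSum.neg (HasSum.mul_left _ (HasSum.sub (HasSum.mul_left _ ?_)
    (HasSum.mul_left _ ?_))))
  · exact (summable_charSum hk1 ψ⁻¹ hz s).hasSum
  · exact (summable_charSum hk1 θ hTz s).hasSum

end

/-! ### Combining the formulas at `z` and `2z` -/

section

variable {k : ℕ} {a b c d : ℤ} {z : ℂ}

/-- `-k/(2πi)` has principal argument `π/2`, and `exp (-πis)` turns it into `-π/2`, that of
`(2πi/k)⁻¹`. -/
lemma neg_div_two_pi_I_cpow (hk : 0 < k) (s : ℂ) :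
    (-(k : ℂ) / (2 * Real.pi * Complex.I)) ^ s * Complex.exp (-Real.pi * Complex.I * s) =
      (Complex.exp (s * poleLog k 1))⁻¹ := by
  have hpi := Real.pi_pos
  have hkR : (0 : ℝ) < k := by exact_mod_cast hk
  have hkC : (k : ℂ) ≠ 0 := by exact_mod_cast hk.ne'
  have hpiC : (Real.pi : ℂ) ≠ 0 := by exact_mod_cast hpi.ne'
  have h1 : -(k : ℂ) / (2 * Real.pi * Complex.I) =
      Complex.exp ((-Real.log (2 * Real.pi / k) : ℝ) + Real.pi / 2 * Complex.I) := by
    rw [Complex.exp_add, ← Complex.ofReal_exp, Real.exp_neg, Real.exp_log (by positivity),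
      Complex.exp_pi_div_two_mul_I, neg_div, div_mul_eq_div_div, Complex.div_I]
    push_cast
    field_simp
  have h2 : Complex.log (-(k : ℂ) / (2 * Real.pi * Complex.I)) =
      (-Real.log (2 * Real.pi / k) : ℝ) + Real.pi / 2 * Complex.I := by
    rw [h1, Complex.log_exp]
    · simp; linarith
    · simp; linarith
  have h3 : -(k : ℂ) / (2 * Real.pi * Complex.I) ≠ 0 := by rw [h1]; exact Complex.exp_ne_zero _
  rw [Complex.cpow_def_of_ne_zero h3, h2, ← Complex.exp_add, ← Complex.exp_neg, poleLog,
    Complex.log_one]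
  congr 1
  push_cast
  ring

lemma exp_mul_poleLog {w : ℂ} (hw : w ≠ 0) (s : ℂ) :
    Complex.exp (s * poleLog k w) = Complex.exp (s * poleLog k 1) * w ^ (-s) := by
  rw [Complex.cpow_def_of_ne_zero hw, ← Complex.exp_add, poleLog, poleLog, Complex.log_one]
  congr 1
  ring

lemma intCast_mul_add_mul_of_dvd {x : ℤ} (h : (k : ℤ) ∣ x) (N y : ℤ) :
    ((x * N + y : ℤ) : ZMod k) = y := by
  push_cast
  rw [(ZMod.intCast_zmod_eq_zero_iff_dvd x k).2 h]
  ring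

variable [NeZero k] {ψ θ : DirichletCharacter ℂ k} {κ κ' : ℂ}

/-- `sum_mul_f` for the given matrix at `z`, minus `2ψ⁻¹(2)` times `sum_mul_f` for the rows `(a,
2b)`, `(c/2, d)` at `2z`. The compatibility `hκκ'` gives the series at `2Tz` the coefficient that
`A₁` requires. -/
theorem sum_mul_f_sub_sum_mul_f (hψ : ψ.IsPrimitive) (hθ : θ.IsPrimitive) (hk1 : k ≠ 1)
    (hdet : a * d - b * c = 1) (hc : 0 < c) (hceven : Even c)
    (hκ : ∀ N y : ℤ, ψ⁻¹ (a * N + c * y : ℤ) * ψ (b * N + d * y : ℤ) = κ * (θ N * θ⁻¹ y))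
    (hκ' : ∀ N y : ℤ, ψ⁻¹ (a * N + c / 2 * y : ℤ) * ψ (2 * b * N + d * y : ℤ) =
      κ' * (θ N * θ⁻¹ y))
    (hκκ' : ψ⁻¹ 2 * κ' = θ 2 * κ)
    (hz : 0 < z.im) (hwr : 0 < ((c : ℂ) * z + d).re) {δ : ℝ}
    (hδ : IsLoopRadius k (c * z + d) δ) (s : ℂ) :
    ∑ μ ∈ Finset.range k, ∑ ν ∈ Finset.range k,
      ((∑ j ∈ Finset.Icc 1 c, ψ⁻¹ ((μ * c + j : ℤ) : ZMod k) *
          ψ ((⌊(d * j : ℝ) / c⌋ + d * μ - ν : ℤ) : ZMod k) * f δ k μ ν j z s c d) -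
        ∑ j ∈ Finset.Icc 1 (c / 2), 2 * ψ⁻¹ 2 * ψ⁻¹ ((μ * (c / 2) + j : ℤ) : ZMod k) *
          ψ ((⌊(2 * d * j : ℝ) / c⌋ + d * μ - ν : ℤ) : ZMod k) *
          f δ k μ ν j (2 * z) s (c / 2) d) =
      Complex.exp (s * poleLog k 1) * (G ψ * H₁ ψ⁻¹ z s -
        (c * z + d) ^ (-s) * κ * G θ⁻¹ * H₁ θ ((a * z + b) / (c * z + d)) s) := by
  obtain ⟨e, he⟩ := hceven.two_dvd
  have hce : c / 2 = e := by omega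
  have he0 : 0 < e := by omega
  rw [hce] at hκ' ⊢
  have hw0 : (c : ℂ) * z + d ≠ 0 := fun h => by simp [h] at hwr
  have hTz := im_mobius_pos hdet hw0 hz
  have hw : (e : ℂ) * (2 * z) + d = c * z + d := by rw [he]; push_cast; ring
  have hz2 : 0 < (2 * z).im := by
    have : (2 * z).im = 2 * z.im := by simp
    rw [this]; positivity
  have hT2 : ((a : ℂ) * (2 * z) + (2 * b : ℤ)) / (e * (2 * z) + d) =
      2 * ((a * z + b) / (c * z + d)) := by
    rw [hw]; push_cast; ring
  have h1 := sum_mul_f hψ hθ hk1 hdet hc hκ hz hwr hδ s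
  have h2 := sum_mul_f (b := 2 * b) hψ hθ hk1 (by rw [← hdet, he]; ring) he0 hκ' hz2
    (by rwa [hw]) (by rwa [hw]) s
  rw [hT2, hw] at h2
  have hfl : ∀ j : ℤ, ⌊(2 * d * j : ℝ) / c⌋ = ⌊(d * j : ℝ) / e⌋ := fun j => by
    rw [he]
    push_cast
    rw [mul_assoc, mul_div_mul_left _ _ (two_ne_zero' ℝ)]
  simp only [Finset.sum_sub_distrib, hfl]
  rw [h1]
  simp only [mul_assoc (2 * ψ⁻¹ 2), ← Finset.mul_sum]
  rw [h2, H₁, H₁, A₁_eq_charSum hk1 _ hz, A₁_eq_charSum hk1 _ hTz, exp_mul_poleLog hw0]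
  linear_combination (2 * Complex.exp (s * poleLog k 1) * (c * z + d) ^ (-s) * G θ⁻¹ *
    (1 + Complex.exp (Real.pi * Complex.I * s)) *
    charSum θ (2 * ((a * z + b) / (c * z + d))) s) * (-hκκ')

end

end CharTransformation

end

theorem mainTheorem9 {k : ℕ} [NeZero k] (hk : Odd k)
    (χ : DirichletCharacter ℂ k) (hχ : χ.IsPrimitive) (hχ1 : χ ≠ 1)
    (a b c d : ℤ) (hdet : a * d - b * c = 1) (hc : 0 < c) (hceven : Even c)
    (z : ℂ) (hz : z ∈ CharTransformation.upperQuarterPlane c d) (s : ℂ) :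
    -- the series and the contour integrals in the formulas are well defined
    (CharTransformation.A₁Converges χ ((a * z + b) / (c * z + d)) s ∧
      CharTransformation.A₁Converges χ z s ∧
      CharTransformation.A₁Converges (CharTransformation.conjChar χ) z s) ∧
    (∃ δ : ℝ, CharTransformation.IsLoopRadius k (c * z + d) δ) ∧
    ∀ δ : ℝ, CharTransformation.IsLoopRadius k (c * z + d) δ →
      (∀ μ ∈ Finset.range k, ∀ ν ∈ Finset.range k,
        (∀ j ∈ Finset.Icc 1 c, CharTransformation.LoopIntegrable δ
          (CharTransformation.fIntegrand k μ ν j z s c d)) ∧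
        (∀ j ∈ Finset.Icc 1 (c / 2), CharTransformation.LoopIntegrable δ
          (CharTransformation.fIntegrand k μ ν j (2 * z) s (c / 2) d))) ∧
      -- the case `a ≡ d ≡ 0 (mod k)`
      ((k : ℤ) ∣ a → (k : ℤ) ∣ d →
        CharTransformation.G (CharTransformation.conjChar χ) * (c * z + d) ^ (-s) *
            CharTransformation.H₁ χ ((a * z + b) / (c * z + d)) s =
          CharTransformation.conjChar χ b * χ c * CharTransformation.G χ *
              CharTransformation.H₁ (CharTransformation.conjChar χ) z s
            - CharTransformation.conjChar χ b * χ c *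
              (-(k : ℂ) / (2 * Real.pi * Complex.I)) ^ s *
              Complex.exp (-Real.pi * Complex.I * s) *
              ∑ μ ∈ Finset.range k, ∑ ν ∈ Finset.range k,
                ((∑ j ∈ Finset.Icc 1 c,
                    CharTransformation.conjChar χ ((μ * c + j : ℤ) : ZMod k) *
                      χ ((⌊(d * j : ℝ) / c⌋ - ν : ℤ) : ZMod k) *
                      CharTransformation.f δ k μ ν j z s c d)
                  - ∑ j ∈ Finset.Icc 1 (c / 2),
                    2 * CharTransformation.conjChar χ 2 *
                      CharTransformation.conjChar χ ((μ * (c / 2) + j : ℤ) : ZMod k) *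
                      χ ((⌊(2 * d * j : ℝ) / c⌋ - ν : ℤ) : ZMod k) *
                      CharTransformation.f δ k μ ν j (2 * z) s (c / 2) d)) ∧
      -- the case `b ≡ c ≡ 0 (mod k)`
      ((k : ℤ) ∣ b → (k : ℤ) ∣ c →
        (c * z + d) ^ (-s) * CharTransformation.G (CharTransformation.conjChar χ) *
            CharTransformation.H₁ χ ((a * z + b) / (c * z + d)) s =
          CharTransformation.conjChar χ a * χ d *
              CharTransformation.G (CharTransformation.conjChar χ) *
              CharTransformation.H₁ χ z s
            - CharTransformation.conjChar χ a * χ d *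
              (-(k : ℂ) / (2 * Real.pi * Complex.I)) ^ s *
              Complex.exp (-Real.pi * Complex.I * s) *
              ∑ μ ∈ Finset.range k, ∑ ν ∈ Finset.range k,
                ((∑ j ∈ Finset.Icc 1 c,
                    χ j *
                      CharTransformation.conjChar χ
                        ((⌊(d * j : ℝ) / c⌋ + d * μ - ν : ℤ) : ZMod k) *
                      CharTransformation.f δ k μ ν j z s c d)
                  - ∑ j ∈ Finset.Icc 1 (c / 2),
                    2 * χ 2 * χ j *
                      CharTransformation.conjChar χ
                        ((⌊(2 * d * j : ℝ) / c⌋ + d * μ - ν : ℤ) : ZMod k) *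
                      CharTransformation.f δ k μ ν j (2 * z) s (c / 2) d)) := by
  have hk0 : 0 < k := NeZero.pos k
  have hk1 : k ≠ 1 := by
    rintro rfl
    exact hχ1 (DirichletCharacter.level_one χ)
  have hzi : 0 < z.im := hz.2
  have hcR : (0 : ℝ) < c := by exact_mod_cast hc
  have hwr : 0 < ((c : ℂ) * z + d).re := by
    have h1 : ((c : ℂ) * z + d).re = c * z.re + d := by simp
    have h2 : -(d : ℝ) / c < z.re := hz.1
    rw [div_lt_iff₀ hcR] at h2
    rw [h1]; linarith
  have hwi : 0 < ((c : ℂ) * z + d).im := by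
    have : ((c : ℂ) * z + d).im = c * z.im := by simp
    rw [this]; positivity
  have hw0 : (c : ℂ) * z + d ≠ 0 := fun h => by simp [h] at hwr
  obtain ⟨e, he⟩ := hceven.two_dvd
  have hce : c / 2 = e := by omega
  have hw2 : ((c / 2 : ℤ) : ℂ) * (2 * z) + d = c * z + d := by
    rw [hce, he]; push_cast; ring
  rw [CharTransformation.conjChar_eq_inv]
  refine ⟨⟨CharTransformation.A₁Converges_of_im_pos χ
      (CharTransformation.im_mobius_pos hdet hw0 hzi) s,
    CharTransformation.A₁Converges_of_im_pos χ hzi s,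
    CharTransformation.A₁Converges_of_im_pos χ⁻¹ hzi s⟩,
    CharTransformation.exists_isLoopRadius hk0 hwr hwi, fun δ hδ => ⟨?_, ?_, ?_⟩⟩
  · intro μ hμ ν hν
    rw [Finset.mem_range] at hμ hν
    refine ⟨fun j hj => ?_, fun j hj => ?_⟩
    · rw [Finset.mem_Icc] at hj
      exact CharTransformation.loopIntegrable_fIntegrand hk0 hμ hν hc hj.1 hj.2 hwr hwi hδ s
    · rw [Finset.mem_Icc] at hj
      exact CharTransformation.loopIntegrable_fIntegrand hk0 hμ hν (by omega) hj.1 hj.2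
        (by rwa [hw2]) (by rwa [hw2]) (by rwa [hw2]) s
  · intro ha hd
    have hbc : IsUnit ((b * c : ℤ) : ZMod k) := by
      have h : b * c = d * a + (-1) := by linear_combination -hdet
      rw [h, CharTransformation.intCast_mul_add_mul_of_dvd hd]
      push_cast
      exact isUnit_one.neg
    -- The prefactor of the formula is the inverse of `κ`; here `bc ≡ -1` modulo `k`.
    have hunit : χ⁻¹ b * χ c * (χ⁻¹ c * χ b) = 1 := by
      have := CharTransformation.inv_apply_mul_apply χ hbc
      push_cast at this
      rw [map_mul, map_mul] at this
      linear_combination this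
    have hκ : ∀ N y : ℤ, χ⁻¹ (a * N + c * y : ℤ) * χ (b * N + d * y : ℤ) =
        χ⁻¹ c * χ b * (χ N * χ⁻¹ y) := fun N y => by
      rw [CharTransformation.intCast_mul_add_mul_of_dvd ha, add_comm (b * N),
        CharTransformation.intCast_mul_add_mul_of_dvd hd]
      push_cast
      rw [map_mul, map_mul]
      ring
    have hκ' : ∀ N y : ℤ, χ⁻¹ (a * N + c / 2 * y : ℤ) * χ (2 * b * N + d * y : ℤ) =
        χ⁻¹ (c / 2 : ℤ) * χ (2 * b : ℤ) * (χ N * χ⁻¹ y) := fun N y => by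
      rw [CharTransformation.intCast_mul_add_mul_of_dvd ha, add_comm (2 * b * N),
        CharTransformation.intCast_mul_add_mul_of_dvd hd, Int.cast_mul, Int.cast_mul (2 * b),
        map_mul, map_mul]
      ring
    have hκκ' : χ⁻¹ 2 * (χ⁻¹ (c / 2 : ℤ) * χ (2 * b : ℤ)) = χ 2 * (χ⁻¹ c * χ b) := by
      rw [hce, he]
      push_cast
      rw [map_mul, map_mul]
      ring
    -- The term `dμ` of the general formula disappears because `k ∣ d`.
    have hco : ∀ x μ ν : ℤ, ((x + d * μ - ν : ℤ) : ZMod k) = (x - ν : ℤ) := fun x μ ν => by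
      have : x + d * μ - ν = d * μ + (x - ν) := by ring
      rw [this, CharTransformation.intCast_mul_add_mul_of_dvd hd]
    have h := CharTransformation.sum_mul_f_sub_sum_mul_f hχ hχ hk1 hdet hc hceven hκ hκ' hκκ' hzi
      hwr hδ s
    simp only [hco] at h
    rw [h, mul_assoc (χ⁻¹ b * χ c) (_ ^ s), CharTransformation.neg_div_two_pi_I_cpow hk0,
      mul_assoc (χ⁻¹ b * χ c) (_⁻¹), inv_mul_cancel_left₀ (Complex.exp_ne_zero _)]
    linear_combination (-((c * z + d) ^ (-s) * CharTransformation.G χ⁻¹ *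
      CharTransformation.H₁ χ ((a * z + b) / (c * z + d)) s)) * hunit
  · intro hb hc'
    -- Oddness of `k` lets the factor `2` be cancelled, so the second matrix satisfies the same
    -- congruences.
    have hke : (k : ℤ) ∣ c / 2 := by
      rw [hce]
      rw [he] at hc'
      refine IsCoprime.dvd_of_dvd_mul_left ?_ hc'
      exact_mod_cast Nat.isCoprime_iff_coprime.2 (Nat.coprime_two_right.2 hk)
    have had : IsUnit ((a * d : ℤ) : ZMod k) := by
      have h : a * d = c * b + 1 := by linear_combination hdet
      rw [h, CharTransformation.intCast_mul_add_mul_of_dvd hc']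
      push_cast
      exact isUnit_one
    have hunit : χ⁻¹ a * χ d * (χ a * χ⁻¹ d) = 1 := by
      have := CharTransformation.inv_apply_mul_apply χ had
      push_cast at this
      rw [map_mul, map_mul] at this
      linear_combination this
    have hκ : ∀ x y N t : ℤ, (k : ℤ) ∣ x → (k : ℤ) ∣ y →
        χ⁻¹⁻¹ (a * N + x * t : ℤ) * χ⁻¹ (y * N + d * t : ℤ) =
          χ a * χ⁻¹ d * (χ N * χ⁻¹ t) := fun x y N t hx hy => by
      rw [CharTransformation.intCast_mul_add_mul_of_dvd hy, add_comm (a * N),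
        CharTransformation.intCast_mul_add_mul_of_dvd hx, inv_inv]
      push_cast
      rw [map_mul, map_mul]
      ring
    have hco : ∀ (x : ℤ) (μ : ℕ) (j : ℤ), (k : ℤ) ∣ x →
        ((μ * x + j : ℤ) : ZMod k) = j := fun x μ j hx => by
      rw [mul_comm, CharTransformation.intCast_mul_add_mul_of_dvd hx]
    have h := CharTransformation.sum_mul_f_sub_sum_mul_f
      (CharTransformation.isPrimitive_inv hχ) hχ hk1 hdet hc hceven
      (fun N y => hκ c b N y hc' hb) (fun N y => hκ (c / 2) (2 * b) N y hke (hb.mul_left 2))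
      (by rw [inv_inv]) hzi hwr hδ s
    simp only [hco _ _ _ hc', hco _ _ _ hke, inv_inv] at h
    rw [h, mul_assoc (χ⁻¹ a * χ d) (_ ^ s), CharTransformation.neg_div_two_pi_I_cpow hk0,
      mul_assoc (χ⁻¹ a * χ d) (_⁻¹), inv_mul_cancel_left₀ (Complex.exp_ne_zero _)]
    linear_combination (-((c * z + d) ^ (-s) * CharTransformation.G χ⁻¹ *
      CharTransformation.H₁ χ ((a * z + b) / (c * z + d)) s)) * hunit
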